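/- All systems are finite-dimensional. For a matrix $M$ let $\|M\|_1=\mathrm{Tr}\sqrt{M^\dagger M}$. For sub-normalized states ($\rho\ge 0$, $\mathrm{Tr}\,\rho\le 1$) let $F(\rho,\tau)=\|\sqrt\rho\sqrt\tau\|_1+\sqrt{(1-\mathrm{Tr}\rho)(1-\mathrm{Tr}\tau)}$ and $P(\rho,\tau)=\sqrt{1-F(\rho,\tau)^2}$. $H_{\min}(\rho_{AE}|E)$ is the largest $\lambda$ with $\rho_{AE}\le 2^{-\lambda}\,\mathbb 1_A\otimes\sigma_E$ for some normalized state $\sigma_E$, and $H_{\min}^{\varepsilon}(\rho_{AE}|E)$ is the maximum of $H_{\min}(\bar\rho_{AE}|E)$ over sub-normalized $\bar\rho_{AE}$ with $P(\bar\rho_{AE},\rho_{AE})\le\varepsilon$. A random function $f$ into $\{0,1\}^k$ is universal$_2$ if $\Pr(f(x)=f(y))\le 2^{-k}$ for all $x\ne y$. Consider a QKD scheme of the following form. (0) The initial (sub-normalized) state is on $A'B'E$, where $E$ is Eve's. (1) Sample measurement: Alice and Bob measure $A'B'$, announce a message (stored in Eve's system), and continue only on certain outcomes. (2) Sifted key measurement: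 Alice measures $A'$ and Bob measures $B'$, obtaining $a,b\in\{0,1\}^n$; $\rho^{\rm sif}_{AE}$ is the resulting sub-normalized state of $a$ and Eve. (3) Information reconciliation: exchanging one-time-pad encrypted messages, Bob produces $b^{\rm cor}$ from $b$; Alice announces a universal$_2$ function $u:\{0,1\}^n\to\{0,1\}^l$ and sends $u(a)$ one-time-pad encrypted, and a key is output only if $u(a)=u(b^{\rm cor})$. (4) Privacy amplification: Alice announces, in a register $G$, a universal$_2$ hash function $g:\{0,1\}^n\to\{0,1\}^m$, each $g$ being linear and surjective; the keys are $k=g(a)$, $k'=g(b^{\rm cor})$. Let $\rho^{\rm fin}_{KK'EG}$ be the final sub-normalized state ($E$ comprises all that Eve holds, the cipher texts and $u$ included), and $$D_1(\rho^{\rm fin}_{KK'EG})=\Big\|\rho^{\rm fin}_{KK'EG}-2^{-m}\sum_k|k\rangle\langle k|_K\otimes|k\rangle\langle k|_{K'}\otimes\rho^{\rm fin}_E\otimes\sum_g\Pr(G=g)|g\rangle\langle g|_G\Big\|_1 .$$ For a state $\rho_{KEG}$ let $d_1(\rho_{KEG})=\|\rho_{KEG}-2^{-m}\,\mathbb 1_K\otimes\rho_E\otimes\sum_g\Pr(G=g)|g\rangle\langle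 g|_G\|_1$. Assume $H_{\min}^{\varepsilon'''}(\rho^{\rm sif}_{AE}|E)\ge H^{\rm th}_{\min}$ for a real number $H^{\rm th}_{\min}$. Then $$D_1(\rho^{\rm fin}_{KK'EG})\le 2^{-l+1}+2\varepsilon'''+2^{\frac12[m-H_{\min}^{\rm th}+3]} .$$ Moreover, the following virtual scheme exists. The initial state has a purification. From any purification, carrying out the sample measurement and Alice's sifted key measurement coherently (isometries recording the outcomes in ancillas, then projection onto the accepted outcomes) gives a vector that is a semi-purification of $\rho^{\rm sif}_{AE}$: measuring $A$ of its reduced state on $AE$ in the $Z$ basis gives $\rho^{\rm sif}_{AE}$. Let $|\Phi\rangle_{AEC}$ be any semi-purification of $\rho^{\rm sif}_{AE}$. For each $g$ let $h$ be a full-rank $(n-m)\times n$ matrix with $hg^T=0$, and for each $g$ and $s\in\{0,1\}^{n-m}$ let $\{E^{g,s,e}\}_{e\in\{0,1\}^n}$ be any measurement ($\sum_e E^{g,s,e\dagger}E^{g,s,e}=\mathbb 1$) of the ancilla introduced below. Twirl, i.e. add an $n$-qubit register $T$ in $|0\rangle$ and apply $\sum_z|z\rangle\langle z|_A\otimes X^z_T$;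 choose $g$ with probability $\Pr(G=g)$; perform phase error correction: measure the syndrome $s$ of the operators $X^{h_j}$ on $A$, measure the ancilla $CT$ with $\{E^{g,s,e}\}_e$, apply $Z^e$ to $A$; finally measure $Z^{g_1},\dots,Z^{g_m}$ on $A$ and store the outcome $k$ in $K$. Then: the twirled vector is a purification of $\rho^{\rm sif}_{AE}$; the final state $\rho^{\rm vir}_{KEG}$ equals the reduced state of the actual scheme on Alice's key, Eve's system before step (3), and $G$, when the outcome of the verification is disregarded; with $P^{\rm ph}_g=1-\langle\tilde 0|\rho_A|\tilde 0\rangle$ the phase error probability after the error correction for $g$, where $|\tilde 0\rangle=2^{-n/2}\sum_z|z\rangle$, one has $d_1(\rho^{\rm vir}_{KEG})\le 2\sqrt2\,\big(\sum_g\Pr(G=g)P^{\rm ph}_g\big)^{1/2}$; and $d_1(\rho^{\rm vir}_{KEG})\le 2\varepsilon'''+2^{\frac12[m-H_{\min}^{\rm th}+3]}$. -/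

import Mathlib

open scoped Matrix Kronecker ComplexOrder MatrixOrder

noncomputable section

namespace QKD

/-! ### Finite-dimensional states, norms and entropies

A system with an orthonormal basis indexed by a finite type `α` is represented by `α`;
operators are matrices, and composite systems are products of index types. -/

/-- Bit strings of length `d`, with addition modulo two. -/
abbrev Bits (d : ℕ) : Type := Fin d → ZMod 2

section States

variable {α β : Type*} [Fintype α] [DecidableEq α] [Fintype β] [DecidableEq β]

/-- The rank one projection `|i⟩⟨i|` onto a basis vector. -/
def proj {α : Type*} [DecidableEq α] (i : α) : Matrix α α ℂ := Matrix.single i i 1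

/-- The density operator `|ψ⟩⟨ψ|` of a vector. -/
def pureState {α : Type*} (ψ : α → ℂ) : Matrix α α ℂ := Matrix.vecMulVec ψ (star ψ)

/-- Partial trace over the first factor. -/
def trFst (ρ : Matrix (α × β) (α × β) ℂ) : Matrix β β ℂ :=
  fun i j => ∑ x, ρ (x, i) (x, j)

/-- Partial trace over the second factor. -/
def trSnd (ρ : Matrix (α × β) (α × β) ℂ) : Matrix α α ℂ :=
  fun i j => ∑ x, ρ (i, x) (j, x)

/-- Sub-normalized states. -/
def IsSubnormalized (ρ : Matrix α α ℂ) : Prop := ρ.PosSemidef ∧ ρ.trace.re ≤ 1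

/-- The trace norm `‖M‖₁ = Tr √(M† M)`. -/
def traceNorm (M : Matrix α α ℂ) : ℝ := (CFC.sqrt (Mᴴ * M)).trace.re

/-- Generalized fidelity of sub-normalized states. -/
def fidelity (ρ τ : Matrix α α ℂ) : ℝ :=
  traceNorm (CFC.sqrt ρ * CFC.sqrt τ) + √((1 - ρ.trace.re) * (1 - τ.trace.re))

/-- Purified distance of sub-normalized states. -/
def purifiedDistance (ρ τ : Matrix α α ℂ) : ℝ := √(1 - fidelity ρ τ ^ 2)

/-- Conditional min-entropy `H_min(ρ_AE | E)` (an extended real, `⊤` for `ρ = 0`): the largest `r`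
such that `ρ_AE ≤ 2^{-r} 1_A ⊗ σ_E` for some normalized state `σ_E`. -/
def minEntropy (ρ : Matrix (α × β) (α × β) ℂ) : EReal :=
  sSup {x | ∃ r : ℝ, x = (r : EReal) ∧ ∃ σ : Matrix β β ℂ, σ.PosSemidef ∧ σ.trace = 1 ∧
    ρ ≤ ((2 : ℝ) ^ (-r)) • ((1 : Matrix α α ℂ) ⊗ₖ σ)}

/-- Smooth conditional min-entropy `H_min^ε(ρ_AE | E)`. -/
def smoothMinEntropy (ε : ℝ) (ρ : Matrix (α × β) (α × β) ℂ) : EReal :=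
  sSup {x | ∃ τ : Matrix (α × β) (α × β) ℂ,
    IsSubnormalized τ ∧ purifiedDistance τ ρ ≤ ε ∧ x = minEntropy τ}

end States

/-- A random function `f` with values in `{0,1}^k`, where `f i` has probability `p i`, is
universal₂. -/
def IsUniversal₂ {ι X : Type*} [Fintype ι] {k : ℕ} (p : ι → ℝ) (f : ι → X → Bits k) : Prop :=
  ∀ x y, x ≠ y → ∑ i, p i * (if f i x = f i y then 1 else 0) ≤ (2 : ℝ) ^ (-(k : ℝ))

/-! ### Security measures -/

section Security

variable {m : ℕ} {E 𝒢 : Type*} [Fintype E] [DecidableEq E] [Fintype 𝒢] [DecidableEq 𝒢]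

/-- The state `∑_g Pr(G = g) |g⟩⟨g|` of the public register holding the hash function. -/
def hashState (p : 𝒢 → ℝ) : Matrix 𝒢 𝒢 ℂ := ∑ g, p g • proj g

/-- `d₁(ρ_KEG)`: distance of Alice's key from a uniform key independent of Eve. -/
def d₁ (p : 𝒢 → ℝ) (ρ : Matrix (Bits m × E × 𝒢) (Bits m × E × 𝒢) ℂ) : ℝ :=
  traceNorm (ρ - ∑ k : Bits m, ((2 : ℝ) ^ (-(m : ℝ))) •
    (proj k ⊗ₖ (trSnd (trFst ρ) ⊗ₖ hashState p)))

/-- `D₁(ρ_KK'EG)`: distance from a pair of identical uniform keys independent of Eve. -/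
def D₁ (p : 𝒢 → ℝ)
    (ρ : Matrix (Bits m × Bits m × E × 𝒢) (Bits m × Bits m × E × 𝒢) ℂ) : ℝ :=
  traceNorm (ρ - ∑ k : Bits m, ((2 : ℝ) ^ (-(m : ℝ))) •
    (proj k ⊗ₖ (proj k ⊗ₖ (trSnd (trFst (trFst ρ)) ⊗ₖ hashState p))))

end Security

/-! ### The actual QKD scheme -/

/-- Writing the public message `t` in a fresh register of Eve's system `E`. -/
def announce (E : Type*) {T : Type*} [DecidableEq E] [DecidableEq T] (t : T) : Matrix (E × T) E ℂ :=
  fun x e => if x.1 = e ∧ x.2 = t then 1 else 0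

/-- A general QKD scheme: initial state on `A'B'E`, sample measurement, sifted key measurement,
error correction and verification over a one-time-pad encrypted channel, privacy amplification.
Here `n`, `m`, `l`, `c` are the lengths of the sifted key, of the final key, of the verification
tag and of the messages sent in the error correction. -/
structure Scheme (n m l c : ℕ) (A' B' E T R I J 𝒰 𝒢 : Type*)
    [Fintype A'] [DecidableEq A'] [Fintype B'] [DecidableEq B'] [Fintype E] [DecidableEq E]
    [Fintype R] [Fintype I] [Fintype J] [Fintype 𝒰] [Fintype 𝒢] where
  /-- The initial state. -/
  ini : Matrix ((A' × B') × E) ((A' × B') × E) ℂ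
  ini_sub : IsSubnormalized ini
  /-- Sample measurement with outcomes in `R`. Arbitrary joint measurement operators are allowed;
  this contains local measurements and public discussion. -/
  smp : R → Matrix (A' × B') (A' × B') ℂ
  smp_sum : ∑ r, (smp r)ᴴ * smp r = 1
  /-- The outcomes on which the protocol is continued. -/
  accept : Finset R
  /-- The public announcement made on each outcome. -/
  ann : R → T
  /-- Alice's sifted key measurement; the outcome is the sifted key and a discarded index. -/
  sifA : Bits n → I → Matrix A' A' ℂ
  sifA_sum : ∑ a, ∑ i, (sifA a i)ᴴ * sifA a i = 1
  /-- Bob's sifted key measurement. -/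
  sifB : Bits n → J → Matrix B' B' ℂ
  sifB_sum : ∑ b, ∑ j, (sifB b j)ᴴ * sifB b j = 1
  /-- Error correction: `ec a b (w, b')` is the probability that, on sifted keys `a` and `b`,
  the plain text of the exchanged messages is `w` and Bob's corrected key is `b'`. -/
  ec : Bits n → Bits n → Bits c × Bits n → ℝ
  ec_prob : ∀ a b, ec a b ∈ stdSimplex ℝ (Bits c × Bits n)
  /-- The random verification function. -/
  pU : 𝒰 → ℝ
  pU_prob : pU ∈ stdSimplex ℝ 𝒰
  u : 𝒰 → Bits n → Bits l
  u_univ : IsUniversal₂ pU u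
  /-- The random hash function of the privacy amplification. -/
  pG : 𝒢 → ℝ
  pG_prob : pG ∈ stdSimplex ℝ 𝒢
  g : 𝒢 → Bits n →ₗ[ZMod 2] Bits m
  g_surj : ∀ i, Function.Surjective (g i)
  g_univ : IsUniversal₂ pG (fun i => ⇑(g i))

/-! ### Virtual privacy amplification with phase error correction -/

section Virtual

variable {n m : ℕ}

/-- `(-1)^{x·z}`. -/
def sign (x z : Bits n) : ℂ := (-1) ^ (x ⬝ᵥ z).val

/-- The phase basis vector `|x̃⟩ = 2^{-n/2} ∑_z (-1)^{x·z} |z⟩`. -/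
def phaseKet (x : Bits n) : Bits n → ℂ := fun z => ((2 : ℝ) ^ (-(n : ℝ) / 2) : ℝ) * sign x z

/-- The Pauli operator `Z^e`. -/
def pauliZ (e : Bits n) : Matrix (Bits n) (Bits n) ℂ := Matrix.diagonal (sign e)

/-- The Pauli operator `X^x`, i.e. `X^x |z⟩ = |z + x⟩`. -/
def pauliX (x : Bits n) : Matrix (Bits n) (Bits n) ℂ :=
  Matrix.of fun y z => if y = z + x then 1 else 0

variable {E C : Type*} [Fintype E] [DecidableEq E] [Fintype C] [DecidableEq C]

/-- Reduced state on `AE` of a pure state on `AEC`. -/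
def reducedAE (ψ : Bits n × E × C → ℂ) : Matrix (Bits n × E) (Bits n × E) ℂ :=
  fun x y => ∑ z, pureState ψ (x.1, x.2, z) (y.1, y.2, z)

/-- Measurement of `A` in the `Z` basis (erasure of the off-diagonal blocks). -/
def zMeasure (ρ : Matrix (Bits n × E) (Bits n × E) ℂ) : Matrix (Bits n × E) (Bits n × E) ℂ :=
  ∑ z : Bits n, (proj z ⊗ₖ (1 : Matrix E E ℂ)) * ρ * (proj z ⊗ₖ (1 : Matrix E E ℂ))

def IsPurification (ψ : Bits n × E × C → ℂ) (ρ : Matrix (Bits n × E) (Bits n × E) ℂ) : Prop :=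
  reducedAE ψ = ρ

def IsSemiPurification (ψ : Bits n × E × C → ℂ) (ρ : Matrix (Bits n × E) (Bits n × E) ℂ) :
    Prop :=
  zMeasure (reducedAE ψ) = ρ

/-- Twirling: a fresh `n`-qubit ancilla `|0⟩` is added and `∑_z |z⟩⟨z|_A ⊗ X^z` is applied. -/
def twirl (ψ : Bits n × E × C → ℂ) : Bits n × E × (C × Bits n) → ℂ :=
  fun x => pauliX x.1 x.2.2.2 0 * ψ (x.1, x.2.1, x.2.2.1)

/-- `h` is a check matrix of the code generated by the rows of the matrix of `g`. -/
def IsCheckMatrix (g : Bits n →ₗ[ZMod 2] Bits m) (h : Matrix (Fin (n - m)) (Fin n) (ZMod 2)) :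
    Prop :=
  LinearIndependent (ZMod 2) h.row ∧ h * (LinearMap.toMatrix' g)ᵀ = 0

/-- Projection onto the joint eigenspace of `X^{h_1}, …, X^{h_{n-m}}` with syndrome `s`, i.e.
onto the span of the phase basis vectors `|x̃⟩` with `h x = s`. -/
def syndromeProj (h : Matrix (Fin (n - m)) (Fin n) (ZMod 2)) (s : Bits (n - m)) :
    Matrix (Bits n) (Bits n) ℂ :=
  ∑ x : Bits n, if h *ᵥ x = s then pureState (phaseKet x) else 0

/-- Phase error correction: measure the syndrome `s` on `A`, measure the ancilla `C` with the
operators `M s e`, and flip phases by `Z^e`. -/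
def pec (h : Matrix (Fin (n - m)) (Fin n) (ZMod 2)) (M : Bits (n - m) → Bits n → Matrix C C ℂ)
    (ρ : Matrix (Bits n × E × C) (Bits n × E × C) ℂ) :
    Matrix (Bits n × E × C) (Bits n × E × C) ℂ :=
  ∑ s, ∑ e, ((pauliZ e * syndromeProj h s) ⊗ₖ ((1 : Matrix E E ℂ) ⊗ₖ M s e)) * ρ *
    ((pauliZ e * syndromeProj h s) ⊗ₖ ((1 : Matrix E E ℂ) ⊗ₖ M s e))ᴴ

/-- The phase error probability `1 - ⟨0̃|ρ_A|0̃⟩` of `A`. -/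
def phaseError (ρ : Matrix (Bits n × E × C) (Bits n × E × C) ℂ) : ℝ :=
  1 - (star (phaseKet 0) ⬝ᵥ (trSnd ρ *ᵥ phaseKet 0)).re

/-- Projection of `A` onto the strings with hash value `k`: the joint eigenspace of
`Z^{g_1}, …, Z^{g_m}` with eigenvalues `(-1)^{k_i}`. -/
def bitProj (g : Bits n →ₗ[ZMod 2] Bits m) (k : Bits m) : Matrix (Bits n) (Bits n) ℂ :=
  Matrix.diagonal fun a => if g a = k then 1 else 0

/-- Bit basis measurement, storing the hash value in `K`, reduced to `KE`. -/
def bitMeasure (g : Bits n →ₗ[ZMod 2] Bits m)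
    (ρ : Matrix (Bits n × E × C) (Bits n × E × C) ℂ) : Matrix (Bits m × E) (Bits m × E) ℂ :=
  ∑ k, proj k ⊗ₖ trSnd (trFst
    ((bitProj g k ⊗ₖ (1 : Matrix (E × C) (E × C) ℂ)) * ρ *
      (bitProj g k ⊗ₖ (1 : Matrix (E × C) (E × C) ℂ))))

end Virtual

namespace Scheme

variable {n m l c : ℕ} {A' B' E T R I J 𝒰 𝒢 : Type*}
  [Fintype A'] [DecidableEq A'] [Fintype B'] [DecidableEq B'] [Fintype E] [DecidableEq E]
  [Fintype T] [DecidableEq T] [Fintype R] [DecidableEq R] [Fintype I] [Fintype J]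
  [Fintype 𝒰] [DecidableEq 𝒰] [Fintype 𝒢] [DecidableEq 𝒢]
  (S : Scheme n m l c A' B' E T R I J 𝒰 𝒢)

/-- The sub-normalized state after the sample measurement (protocol continued). Eve holds `E`
and the announcement. -/
def sampled : Matrix ((A' × B') × (E × T)) ((A' × B') × (E × T)) ℂ :=
  ∑ r ∈ S.accept,
    (S.smp r ⊗ₖ announce E (S.ann r)) * S.ini * (S.smp r ⊗ₖ announce E (S.ann r))ᴴ

/-- Eve's sub-normalized state when the sifted keys are `a` and `b`. -/
def siftedBlock (a b : Bits n) : Matrix (E × T) (E × T) ℂ :=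
  trFst (∑ i, ∑ j, ((S.sifA a i ⊗ₖ S.sifB b j) ⊗ₖ (1 : Matrix (E × T) (E × T) ℂ)) * S.sampled *
    ((S.sifA a i ⊗ₖ S.sifB b j) ⊗ₖ (1 : Matrix (E × T) (E × T) ℂ))ᴴ)

/-- The state `ρ_AE^sif` of Alice's sifted key and Eve. -/
def siftedAE : Matrix (Bits n × (E × T)) (Bits n × (E × T)) ℂ :=
  ∑ a, ∑ b, proj a ⊗ₖ S.siftedBlock a b

/-- The part of the final state `ρ_KK'EG` in which the outcome of the verification is `ok`.
Besides `E` and the announcement, Eve holds the verification function and the cipher texts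
`w + x` and `u(a) + y` of the error correction messages `w` and of the verification tag `u(a)`;
`x` and `y` are uniform secret one-time-pad keys. -/
def finalBranch (ok : Bool) :
    Matrix (Bits m × Bits m × ((E × T) × (𝒰 × Bits c × Bits l)) × 𝒢)
      (Bits m × Bits m × ((E × T) × (𝒰 × Bits c × Bits l)) × 𝒢) ℂ :=
  ∑ g, ∑ u, ∑ a, ∑ b, ∑ w, ∑ b', ∑ x : Bits c, ∑ y : Bits l,
    (S.pG g * S.pU u * S.ec a b (w, b') * (2 : ℝ) ^ (-(c : ℝ)) * (2 : ℝ) ^ (-(l : ℝ)) *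
      (if decide (S.u u a = S.u u b') = ok then 1 else 0)) •
    (proj (S.g g a) ⊗ₖ (proj (S.g g b') ⊗ₖ
      ((S.siftedBlock a b ⊗ₖ (proj u ⊗ₖ (proj (w + x) ⊗ₖ proj (S.u u a + y)))) ⊗ₖ proj g)))

/-- The final sub-normalized state `ρ_KK'EG^fin`: the verification has succeeded. -/
def final : Matrix (Bits m × Bits m × ((E × T) × (𝒰 × Bits c × Bits l)) × 𝒢)
      (Bits m × Bits m × ((E × T) × (𝒰 × Bits c × Bits l)) × 𝒢) ℂ :=
  S.finalBranch true

/-- Reduced state of Alice's final key, Eve's system `E` with the announcement, and `G`,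
irrespective of what Bob does: both outcomes of the verification are kept, and `K'` and the
registers written during the information reconciliation are traced out. -/
def finalAlice : Matrix (Bits m × (E × T) × 𝒢) (Bits m × (E × T) × 𝒢) ℂ :=
  fun p q => ∑ k', ∑ z,
    (S.finalBranch true + S.finalBranch false)
      (p.1, k', (p.2.1, z), p.2.2) (q.1, k', (q.2.1, z), q.2.2)

/-- The pure state prepared in the virtual schemes from a purification `ψ` of the initial state
with ancilla `P`: the sample measurement and Alice's sifted key measurement are carried out
coherently (by isometries that record the outcomes in ancillas), and the outcomes of the sample
measurement are projected onto the accepted ones. -/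
def prepared {P : Type*} (ψ : ((A' × B') × E) × P → ℂ) :
    Bits n × (E × T) × ((A' × B') × P × R × I) → ℂ :=
  fun (a, (e, t), (z, p, r, i)) =>
    if r ∈ S.accept ∧ t = S.ann r then
      ∑ z', ((S.sifA a i ⊗ₖ (1 : Matrix B' B' ℂ)) * S.smp r) z z' * ψ ((z', e), p)
    else 0

/-- The final state on `KEG` of the virtual scheme with twirling and phase error correction,
run on the prepared state `φ`, with check matrices `h` and ancilla measurements `M`. -/
def virtualFinal {C : Type*} [Fintype C] [DecidableEq C]
    (h : 𝒢 → Matrix (Fin (n - m)) (Fin n) (ZMod 2))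
    (M : 𝒢 → Bits (n - m) → Bits n → Matrix (C × Bits n) (C × Bits n) ℂ)
    (φ : Bits n × (E × T) × C → ℂ) :
    Matrix (Bits m × (E × T) × 𝒢) (Bits m × (E × T) × 𝒢) ℂ :=
  (∑ g, S.pG g • (bitMeasure (S.g g) (pec (h g) (M g) (pureState (twirl φ))) ⊗ₖ proj g)).submatrix
    (Equiv.prodAssoc _ _ _).symm (Equiv.prodAssoc _ _ _).symm

end Scheme

end QKD

end

set_option linter.unusedSectionVars false

open scoped Matrix Kronecker ComplexOrder MatrixOrder

noncomputable section

namespace QKD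

/-! ### Contractions, Hilbert–Schmidt norm and the trace norm -/

section Contraction

variable {α β γ : Type*} [Fintype α] [DecidableEq α] [Fintype β] [DecidableEq β]
  [Fintype γ] [DecidableEq γ]

/-! The trace norm of M is attained as Re Tr(UM) on a contraction U, and for an operator that is
block diagonal in classical registers only the diagonal blocks of U matter
(`traceNorm_le_of_blocks`). Bounding `D₁` and `d₁` thus amounts to bounding sums ∑_g p_g ∑_k Re
Tr(V_{g,k} ∑_a (1[g(a)=k] − 2^{-m}) τ_a), uniformly over contractions V.

Leftover hashing bounds such a sum. For v ≠ 0, universality gives Pr(g(v)=0) ≤ 2^{-m}, while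
surjectivity makes the deviations Pr(g(v)=0) − 2^{-m} sum to zero over all v. Their absolute values
therefore sum to at most 2, and hashing has small variance (`sum_hashDev_norm_sq_le`). Smoothing is
done on square roots: if ρ' is close to ρ with fidelity F, then √ρ = N + F √ρ' W with W a
contraction and ‖N‖² ≤ 1 − F² in Hilbert–Schmidt norm (`exists_contraction_fidelity`). The term NN†
costs at most 2ε, and all remaining terms contain a factor √ρ', to which Cauchy–Schwarz and the
min-entropy of ρ' apply (`leftover_hashing`). The argument is carried out for every τ ≤ ρ, because
the verified part of the sifted state is only dominated by that state.

For the actual scheme, the accepted state splits into the part with a correct key, which is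
dominated by the sifted state and has k = k', and the part in which verification accepts a wrong
key. The latter has weight at most 2^{-l} by universality of u, and it is counted in the real and in
the ideal state, which gives 2^{-l+1} (`sum_keyBlock_dev_le`).

For the virtual scheme, twirling erases coherences between different sifted keys, and h gᵀ = 0 makes
the syndrome measurement commute with the measurement of the hash value, so phase error correction
leaves the joint state of key and Eve untouched (`trace_bitProj_mul_pec`). The virtual state is then
the actual one and inherits the leftover hashing bound. Independently, if A were exactly in |0̃⟩,
the hash value would be uniform and uncorrelated with Eve; a gentle measurement estimate turns the
phase error probability into a distance (`sum_trace_bitProj_dev_le`). -/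

/-- A matrix `U` with `U U† ≤ 1`. -/
def IsContraction (U : Matrix α β ℂ) : Prop := (1 - U * Uᴴ).PosSemidef

/-- If `B B† ≤ A` with `A` positive definite then `B† A⁻¹ B ≤ 1`. -/
lemma posSemidef_one_sub_conj_inv {A : Matrix α α ℂ} (hA : A.PosDef) (B : Matrix α β ℂ)
    (h : (A - B * Bᴴ).PosSemidef) : (1 - Bᴴ * A⁻¹ * B).PosSemidef := by
  have : Invertible A := hA.isUnit.invertible
  have : Invertible (1 : Matrix β β ℂ) := invertibleOne
  -- Both inequalities are Schur complement conditions for positivity of the same block matrix with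
  -- rows (A, B) and (B†, 1).
  rw [← Matrix.PosDef.fromBlocks₁₁ B 1 hA]
  rw [Matrix.PosDef.fromBlocks₂₂ A B Matrix.PosDef.one]
  simpa using h

lemma IsContraction.conjTranspose {U : Matrix α β ℂ} (hU : IsContraction U) :
    IsContraction Uᴴ := by
  have := posSemidef_one_sub_conj_inv (A := 1) Matrix.PosDef.one U hU
  simpa [IsContraction] using this

lemma IsContraction.neg {U : Matrix α β ℂ} (hU : IsContraction U) : IsContraction (-U) := by
  simpa [IsContraction] using hU

lemma IsContraction.mul {U : Matrix α β ℂ} {V : Matrix β γ ℂ} (hU : IsContraction U)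
    (hV : IsContraction V) : IsContraction (U * V) := by
  have h : 1 - (U * V) * (U * V)ᴴ = (1 - U * Uᴴ) + U * (1 - V * Vᴴ) * Uᴴ := by
    simp only [Matrix.conjTranspose_mul, Matrix.mul_sub, Matrix.sub_mul, Matrix.mul_one,
      Matrix.mul_assoc]
    abel
  rw [IsContraction, h]
  exact Matrix.PosSemidef.add hU (hV.mul_mul_conjTranspose_same U)

lemma isContraction_of_conjTranspose_mul_self {J : Matrix α β ℂ} (h : Jᴴ * J = 1) :
    IsContraction J := by
  have : IsContraction Jᴴ := by
    simp [IsContraction, h, Matrix.PosSemidef.zero]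
  simpa using this.conjTranspose

/-- An injective index map gives an isometry J, and the submatrix is the compression J† U J. -/
lemma IsContraction.submatrix {U : Matrix α α ℂ} (hU : IsContraction U) {f : β → α}
    (hf : Function.Injective f) : IsContraction (U.submatrix f f) := by
  let J : Matrix α β ℂ := Matrix.of fun x y => if x = f y then 1 else 0
  have hJ : Jᴴ * J = 1 := by
    ext i j
    simp [J, Matrix.mul_apply, Matrix.one_apply, hf.eq_iff, apply_ite, eq_comm]
  have hU' : U.submatrix f f = Jᴴ * U * J := by
    ext i j
    simp [J, Matrix.mul_apply, apply_ite]
  rw [hU']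
  exact ((isContraction_of_conjTranspose_mul_self hJ).conjTranspose.mul hU).mul
    (isContraction_of_conjTranspose_mul_self hJ)

/-! ### Hilbert–Schmidt norm, Cauchy–Schwarz and traces against contractions. -/

lemma re_trace_conjTranspose (A : Matrix α α ℂ) : Aᴴ.trace.re = A.trace.re := by
  simp [Matrix.trace_conjTranspose]

/-- The squared Hilbert–Schmidt norm. -/
def hsNormSq {α β : Type*} [Fintype α] [Fintype β] (A : Matrix α β ℂ) : ℝ := ∑ i, ∑ j, ‖A i j‖ ^ 2

lemma hsNormSq_nonneg (A : Matrix α β ℂ) : 0 ≤ hsNormSq A := by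
  unfold hsNormSq; positivity

lemma trace_mul_conjTranspose (A : Matrix α β ℂ) : (A * Aᴴ).trace = (hsNormSq A : ℂ) := by
  simp [Matrix.trace, Matrix.mul_apply, hsNormSq, Complex.mul_conj']

lemma re_trace_mul_conjTranspose (A : Matrix α β ℂ) : (A * Aᴴ).trace.re = hsNormSq A := by
  simp [trace_mul_conjTranspose]

lemma hsNormSq_conjTranspose (A : Matrix α β ℂ) : hsNormSq Aᴴ = hsNormSq A := by
  rw [← re_trace_mul_conjTranspose, Matrix.conjTranspose_conjTranspose, Matrix.trace_mul_comm,
    re_trace_mul_conjTranspose]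

lemma hsNormSq_smul (c : ℂ) (A : Matrix α β ℂ) : hsNormSq (c • A) = ‖c‖ ^ 2 * hsNormSq A := by
  simp [hsNormSq, mul_pow, Finset.mul_sum]

lemma re_trace_mul_le (A : Matrix α β ℂ) (B : Matrix β α ℂ) :
    (A * B).trace.re ≤ √(hsNormSq A) * √(hsNormSq B) := by
  calc (A * B).trace.re ≤ ‖(A * B).trace‖ := Complex.re_le_norm _
    _ ≤ ∑ x : α × β, ‖A x.1 x.2‖ * ‖B x.2 x.1‖ := by
      rw [Fintype.sum_prod_type]
      refine (norm_sum_le _ _).trans (Finset.sum_le_sum fun i _ => ?_)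
      rw [Matrix.diag_apply, Matrix.mul_apply]
      refine (norm_sum_le _ _).trans (Finset.sum_le_sum fun j _ => ?_)
      rw [norm_mul]
    _ ≤ √(∑ x : α × β, ‖A x.1 x.2‖ ^ 2) * √(∑ x : α × β, ‖B x.2 x.1‖ ^ 2) :=
      Real.sum_mul_le_sqrt_mul_sqrt _ _ _
    _ = _ := by
      rw [Fintype.sum_prod_type, Fintype.sum_prod_type_right]; rfl

lemma sqrt_hsNormSq_add_le (A B : Matrix α β ℂ) :
    √(hsNormSq (A + B)) ≤ √(hsNormSq A) + √(hsNormSq B) := by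
  have h1 : hsNormSq (A + B) = hsNormSq A + 2 * (A * Bᴴ).trace.re + hsNormSq B := by
    have h := re_trace_conjTranspose (A * Bᴴ)
    rw [Matrix.conjTranspose_mul, Matrix.conjTranspose_conjTranspose] at h
    rw [← re_trace_mul_conjTranspose, ← re_trace_mul_conjTranspose A, ← re_trace_mul_conjTranspose B]
    simp only [Matrix.conjTranspose_add, Matrix.add_mul, Matrix.mul_add, Matrix.trace_add,
      Complex.add_re, h]
    ring
  have h2 := re_trace_mul_le A Bᴴ
  rw [hsNormSq_conjTranspose] at h2
  apply Real.sqrt_le_iff.2 ⟨by positivity, ?_⟩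
  rw [h1, add_sq, Real.sq_sqrt (hsNormSq_nonneg _), Real.sq_sqrt (hsNormSq_nonneg _)]
  linarith

lemma re_trace_nonneg {A : Matrix α α ℂ} (hA : A.PosSemidef) : 0 ≤ A.trace.re :=
  (Complex.le_def.1 hA.trace_nonneg).1

lemma re_trace_mono {A B : Matrix α α ℂ} (h : A ≤ B) : A.trace.re ≤ B.trace.re := by
  have := re_trace_nonneg (Matrix.le_iff.1 h)
  simpa using this

lemma hsNormSq_mul_le (A : Matrix α β ℂ) {U : Matrix β γ ℂ} (hU : IsContraction U) :
    hsNormSq (A * U) ≤ hsNormSq A := by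
  rw [← re_trace_mul_conjTranspose, ← re_trace_mul_conjTranspose]
  apply re_trace_mono
  rw [Matrix.le_iff]
  have h : A * Aᴴ - A * U * (A * U)ᴴ = A * (1 - U * Uᴴ) * Aᴴ := by
    simp [Matrix.conjTranspose_mul, Matrix.mul_sub, Matrix.sub_mul, Matrix.mul_assoc]
  rw [h]
  exact hU.mul_mul_conjTranspose_same A

/-- Plays the role of ‖AB‖₁ ≤ ‖A‖₂ ‖B‖₂: a contraction moved next to B by cyclicity does not
increase its norm. -/
lemma re_trace_contraction_mul_le {U : Matrix α α ℂ} (hU : IsContraction U) (A : Matrix α β ℂ)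
    (B : Matrix β α ℂ) : (U * (A * B)).trace.re ≤ √(hsNormSq A) * √(hsNormSq B) := by
  rw [Matrix.trace_mul_comm, Matrix.mul_assoc]
  refine (re_trace_mul_le _ _).trans ?_
  gcongr
  exact hsNormSq_mul_le B hU

lemma isHermitian_sqrt (A : Matrix α α ℂ) : (CFC.sqrt A).IsHermitian :=
  (Matrix.nonneg_iff_posSemidef.1 (CFC.sqrt_nonneg A)).isHermitian

lemma sqrt_mul_sqrt {A : Matrix α α ℂ} (hA : A.PosSemidef) : CFC.sqrt A * CFC.sqrt A = A :=
  CFC.sqrt_mul_sqrt_self A (Matrix.nonneg_iff_posSemidef.2 hA)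

lemma exists_eq_conjTranspose_mul_self {X : Matrix α α ℂ} (hX : X.PosSemidef) :
    ∃ L : Matrix α α ℂ, X = Lᴴ * L :=
  ⟨CFC.sqrt X, by rw [(isHermitian_sqrt X).eq, sqrt_mul_sqrt hX]⟩

lemma re_trace_contraction_posSemidef_le {U : Matrix α α ℂ} (hU : IsContraction U)
    {X : Matrix α α ℂ} (hX : X.PosSemidef) : (U * X).trace.re ≤ X.trace.re := by
  obtain ⟨L, rfl⟩ := exists_eq_conjTranspose_mul_self hX
  refine (re_trace_contraction_mul_le hU _ _).trans ?_
  rw [hsNormSq_conjTranspose, Real.mul_self_sqrt (hsNormSq_nonneg _), Matrix.trace_mul_comm,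
    re_trace_mul_conjTranspose]

lemma neg_re_trace_contraction_posSemidef_le {U : Matrix α α ℂ} (hU : IsContraction U)
    {X : Matrix α α ℂ} (hX : X.PosSemidef) : -(U * X).trace.re ≤ X.trace.re := by
  simpa using re_trace_contraction_posSemidef_le hU.neg hX

/-- The Moore–Penrose inverse of a Hermitian matrix. -/
lemma exists_pseudoinverse {S : Matrix α α ℂ} (hS : S.IsHermitian) :
    ∃ G : Matrix α α ℂ, G.IsHermitian ∧ G * S = S * G ∧ S * G * S = S ∧ G * S * G = G := by
  have hs : IsSelfAdjoint S := hS
  have hc : ∀ f : ℝ → ℝ, ContinuousOn f (spectrum ℝ S) := fun f =>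
    (Matrix.finite_real_spectrum (A := S)).continuousOn f
  have key : ∀ f g : ℝ → ℝ, cfc f S * cfc g S = cfc (fun x => f x * g x) S := fun f g =>
    (cfc_mul f g S (hc _) (hc _)).symm
  have hid : cfc (fun x : ℝ => x) S = S := cfc_id' ℝ S
  -- The convention 0⁻¹ = 0 makes this the pseudoinverse. The spectrum is finite, so discontinuity
  -- of the inverse at 0 does no harm.
  set G := cfc (fun x : ℝ => x⁻¹) S with hG
  have hGS : G * S = cfc (fun x : ℝ => x⁻¹ * x) S := by
    rw [← key, hid]
  have hSG : S * G = cfc (fun x : ℝ => x⁻¹ * x) S := by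
    rw [show (fun x : ℝ => x⁻¹ * x) = fun x => x * x⁻¹ from funext fun x => mul_comm _ _, ← key, hid]
  refine ⟨G, cfc_predicate _ S, hGS.trans hSG.symm, ?_, ?_⟩
  · calc S * G * S = cfc (fun x : ℝ => x⁻¹ * x * x) S := by 
          rw [hSG, ← key (fun x => x⁻¹ * x) (fun x => x), hid]
      _ = cfc (fun x : ℝ => x) S := by
        congr 1; ext x; by_cases hx : x = 0 <;> simp [hx]
      _ = S := hid
  · calc G * S * G = cfc (fun x : ℝ => x⁻¹ * x * x⁻¹) S := by 
          rw [hGS, ← key (fun x => x⁻¹ * x) (fun x => x⁻¹)]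
      _ = G := by
        rw [hG]; congr 1; ext x; by_cases hx : x = 0 <;> simp [hx]

/-- The support projection of a Hermitian matrix is at most one. -/
lemma posSemidef_one_sub_support {S G : Matrix α α ℂ} (hS : S.IsHermitian) (hG : G.IsHermitian)
    (hc : G * S = S * G) (h : G * S * G = G) : (1 - G * S).PosSemidef := by
  have h2 : G * S * (G * S) = G * S := by rw [← Matrix.mul_assoc, h]
  have h1 : 1 - G * S = (1 - G * S)ᴴ * (1 - G * S) := by
    rw [Matrix.conjTranspose_sub, Matrix.conjTranspose_mul, hS.eq, hG.eq, ← hc,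
      Matrix.conjTranspose_one, Matrix.mul_sub, Matrix.sub_mul 1 _ (G * S), h2]
    simp
  rw [h1]
  exact Matrix.posSemidef_conjTranspose_mul_self _

/-- The trace norm of `M` is attained on a contraction (polar decomposition). -/
lemma exists_contraction_traceNorm (M : Matrix α α ℂ) :
    ∃ U : Matrix α α ℂ, IsContraction U ∧ (U * M).trace.re = traceNorm M := by
  have hS := isHermitian_sqrt (Mᴴ * M)
  have hSS := sqrt_mul_sqrt (Matrix.posSemidef_conjTranspose_mul_self M)
  set S := CFC.sqrt (Mᴴ * M) with hSdef
  obtain ⟨G, hG, hc, h1, h2⟩ := exists_pseudoinverse hS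
  -- With S = √(M†M) and pseudoinverse G, the choice U = G M† gives UU† = GS, the support
  -- projection, and a trace of UM equal to that of S.
  refine ⟨G * Mᴴ, ?_, ?_⟩
  · have : G * Mᴴ * (G * Mᴴ)ᴴ = G * S := by
      calc G * Mᴴ * (G * Mᴴ)ᴴ = G * (Mᴴ * M) * G := by
            simp [Matrix.conjTranspose_mul, hG.eq, Matrix.mul_assoc]
        _ = G * S * (S * G) := by rw [← hSS]; simp only [Matrix.mul_assoc]
        _ = G * S * G * S := by rw [← hc]; simp only [Matrix.mul_assoc]
        _ = G * S := by rw [h2]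
    rw [IsContraction, this]
    exact posSemidef_one_sub_support hS hG hc h2
  · rw [traceNorm, ← hSdef, Matrix.mul_assoc, ← hSS, ← Matrix.mul_assoc, hc, h1]

lemma traceNorm_le {M : Matrix α α ℂ} {C : ℝ}
    (h : ∀ U : Matrix α α ℂ, IsContraction U → (U * M).trace.re ≤ C) : traceNorm M ≤ C := by
  obtain ⟨U, hU, hM⟩ := exists_contraction_traceNorm M
  exact hM ▸ h U hU

/-- Trace norm of a matrix that is block diagonal with respect to a classical register. -/
lemma traceNorm_le_of_blocks {Ω ι E : Type*} [Fintype Ω] [DecidableEq Ω] [Fintype ι]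
    [DecidableEq ι] [Fintype E] [DecidableEq E] (f : Ω ≃ ι × E) {M : Matrix Ω Ω ℂ}
    {D : ι → Matrix E E ℂ} {C : ℝ}
    (hM : ∀ i e j e', M (f.symm (i, e)) (f.symm (j, e')) = if i = j then D i e e' else 0)
    (h : ∀ V : ι → Matrix E E ℂ, (∀ i, IsContraction (V i)) → ∑ i, (V i * D i).trace.re ≤ C) :
    traceNorm M ≤ C := by
  refine traceNorm_le fun U hU => ?_
  let F : ι → E → Ω := fun i e => f.symm (i, e)
  have hF : ∀ i, Function.Injective (F i) := fun i x y hxy => by simpa [F] using hxy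
  -- Off-diagonal blocks of U meet vanishing blocks of M, and the diagonal ones are again
  -- contractions.
  refine le_trans (le_of_eq ?_) (h (fun i => U.submatrix (F i) (F i)) fun i => hU.submatrix (hF i))
  rw [← Complex.re_sum]
  congr 1
  simp only [Matrix.trace, Matrix.diag_apply, Matrix.mul_apply, Matrix.submatrix_apply]
  rw [← Equiv.sum_comp f.symm, Fintype.sum_prod_type]
  refine Finset.sum_congr rfl fun i _ => Finset.sum_congr rfl fun e _ => ?_
  rw [← Equiv.sum_comp f.symm, Fintype.sum_prod_type]
  rw [Finset.sum_eq_single i]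
  · simp [hM, F]
  · intro j _ hj
    simp [hM, hj]
  · simp

/-- If `0 ≤ τ ≤ ρ` then `τ = √ρ Q Q† √ρ` for a contraction `Q`. -/
lemma exists_contraction_of_le {τ ρ : Matrix α α ℂ} (hτ : τ.PosSemidef) (hρ : ρ.PosSemidef)
    (h : τ ≤ ρ) : ∃ Q : Matrix α α ℂ, IsContraction Q ∧
      τ = CFC.sqrt ρ * Q * (CFC.sqrt ρ * Q)ᴴ := by
  have hS := isHermitian_sqrt ρ
  have hSS := sqrt_mul_sqrt hρ
  set S := CFC.sqrt ρ with hSdef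
  obtain ⟨G, hG, hc, h1, h2⟩ := exists_pseudoinverse hS
  obtain ⟨L, rfl⟩ := exists_eq_conjTranspose_mul_self hτ
  have hP : (1 - G * S)ᴴ = 1 - G * S := by
    rw [Matrix.conjTranspose_sub, Matrix.conjTranspose_mul, hS.eq, hG.eq, ← hc,
      Matrix.conjTranspose_one]
  have hSP : S * (1 - G * S) = 0 := by
    rw [Matrix.mul_sub, ← Matrix.mul_assoc, h1, Matrix.mul_one, sub_self]
  -- Since L†L ≤ ρ, the kernel of ρ is contained in that of L: conjugating by the kernel projection
  -- leaves only −L†L, which must be both positive and negative.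
  have hL : L * (1 - G * S) = 0 := by
    rw [← Matrix.conjTranspose_mul_self_eq_zero, Matrix.conjTranspose_mul]
    have h3 : ((1 - G * S)ᴴ * (ρ - Lᴴ * L) * (1 - G * S)).PosSemidef :=
      (Matrix.le_iff.1 h).conjTranspose_mul_mul_same _
    have h4 : (1 - G * S)ᴴ * (ρ - Lᴴ * L) * (1 - G * S) =
        - ((1 - G * S)ᴴ * Lᴴ * (L * (1 - G * S))) := by
      rw [← hSS, Matrix.mul_sub _ (S * S), Matrix.sub_mul]
      simp only [Matrix.mul_assoc, hSP, Matrix.mul_zero, zero_sub]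
    rw [h4] at h3
    apply le_antisymm
    · rw [Matrix.le_iff]; simpa using h3
    · rw [Matrix.nonneg_iff_posSemidef, ← Matrix.conjTranspose_mul]
      exact Matrix.posSemidef_conjTranspose_mul_self _
  have hL' : L = L * G * S := by
    rw [Matrix.mul_sub, Matrix.mul_one, sub_eq_zero] at hL
    rw [Matrix.mul_assoc]; exact hL
  -- Q = ρ^{-1/2} L† on the support of ρ; τ ≤ ρ makes QQ† at most the support projection.
  refine ⟨G * Lᴴ, ?_, ?_⟩
  · have h5 : 1 - G * Lᴴ * (G * Lᴴ)ᴴ = (1 - G * S) + G * (ρ - Lᴴ * L) * Gᴴ := by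
      have : G * ρ * G = G * S := by
        calc G * ρ * G = G * S * (S * G) := by rw [← hSS]; simp only [Matrix.mul_assoc]
        _ = G * S * G * S := by rw [← hc]; simp only [Matrix.mul_assoc]
        _ = G * S := by rw [h2]
      rw [hG.eq, Matrix.mul_sub, Matrix.sub_mul, this]
      simp [Matrix.mul_assoc, hG.eq]
    rw [IsContraction, h5]
    exact (posSemidef_one_sub_support hS hG hc h2).add
      ((Matrix.le_iff.1 h).mul_mul_conjTranspose_same G)
  · have h6 : (S * (G * Lᴴ))ᴴ = L := by
      rw [Matrix.conjTranspose_mul, Matrix.conjTranspose_mul, Matrix.conjTranspose_conjTranspose,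
        hG.eq, hS.eq, ← hL']
    rw [h6, ← Matrix.conjTranspose_conjTranspose (S * (G * Lᴴ)), h6]

end Contraction

/-! ### Linear universal hashing -/

section Hashing

variable {n m : ℕ} {𝒢 : Type*} [Fintype 𝒢]

lemma card_bits (d : ℕ) : Fintype.card (Bits d) = 2 ^ d := by
  simp [Bits, ZMod.card]

lemma two_rpow_neg_mul_two_pow (d : ℕ) : (2 : ℝ) ^ (-(d : ℝ)) * 2 ^ d = 1 := by
  rw [Real.rpow_neg (by norm_num), Real.rpow_natCast]
  exact inv_mul_cancel₀ (by positivity)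

lemma sum_bits_two_rpow_neg (d : ℕ) : ∑ _k : Bits d, (2 : ℝ) ^ (-(d : ℝ)) = 1 := by
  rw [Finset.sum_const, Finset.card_univ, card_bits, nsmul_eq_mul, mul_comm]
  exact_mod_cast two_rpow_neg_mul_two_pow d

/-- All fibers of a surjective linear map have the same weight. -/
lemma sum_fiber_eq (g : Bits n →ₗ[ZMod 2] Bits m) (hg : Function.Surjective g) (k : Bits m) :
    ∑ a, (if g a = k then (1 : ℝ) else 0) = 2 ^ n * (2 : ℝ) ^ (-(m : ℝ)) := by
  have hconst : ∀ k' : Bits m,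
      ∑ a, (if g a = k' then (1 : ℝ) else 0) = ∑ a, (if g a = k then (1 : ℝ) else 0) := by
    intro k'
    -- Translation by a preimage of k' − k carries one fiber onto the other.
    obtain ⟨x, hx⟩ := hg (k' - k)
    rw [← Equiv.sum_comp (Equiv.addRight x)]
    refine Finset.sum_congr rfl fun a _ => ?_
    congr 1
    simp [hx, ← eq_sub_iff_add_eq]
  have htot : ∑ k' : Bits m, ∑ a, (if g a = k' then (1 : ℝ) else 0) = 2 ^ n := by
    rw [Finset.sum_comm]
    simp
  rw [Finset.sum_congr rfl fun k' _ => hconst k'] at htot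
  rw [Finset.sum_const, Finset.card_univ, card_bits, nsmul_eq_mul] at htot
  have h2 := two_rpow_neg_mul_two_pow m
  push_cast at htot
  rw [← htot]
  linear_combination (- ∑ a, (if g a = k then (1 : ℝ) else 0)) * h2

/-- Deviation of the collision indicator from the uniform probability. -/
def hashDev (g : Bits n →ₗ[ZMod 2] Bits m) (k : Bits m) (a : Bits n) : ℝ :=
  (if g a = k then 1 else 0) - (2 : ℝ) ^ (-(m : ℝ))

/-- Linearity makes the covariance a function of a − b alone, so the quadratic form in
`sum_hashDev_norm_sq_le` is a convolution. -/
lemma sum_hashDev_mul_hashDev (g : Bits n →ₗ[ZMod 2] Bits m) (a b : Bits n) :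
    ∑ k, hashDev g k a * hashDev g k b =
      (if g (a - b) = 0 then 1 else 0) - (2 : ℝ) ^ (-(m : ℝ)) := by
  have h2 := sum_bits_two_rpow_neg m
  simp only [hashDev, sub_mul, mul_sub, Finset.sum_sub_distrib, ← Finset.sum_mul,
    ← Finset.mul_sum, h2]
  simp [sub_eq_zero, eq_comm (b := g b)]

/-- All deviations with w ≠ 0 are nonpositive, and the total over w vanishes since every kernel has
2^{n-m} elements. The absolute sum is therefore twice the single positive term 1 − 2^{-m} at w = 0.
-/
lemma sum_collision_deviation_le {p : 𝒢 → ℝ} (hp : p ∈ stdSimplex ℝ 𝒢)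
    {g : 𝒢 → Bits n →ₗ[ZMod 2] Bits m} (hg : ∀ i, Function.Surjective (g i))
    (hu : IsUniversal₂ p (fun i => ⇑(g i))) :
    ∑ w : Bits n, |∑ i, p i * (if g i w = 0 then 1 else 0) - (2 : ℝ) ^ (-(m : ℝ))| ≤ 2 := by
  set c : ℝ := (2 : ℝ) ^ (-(m : ℝ)) with hc
  have hc0 : 0 ≤ c := by positivity
  -- The first summand has total zero; the correction at w = 0 turns c − 1 into 1 − c.
  have hq : ∀ w : Bits n, |∑ i, p i * (if g i w = 0 then 1 else 0) - c| ≤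
      (c - ∑ i, p i * (if g i w = 0 then 1 else 0)) + if w = 0 then 2 * (1 - c) else 0 := by
    intro w
    by_cases hw : w = 0
    · subst hw
      simp only [map_zero, if_true, mul_one, hp.2]
      have : c ≤ 1 := by
        rw [hc, Real.rpow_neg (by norm_num)]
        exact inv_le_one_of_one_le₀ (Real.one_le_rpow (by norm_num) (by positivity))
      rw [abs_of_nonneg (by linarith)]
      linarith
    · have h := hu w 0 hw
      simp only [map_zero] at h
      rw [if_neg hw, abs_of_nonpos (by linarith)]
      linarith
  refine (Finset.sum_le_sum fun w _ => hq w).trans ?_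
  have hs : ∑ w : Bits n, ∑ i, p i * (if g i w = 0 then (1 : ℝ) else 0) = 2 ^ n * c := by
    rw [Finset.sum_comm]
    simp_rw [← Finset.mul_sum, sum_fiber_eq _ (hg _), ← Finset.sum_mul]
    rw [hp.2, one_mul]
  rw [Finset.sum_add_distrib, Finset.sum_sub_distrib, hs, Finset.sum_const, Finset.card_univ,
    card_bits, nsmul_eq_mul]
  simp only [Finset.sum_ite_eq', Finset.mem_univ, if_true]
  push_cast
  linarith

/-- Pairwise independence: the hash of a family has small variance around its mean. -/
lemma sum_hashDev_norm_sq_le {p : 𝒢 → ℝ} (hp : p ∈ stdSimplex ℝ 𝒢)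
    {g : 𝒢 → Bits n →ₗ[ZMod 2] Bits m} (hg : ∀ i, Function.Surjective (g i))
    (hu : IsUniversal₂ p (fun i => ⇑(g i))) (w : Bits n → ℂ) :
    ∑ i, p i * ∑ k, ‖∑ a, (hashDev (g i) k a : ℂ) * w a‖ ^ 2 ≤ 2 * ∑ a, ‖w a‖ ^ 2 := by
  set Q : Bits n → ℝ := fun v => ∑ i, p i * (if g i v = 0 then 1 else 0) - (2 : ℝ) ^ (-(m : ℝ))
    with hQdef
  have hsq : ∀ i k, ‖∑ a, (hashDev (g i) k a : ℂ) * w a‖ ^ 2 =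
      ∑ a, ∑ b, hashDev (g i) k a * hashDev (g i) k b * (w a * star (w b)).re := by
    intro i k
    have h : ((‖∑ a, (hashDev (g i) k a : ℂ) * w a‖ ^ 2 : ℝ) : ℂ) =
        ∑ a, ∑ b, ((hashDev (g i) k a * hashDev (g i) k b : ℝ) : ℂ) * (w a * star (w b)) := by
      push_cast
      rw [← Complex.mul_conj', map_sum, Finset.sum_mul_sum]
      refine Finset.sum_congr rfl fun a _ => Finset.sum_congr rfl fun b _ => ?_
      simp only [map_mul, Complex.conj_ofReal, RCLike.star_def]
      ring
    have h' := congrArg Complex.re h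
    simp only [Complex.re_sum, Complex.ofReal_re, Complex.re_ofReal_mul] at h'
    exact h'
  have htot : ∑ i, p i * ∑ k, ‖∑ a, (hashDev (g i) k a : ℂ) * w a‖ ^ 2 =
      ∑ a, ∑ b, Q (a - b) * (w a * star (w b)).re := by
    simp_rw [hsq]
    calc _ = ∑ i, ∑ a, ∑ b, p i * ((if g i (a - b) = 0 then 1 else 0) - (2 : ℝ) ^ (-(m : ℝ))) *
          (w a * star (w b)).re := by
          refine Finset.sum_congr rfl fun i _ => ?_
          rw [Finset.sum_comm, Finset.mul_sum]
          refine Finset.sum_congr rfl fun a _ => ?_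
          rw [Finset.sum_comm, Finset.mul_sum]
          refine Finset.sum_congr rfl fun b _ => ?_
          rw [← Finset.sum_mul, sum_hashDev_mul_hashDev, mul_assoc]
      _ = _ := by
          rw [Finset.sum_comm]
          refine Finset.sum_congr rfl fun a _ => ?_
          rw [Finset.sum_comm]
          refine Finset.sum_congr rfl fun b _ => ?_
          rw [← Finset.sum_mul]
          congr 1
          simp only [Q, mul_sub, Finset.sum_sub_distrib, ← Finset.sum_mul, hp.2, one_mul]
  -- Schur test: by the inequality of arithmetic and geometric means, the form is controlled by the
  -- row and column sums of |Q(a − b)|, each at most 2.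
  have hterm : ∀ a b, Q (a - b) * (w a * star (w b)).re ≤
      |Q (a - b)| * ‖w a‖ ^ 2 / 2 + |Q (a - b)| * ‖w b‖ ^ 2 / 2 := by
    intro a b
    have h1 : |(w a * star (w b)).re| ≤ ‖w a‖ * ‖w b‖ := by
      refine (Complex.abs_re_le_norm _).trans ?_
      rw [norm_mul, norm_star]
    have h2 : ‖w a‖ * ‖w b‖ ≤ (‖w a‖ ^ 2 + ‖w b‖ ^ 2) / 2 := by
      nlinarith [sq_nonneg (‖w a‖ - ‖w b‖)]
    calc _ ≤ |Q (a - b)| * |(w a * star (w b)).re| := by rw [← abs_mul]; exact le_abs_self _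
      _ ≤ |Q (a - b)| * ((‖w a‖ ^ 2 + ‖w b‖ ^ 2) / 2) := by gcongr; exact h1.trans h2
      _ = _ := by ring
  have hQ : ∑ v, |Q v| ≤ 2 := sum_collision_deviation_le hp hg hu
  have hQ1 : ∀ a, ∑ b, |Q (a - b)| ≤ 2 := fun a => by
    rw [← Equiv.sum_comp (Equiv.subLeft a)]
    simpa using hQ
  have hQ2 : ∀ b, ∑ a, |Q (a - b)| ≤ 2 := fun b => by
    rw [← Equiv.sum_comp (Equiv.addRight b)]
    simpa using hQ
  rw [htot]
  refine (Finset.sum_le_sum fun a _ => Finset.sum_le_sum fun b _ => hterm a b).trans ?_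
  simp only [Finset.sum_add_distrib]
  have e1 : ∑ a, ∑ b, |Q (a - b)| * ‖w a‖ ^ 2 / 2 ≤ ∑ a, ‖w a‖ ^ 2 := by
    refine Finset.sum_le_sum fun a _ => ?_
    rw [← Finset.sum_div, ← Finset.sum_mul]
    nlinarith [hQ1 a, sq_nonneg ‖w a‖]
  have e2 : ∑ a, ∑ b, |Q (a - b)| * ‖w b‖ ^ 2 / 2 ≤ ∑ a, ‖w a‖ ^ 2 := by
    rw [Finset.sum_comm]
    refine Finset.sum_le_sum fun a _ => ?_
    rw [← Finset.sum_div, ← Finset.sum_mul]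
    nlinarith [hQ2 a, sq_nonneg ‖w a‖]
  linarith

end Hashing

/-! ### Leftover hashing -/

section LeftoverHashing

variable {n m : ℕ} {𝒢 : Type*} [Fintype 𝒢]
variable {E κ : Type*} [Fintype E] [DecidableEq E] [Fintype κ] [DecidableEq κ]

/-- The rows of `N` belonging to the value `a` of a classical register. -/
def rowBlock {X E κ : Type*} (N : Matrix (X × E) κ ℂ) (a : X) : Matrix E κ ℂ :=
  N.submatrix (fun e => (a, e)) id

/-- The diagonal block of `ρ` belonging to the value `a` of a classical register. -/
def diagBlock {X E : Type*} (ρ : Matrix (X × E) (X × E) ℂ) (a : X) : Matrix E E ℂ :=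
  ρ.submatrix (fun e => (a, e)) (fun e => (a, e))

lemma rowBlock_mul_conjTranspose {X : Type*} (N B : Matrix (X × E) κ ℂ) (a : X) :
    rowBlock N a * (rowBlock B a)ᴴ = diagBlock (N * Bᴴ) a := rfl

lemma sum_hsNormSq_rowBlock {X : Type*} [Fintype X] (N : Matrix (X × E) κ ℂ) :
    ∑ a, hsNormSq (rowBlock N a) = hsNormSq N := by
  simp only [hsNormSq, Fintype.sum_prod_type]
  rfl

lemma sum_sum_comm {α β γ δ : Type*} [Fintype α] [Fintype β] [Fintype γ] [Fintype δ]
    {M : Type*} [AddCommMonoid M] (f : α → β → γ → δ → M) :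
    ∑ a, ∑ b, ∑ c, ∑ d, f a b c d = ∑ c, ∑ d, ∑ a, ∑ b, f a b c d := by
  have := Finset.sum_comm (s := (Finset.univ : Finset (α × β)))
    (t := (Finset.univ : Finset (γ × δ))) (f := fun x y => f x.1 x.2 y.1 y.2)
  simpa only [Fintype.sum_prod_type] using this

/-- Only the factor B has to satisfy the min-entropy bound B_a B_a† ≤ A; N is arbitrary. This
asymmetry is what allows smoothing on square roots of states. -/
lemma sum_hashDev_re_trace_cross_le {p : 𝒢 → ℝ} (hp : p ∈ stdSimplex ℝ 𝒢)
    {g : 𝒢 → Bits n →ₗ[ZMod 2] Bits m} (hg : ∀ i, Function.Surjective (g i))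
    (hu : IsUniversal₂ p (fun i => ⇑(g i))) {V : 𝒢 → Bits m → Matrix E E ℂ}
    (hV : ∀ i k, IsContraction (V i k)) {A : Matrix E E ℂ} (hA : A.PosDef)
    (N B : Matrix (Bits n × E) κ ℂ)
    (hB : ∀ a, (A - rowBlock B a * (rowBlock B a)ᴴ).PosSemidef) :
    ∑ i, p i * ∑ k, (V i k * ∑ a, hashDev (g i) k a •
      (rowBlock N a * (rowBlock B a)ᴴ)).trace.re ≤
      √(2 ^ m) * √(2 * hsNormSq N) * √(A.trace.re) := by
  obtain ⟨S, hS⟩ := exists_eq_conjTranspose_mul_self hA.posSemidef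
  have hdet : IsUnit S.det := by
    have h := (Matrix.isUnit_iff_isUnit_det _).1 hA.isUnit
    rw [hS, Matrix.det_mul] at h
    exact isUnit_of_mul_isUnit_right h
  have hSS : S⁻¹ * S = 1 := Matrix.nonsing_inv_mul S hdet
  have hAinv : A⁻¹ = S⁻¹ * S⁻¹ᴴ := by
    rw [hS, Matrix.mul_inv_rev, Matrix.conjTranspose_nonsing_inv]
  -- With A = S†S, the bound on the blocks of B makes B_a† S⁻¹ a contraction, so N_a B_a† = Y_a S
  -- with ‖Y_a‖ ≤ ‖N_a‖ and with S independent of a.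
  set W : Bits n → Matrix κ E ℂ := fun a => (rowBlock B a)ᴴ * S⁻¹ with hW
  set Y : Bits n → Matrix E E ℂ := fun a => rowBlock N a * W a with hY
  have hYS : ∀ a, rowBlock N a * (rowBlock B a)ᴴ = Y a * S := fun a => by
    simp only [hY, hW, Matrix.mul_assoc, hSS, Matrix.mul_one]
  have hWc : ∀ a, IsContraction (W a) := fun a => by
    have h := posSemidef_one_sub_conj_inv hA (rowBlock B a) (hB a)
    rw [hAinv] at h
    simpa [IsContraction, hW, Matrix.conjTranspose_mul, Matrix.mul_assoc] using h
  have hYN : ∀ a, hsNormSq (Y a) ≤ hsNormSq (rowBlock N a) := fun a => hsNormSq_mul_le _ (hWc a)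
  have hSA : hsNormSq S = A.trace.re := by
    rw [hS, Matrix.trace_mul_comm, re_trace_mul_conjTranspose]
  have hterm : ∀ i k, (V i k * ∑ a, hashDev (g i) k a •
      (rowBlock N a * (rowBlock B a)ᴴ)).trace.re ≤
      √(hsNormSq (∑ a, hashDev (g i) k a • Y a)) * √(A.trace.re) := fun i k => by
    have : ∑ a, hashDev (g i) k a • (rowBlock N a * (rowBlock B a)ᴴ) =
        (∑ a, hashDev (g i) k a • Y a) * S := by
      simp only [hYS, Finset.sum_mul, Matrix.smul_mul]
    rw [this, ← hSA]
    exact re_trace_contraction_mul_le (hV i k) _ _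
  have hvar : ∑ i, p i * ∑ k, hsNormSq (∑ a, hashDev (g i) k a • Y a) ≤ 2 * hsNormSq N := by
    calc _ = ∑ e, ∑ e', ∑ i, p i * ∑ k, ‖∑ a, (hashDev (g i) k a : ℂ) * Y a e e'‖ ^ 2 := by
          simp only [hsNormSq, Matrix.sum_apply, Matrix.smul_apply, Complex.real_smul,
            Finset.mul_sum]
          exact sum_sum_comm _
      _ ≤ ∑ e, ∑ e', 2 * ∑ a, ‖Y a e e'‖ ^ 2 := by
          gcongr with e _ e' _
          exact sum_hashDev_norm_sq_le hp hg hu _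
      _ = 2 * ∑ a, hsNormSq (Y a) := by
          simp only [← Finset.mul_sum, hsNormSq]
          congr 1
          rw [Finset.sum_comm' (t' := Finset.univ) (s' := fun _ => Finset.univ) (by simp)]
          simp_rw [Finset.sum_comm (γ := Bits n) (α := E)]
          exact Finset.sum_comm
      _ ≤ 2 * hsNormSq N := by
          rw [← sum_hsNormSq_rowBlock N]
          gcongr with a _
          exact hYN a
  -- Cauchy–Schwarz over the pairs (g, k) with weights p; the total weight is 2^m, one for each key
  -- value.
  have hcs : ∑ i, p i * ∑ k, √(hsNormSq (∑ a, hashDev (g i) k a • Y a)) ≤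
      √(2 ^ m) * √(2 * hsNormSq N) := by
    calc _ = ∑ x : 𝒢 × Bits m, √(p x.1) *
          (√(p x.1) * √(hsNormSq (∑ a, hashDev (g x.1) x.2 a • Y a))) := by
          simp only [← mul_assoc, Real.mul_self_sqrt (hp.1 _), Fintype.sum_prod_type,
            Finset.mul_sum]
      _ ≤ √(∑ x : 𝒢 × Bits m, √(p x.1) ^ 2) * √(∑ x : 𝒢 × Bits m,
          (√(p x.1) * √(hsNormSq (∑ a, hashDev (g x.1) x.2 a • Y a))) ^ 2) :=
          Real.sum_mul_le_sqrt_mul_sqrt _ _ _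
      _ ≤ _ := by
          simp only [mul_pow, Real.sq_sqrt (hp.1 _), Real.sq_sqrt (hsNormSq_nonneg _),
            Fintype.sum_prod_type, ← Finset.mul_sum]
          gcongr
          simp [← Finset.mul_sum, hp.2]
  calc _ ≤ ∑ i, p i * ∑ k, √(hsNormSq (∑ a, hashDev (g i) k a • Y a)) * √(A.trace.re) := by
        gcongr with i _ k _
        · exact hp.1 i
        · exact hterm i k
    _ = (∑ i, p i * ∑ k, √(hsNormSq (∑ a, hashDev (g i) k a • Y a))) * √(A.trace.re) := by
        simp only [Finset.sum_mul, Finset.mul_sum, mul_assoc]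
    _ ≤ _ := by gcongr

/-- For fixed a, the point mass at g(a) and the uniform distribution each contribute one. -/
lemma sum_abs_hashDev_mul_le (g : Bits n →ₗ[ZMod 2] Bits m) {t : Bits n → ℝ} (ht : ∀ a, 0 ≤ t a) :
    ∑ k, ∑ a, |hashDev g k a| * t a ≤ 2 * ∑ a, t a := by
  rw [Finset.sum_comm, Finset.mul_sum]
  refine Finset.sum_le_sum fun a _ => ?_
  rw [← Finset.sum_mul]
  refine mul_le_mul_of_nonneg_right ?_ (ht a)
  calc ∑ k, |hashDev g k a| ≤ ∑ k, ((if g a = k then 1 else 0) + (2 : ℝ) ^ (-(m : ℝ))) := by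
        refine Finset.sum_le_sum fun k _ => ?_
        refine (abs_sub _ _).trans (le_of_eq ?_)
        rw [abs_of_nonneg (by split_ifs <;> norm_num), abs_of_nonneg (by positivity)]
    _ = 2 := by
        rw [Finset.sum_add_distrib, sum_bits_two_rpow_neg]
        simp only [Finset.sum_ite_eq, Finset.mem_univ, if_true]
        norm_num

/-- Hashing a positive family and comparing with the uniform distribution costs at most twice
its trace. -/
lemma sum_hashDev_re_trace_posSemidef_le (g : Bits n →ₗ[ZMod 2] Bits m)
    {V : Bits m → Matrix E E ℂ} (hV : ∀ k, IsContraction (V k)) {X : Bits n → Matrix E E ℂ}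
    (hX : ∀ a, (X a).PosSemidef) :
    ∑ k, (V k * ∑ a, hashDev g k a • X a).trace.re ≤ 2 * ∑ a, (X a).trace.re := by
  refine le_trans (Finset.sum_le_sum fun k _ => ?_)
    (sum_abs_hashDev_mul_le g fun a => re_trace_nonneg (hX a))
  simp only [Matrix.mul_sum, Matrix.trace_sum, Complex.re_sum, Matrix.mul_smul, Matrix.trace_smul,
    Complex.smul_re, smul_eq_mul]
  refine Finset.sum_le_sum fun a _ => ?_
  refine (le_abs_self _).trans ?_
  rw [abs_mul]
  gcongr
  rw [abs_le']
  exact ⟨re_trace_contraction_posSemidef_le (hV k) (hX a),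
    neg_re_trace_contraction_posSemidef_le (hV k) (hX a)⟩

/-- Leftover hashing for a state `R R†`, where `R` is close to a multiple of `B` and `B B†` has
large min-entropy. -/
lemma leftover_hashing {p : 𝒢 → ℝ} (hp : p ∈ stdSimplex ℝ 𝒢)
    {g : 𝒢 → Bits n →ₗ[ZMod 2] Bits m} (hg : ∀ i, Function.Surjective (g i))
    (hu : IsUniversal₂ p (fun i => ⇑(g i))) {V : 𝒢 → Bits m → Matrix E E ℂ}
    (hV : ∀ i k, IsContraction (V i k)) {A : Matrix E E ℂ} (hA : A.PosDef)
    {R N B : Matrix (Bits n × E) κ ℂ}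
    (hB : ∀ a, (A - rowBlock B a * (rowBlock B a)ᴴ).PosSemidef) {F s : ℝ} (hF : 0 ≤ F)
    (hs : 0 ≤ s) (hFs : F ^ 2 + s ^ 2 ≤ 1) (hN : hsNormSq N ≤ s ^ 2) (hB1 : hsNormSq B ≤ 1)
    (hR : R = N + (F : ℂ) • B) :
    ∑ i, p i * ∑ k, (V i k * ∑ a, hashDev (g i) k a •
      (rowBlock R a * (rowBlock R a)ᴴ)).trace.re ≤
      2 * s ^ 2 + 2 * √2 * (√(2 ^ m) * √(A.trace.re)) := by
  -- The half weight symmetrizes the expansion: RR† = NN† + F(XB† + BX†), so every term other than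
  -- NN† has a factor B.
  set X := N + ((F / 2 : ℝ) : ℂ) • B with hX
  have hXn : √(hsNormSq X) ≤ s + F / 2 := by
    refine (sqrt_hsNormSq_add_le _ _).trans (add_le_add ?_ ?_)
    · exact (Real.sqrt_le_left hs).2 hN
    · rw [hsNormSq_smul, Real.sqrt_le_left (by positivity), Complex.norm_real, Real.norm_eq_abs,
        sq_abs]
      nlinarith [sq_nonneg (F / 2)]
  have hdec : ∀ a, rowBlock R a * (rowBlock R a)ᴴ = rowBlock N a * (rowBlock N a)ᴴ +
      (F • (rowBlock X a * (rowBlock B a)ᴴ) + F • (rowBlock X a * (rowBlock B a)ᴴ)ᴴ) := by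
    intro a
    have h1 : rowBlock R a = rowBlock N a + F • rowBlock B a := by
      rw [hR]; ext; simp [rowBlock]
    have h2 : rowBlock X a = rowBlock N a + (F / 2) • rowBlock B a := by
      rw [hX]; ext; simp [rowBlock]
    rw [h1, h2]
    simp only [Matrix.conjTranspose_add, Matrix.conjTranspose_mul, Matrix.conjTranspose_smul,
      Matrix.conjTranspose_conjTranspose, Matrix.add_mul, Matrix.mul_add, Matrix.smul_mul,
      Matrix.mul_smul, smul_add, smul_smul, star_trivial]
    module
  have hNN : ∀ i, ∑ k, (V i k * ∑ a, hashDev (g i) k a •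
      (rowBlock N a * (rowBlock N a)ᴴ)).trace.re ≤ 2 * s ^ 2 := fun i => by
    refine (sum_hashDev_re_trace_posSemidef_le (g i) (hV i)
      fun a => Matrix.posSemidef_self_mul_conjTranspose _).trans ?_
    simp only [re_trace_mul_conjTranspose, sum_hsNormSq_rowBlock]
    linarith
  have hc1 := sum_hashDev_re_trace_cross_le hp hg hu hV hA X B hB
  have hc2 := sum_hashDev_re_trace_cross_le hp hg hu (fun i k => (hV i k).conjTranspose) hA X B hB
  have hflip : ∀ i k, (V i k * ∑ a, hashDev (g i) k a •
      (rowBlock X a * (rowBlock B a)ᴴ)ᴴ).trace.re = ((V i k)ᴴ * ∑ a, hashDev (g i) k a •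
      (rowBlock X a * (rowBlock B a)ᴴ)).trace.re := fun i k => by
    rw [← re_trace_conjTranspose, Matrix.conjTranspose_mul, Matrix.trace_mul_comm]
    simp only [Matrix.conjTranspose_sum, Matrix.conjTranspose_smul,
      Matrix.conjTranspose_conjTranspose, star_trivial]
  have hsum : ∑ i, p i * ∑ k, (V i k * ∑ a, hashDev (g i) k a •
      (rowBlock R a * (rowBlock R a)ᴴ)).trace.re =
      ∑ i, p i * ∑ k, (V i k * ∑ a, hashDev (g i) k a •
        (rowBlock N a * (rowBlock N a)ᴴ)).trace.re +
      (F * ∑ i, p i * ∑ k, (V i k * ∑ a, hashDev (g i) k a •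
        (rowBlock X a * (rowBlock B a)ᴴ)).trace.re +
      F * ∑ i, p i * ∑ k, ((V i k)ᴴ * ∑ a, hashDev (g i) k a •
        (rowBlock X a * (rowBlock B a)ᴴ)).trace.re) := by
    simp only [← hflip]
    simp only [Finset.mul_sum, ← Finset.sum_add_distrib]
    refine Finset.sum_congr rfl fun i _ => Finset.sum_congr rfl fun k _ => ?_
    have : ∑ a, hashDev (g i) k a • (rowBlock R a * (rowBlock R a)ᴴ) =
        ∑ a, hashDev (g i) k a • (rowBlock N a * (rowBlock N a)ᴴ) +
        (F • ∑ a, hashDev (g i) k a • (rowBlock X a * (rowBlock B a)ᴴ) +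
        F • ∑ a, hashDev (g i) k a • (rowBlock X a * (rowBlock B a)ᴴ)ᴴ) := by
      simp only [hdec, smul_add, Finset.sum_add_distrib, Finset.smul_sum,
        smul_comm F (hashDev (g i) k _)]
    simp only [← Finset.mul_sum]
    rw [this]
    simp only [Matrix.mul_add, Matrix.trace_add, Complex.add_re, Matrix.mul_smul,
      Matrix.trace_smul, Complex.smul_re, smul_eq_mul]
    ring
  have hfst : ∑ i, p i * ∑ k, (V i k * ∑ a, hashDev (g i) k a •
        (rowBlock N a * (rowBlock N a)ᴴ)).trace.re ≤ 2 * s ^ 2 := by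
    calc _ ≤ ∑ i, p i * (2 * s ^ 2) := by
          gcongr with i _
          · exact hp.1 i
          · exact hNN i
      _ = _ := by rw [← Finset.sum_mul, hp.2, one_mul]
  set c : ℝ := √(2 ^ m) * √(A.trace.re) with hc
  have hc0 : 0 ≤ c := by positivity
  have hcross : √(2 ^ m) * √(2 * hsNormSq X) * √(A.trace.re) ≤ √2 * (s + F / 2) * c := by
    rw [Real.sqrt_mul (by norm_num)]
    calc _ = √2 * √(hsNormSq X) * c := by rw [hc]; ring
      _ ≤ _ := by gcongr
  have hfin : F * (√2 * (s + F / 2) * c) + F * (√2 * (s + F / 2) * c) ≤ 2 * √2 * c := by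
    -- 2Fs + F² ≤ (F² + s²) + F² ≤ 2, from F² + s² ≤ 1.
    have h3 : 2 * F * (s + F / 2) ≤ 2 := by nlinarith [sq_nonneg (F - s)]
    have h4 : 0 ≤ √2 * c := by positivity
    nlinarith [mul_le_mul_of_nonneg_right h3 h4]
  rw [hsum]
  have h5 := mul_le_mul_of_nonneg_left (hc1.trans hcross) hF
  have h6 := mul_le_mul_of_nonneg_left (hc2.trans hcross) hF
  linarith

end LeftoverHashing

/-! ### Leftover hashing with smooth min-entropy -/

section Smoothing

variable {n m : ℕ} {𝒢 : Type*} [Fintype 𝒢]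
variable {α E : Type*} [Fintype α] [DecidableEq α] [Fintype E] [DecidableEq E]

lemma traceNorm_nonneg (M : Matrix α α ℂ) : 0 ≤ traceNorm M :=
  re_trace_nonneg (Matrix.nonneg_iff_posSemidef.1 (CFC.sqrt_nonneg _))

lemma fidelity_nonneg (ρ τ : Matrix α α ℂ) : 0 ≤ fidelity ρ τ :=
  add_nonneg (traceNorm_nonneg _) (Real.sqrt_nonneg _)

/-- A form of Uhlmann's theorem: `√ρ` is, up to a defect controlled by the fidelity, a multiple of
`√τ W` for a contraction `W`. -/
lemma exists_contraction_fidelity {ρ τ : Matrix α α ℂ} (hρ : IsSubnormalized ρ)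
    (hτ : IsSubnormalized τ) : ∃ W : Matrix α α ℂ, IsContraction W ∧
      hsNormSq (CFC.sqrt ρ - (fidelity τ ρ : ℂ) • (CFC.sqrt τ * W)) ≤ 1 - fidelity τ ρ ^ 2 := by
  obtain ⟨U, hU, hUf⟩ := exists_contraction_traceNorm (CFC.sqrt τ * CFC.sqrt ρ)
  -- U attains the trace norm in the fidelity, so this choice makes the overlap of √ρ and √τ U† as
  -- large as possible.
  refine ⟨Uᴴ, hU.conjTranspose, ?_⟩
  set F := fidelity τ ρ with hF
  set x := √((1 - τ.trace.re) * (1 - ρ.trace.re)) with hx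
  set B := CFC.sqrt τ * Uᴴ with hB
  have hf : (CFC.sqrt ρ * Bᴴ).trace.re = F - x := by
    rw [hB, Matrix.conjTranspose_mul, Matrix.conjTranspose_conjTranspose, (isHermitian_sqrt τ).eq,
      Matrix.trace_mul_comm, Matrix.mul_assoc, hUf, hF, fidelity]
    ring
  have hf' : (B * CFC.sqrt ρ).trace.re = F - x := by
    rw [← hf, ← re_trace_conjTranspose, Matrix.conjTranspose_mul, (isHermitian_sqrt ρ).eq]
  have hB1 : hsNormSq B ≤ τ.trace.re := by
    refine (hsNormSq_mul_le _ hU.conjTranspose).trans (le_of_eq ?_)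
    rw [← re_trace_mul_conjTranspose, (isHermitian_sqrt τ).eq, sqrt_mul_sqrt hτ.1]
  have hexp : hsNormSq (CFC.sqrt ρ - (F : ℂ) • B) =
      ρ.trace.re - 2 * F * (F - x) + F ^ 2 * hsNormSq B := by
    rw [← re_trace_mul_conjTranspose, ← re_trace_mul_conjTranspose B]
    simp only [Matrix.conjTranspose_sub, Matrix.conjTranspose_smul, Matrix.sub_mul, Matrix.mul_sub,
      (isHermitian_sqrt ρ).eq, sqrt_mul_sqrt hρ.1, Matrix.smul_mul, Matrix.mul_smul,
      Matrix.trace_sub, Matrix.trace_smul, Complex.sub_re, smul_eq_mul, RCLike.star_def,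
      Complex.conj_ofReal, Complex.re_ofReal_mul, hf, hf']
    ring
  have hρ0 : 0 ≤ 1 - ρ.trace.re := by linarith [hρ.2]
  have hτ0 : 0 ≤ 1 - τ.trace.re := by linarith [hτ.2]
  have hxe : x = √(1 - τ.trace.re) * √(1 - ρ.trace.re) := Real.sqrt_mul hτ0 _
  have h1 := Real.sq_sqrt hρ0
  have h2 := Real.sq_sqrt hτ0
  -- Write α² and β² for the missing traces of ρ and τ. The upper bound for the defect is exactly 1
  -- − F² − (α − Fβ)².
  have h3 := sq_nonneg (√(1 - ρ.trace.re) - F * √(1 - τ.trace.re))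
  have h4 : F ^ 2 * hsNormSq B ≤ F ^ 2 * τ.trace.re := by gcongr
  rw [hexp, hxe]
  nlinarith

/-- The summand 3 in the exponent is the prefactor 2√2 = 2^{3/2} of `leftover_hashing`. -/
lemma two_rpow_half_eq (m : ℕ) (H : ℝ) :
    2 * √2 * (√(2 ^ m) * √((2 : ℝ) ^ (-H))) = (2 : ℝ) ^ (((m : ℝ) - H + 3) / 2) := by
  have h2 : (0 : ℝ) < 2 := by norm_num
  rw [Real.sqrt_eq_rpow, ← Real.rpow_natCast 2 m, Real.sqrt_eq_rpow, Real.sqrt_eq_rpow,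
    ← Real.rpow_mul h2.le, ← Real.rpow_mul h2.le]
  nth_rw 1 [← Real.rpow_one 2]
  rw [← Real.rpow_add h2, ← Real.rpow_add h2, ← Real.rpow_add h2]
  congr 1
  ring

/-- Leftover hashing for `τ ≤ ρ` when some state `ρ'` close to `ρ` has min-entropy above `H`. -/
lemma leftover_hashing_of_le {p : 𝒢 → ℝ} (hp : p ∈ stdSimplex ℝ 𝒢)
    {g : 𝒢 → Bits n →ₗ[ZMod 2] Bits m} (hg : ∀ i, Function.Surjective (g i))
    (hu : IsUniversal₂ p (fun i => ⇑(g i))) {V : 𝒢 → Bits m → Matrix E E ℂ}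
    (hV : ∀ i k, IsContraction (V i k)) {ρ ρ' τ : Matrix (Bits n × E) (Bits n × E) ℂ}
    (hρ : IsSubnormalized ρ) (hρ' : IsSubnormalized ρ') (hτ : τ.PosSemidef) (hτρ : τ ≤ ρ)
    {ε H r : ℝ} (hP : purifiedDistance ρ' ρ ≤ ε) {σ : Matrix E E ℂ} (hσ : σ.PosSemidef)
    (hσ1 : σ.trace = 1) (hr : ρ' ≤ ((2 : ℝ) ^ (-r)) • ((1 : Matrix (Bits n) (Bits n) ℂ) ⊗ₖ σ))
    (hH : H < r) :
    ∑ i, p i * ∑ k, (V i k * ∑ a, hashDev (g i) k a • diagBlock τ a).trace.re ≤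
      2 * ε + (2 : ℝ) ^ (((m : ℝ) - H + 3) / 2) := by
  obtain ⟨W, hW, hWF⟩ := exists_contraction_fidelity hρ hρ'
  obtain ⟨Q, hQ, hQτ⟩ := exists_contraction_of_le hτ hρ.1 hτρ
  set F := fidelity ρ' ρ with hF
  have hF0 : 0 ≤ F := fidelity_nonneg _ _
  set N₀ := CFC.sqrt ρ - (F : ℂ) • (CFC.sqrt ρ' * W) with hN₀
  set s := √(hsNormSq N₀) with hs
  have hs0 : 0 ≤ s := Real.sqrt_nonneg _
  have hs2 : s ^ 2 = hsNormSq N₀ := Real.sq_sqrt (hsNormSq_nonneg _)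
  have hsε : s ≤ ε := (Real.sqrt_le_sqrt hWF).trans hP
  -- Needed at the end to weaken 2s² to 2s ≤ 2ε.
  have hs1 : s ≤ 1 := by nlinarith [sq_nonneg F]
  -- a positive definite upper bound of the blocks
  have hcard : (0 : ℝ) < Fintype.card E := by
    rcases isEmpty_or_nonempty E with h | h
    · simp [Matrix.trace] at hσ1
    · exact_mod_cast Fintype.card_pos
  -- The slack H < r pays for a multiple of the identity that makes 2^{-r}σ invertible and raises
  -- its trace to exactly 2^{-H}.
  set t : ℝ := ((2 : ℝ) ^ (-H) - (2 : ℝ) ^ (-r)) / Fintype.card E with ht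
  have ht0 : 0 < t :=
    div_pos (sub_pos.2 (Real.rpow_lt_rpow_of_exponent_lt (by norm_num) (by linarith))) hcard
  set A : Matrix E E ℂ := ((2 : ℝ) ^ (-r)) • σ + t • 1 with hAdef
  have hA : A.PosDef :=
    Matrix.PosDef.posSemidef_add (hσ.smul (by positivity)) (Matrix.PosDef.one.smul ht0)
  have hAtr : A.trace.re = (2 : ℝ) ^ (-H) := by
    simp only [hAdef, Matrix.trace_add, Matrix.trace_smul, hσ1, Matrix.trace_one, Complex.add_re,
      Complex.smul_re, Complex.one_re, Complex.natCast_re, smul_eq_mul, ht]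
    field_simp
    ring
  have hQW := hW.mul hQ
  set B := CFC.sqrt ρ' * (W * Q) with hB
  have hBA : ∀ a, (A - rowBlock B a * (rowBlock B a)ᴴ).PosSemidef := by
    intro a
    have h1 : (ρ' - B * Bᴴ).PosSemidef := by
      have : ρ' - B * Bᴴ = CFC.sqrt ρ' * (1 - W * Q * (W * Q)ᴴ) * (CFC.sqrt ρ')ᴴ := by
        rw [Matrix.mul_sub, Matrix.sub_mul, Matrix.mul_one, (isHermitian_sqrt ρ').eq,
          sqrt_mul_sqrt hρ'.1, hB, Matrix.conjTranspose_mul _ (W * Q), (isHermitian_sqrt ρ').eq]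
        simp only [Matrix.mul_assoc]
      rw [this]
      exact Matrix.PosSemidef.mul_mul_conjTranspose_same hQW _
    have h2 := ((Matrix.le_iff.1 hr).add h1).submatrix (fun e : E => (a, e))
    have h3 : A - rowBlock B a * (rowBlock B a)ᴴ = t • 1 +
        (((2 : ℝ) ^ (-r)) • ((1 : Matrix (Bits n) (Bits n) ℂ) ⊗ₖ σ) - ρ' +
          (ρ' - B * Bᴴ)).submatrix (fun e : E => (a, e)) (fun e : E => (a, e)) := by
      rw [rowBlock_mul_conjTranspose, hAdef]
      ext e e'
      simp [diagBlock]
      ring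
    rw [h3]
    exact (Matrix.PosDef.one.smul ht0).posSemidef.add h2
  have hB1 : hsNormSq B ≤ 1 := by
    refine (hsNormSq_mul_le _ hQW).trans (le_trans (le_of_eq ?_) hρ'.2)
    rw [← re_trace_mul_conjTranspose, (isHermitian_sqrt ρ').eq, sqrt_mul_sqrt hρ'.1]
  have hN : hsNormSq (N₀ * Q) ≤ s ^ 2 := hs2 ▸ hsNormSq_mul_le _ hQ
  have hR : CFC.sqrt ρ * Q = N₀ * Q + (F : ℂ) • B := by
    rw [hN₀, hB, Matrix.sub_mul, Matrix.smul_mul, Matrix.mul_assoc, sub_add_cancel]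
  have hmain := leftover_hashing hp hg hu hV hA hBA hF0 hs0 (by linarith) hN hB1 hR
  simp only [rowBlock_mul_conjTranspose, ← hQτ, hAtr, two_rpow_half_eq] at hmain
  nlinarith

/-- Leftover hashing for `τ ≤ ρ` in terms of the smooth min-entropy of `ρ`. -/
theorem smooth_leftover_hashing {p : 𝒢 → ℝ} (hp : p ∈ stdSimplex ℝ 𝒢)
    {g : 𝒢 → Bits n →ₗ[ZMod 2] Bits m} (hg : ∀ i, Function.Surjective (g i))
    (hu : IsUniversal₂ p (fun i => ⇑(g i))) {V : 𝒢 → Bits m → Matrix E E ℂ}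
    (hV : ∀ i k, IsContraction (V i k)) {ρ τ : Matrix (Bits n × E) (Bits n × E) ℂ}
    (hρ : IsSubnormalized ρ) (hτ : τ.PosSemidef) (hτρ : τ ≤ ρ)
    {ε Hth : ℝ} (hSM : (Hth : EReal) ≤ smoothMinEntropy ε ρ) :
    ∑ i, p i * ∑ k, (V i k * ∑ a, hashDev (g i) k a • diagBlock τ a).trace.re ≤
      2 * ε + (2 : ℝ) ^ (((m : ℝ) - Hth + 3) / 2) := by
  -- The suprema defining the entropies need not be attained, so each H below the threshold is
  -- treated separately; continuity of the bound in H then gives the threshold itself.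
  have key : ∀ H < Hth,
      ∑ i, p i * ∑ k, (V i k * ∑ a, hashDev (g i) k a • diagBlock τ a).trace.re ≤
        2 * ε + (2 : ℝ) ^ (((m : ℝ) - H + 3) / 2) := by
    intro H hH
    have h1 : (H : EReal) < smoothMinEntropy ε ρ := (EReal.coe_lt_coe_iff.2 hH).trans_le hSM
    obtain ⟨_, ⟨ρ', hρ', hP, rfl⟩, h2⟩ := lt_sSup_iff.1 h1
    obtain ⟨_, ⟨r, rfl, σ, hσ, hσ1, hr⟩, h3⟩ := lt_sSup_iff.1 h2
    exact leftover_hashing_of_le hp hg hu hV hρ hρ' hτ hτρ hP hσ hσ1 hr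
      (EReal.coe_lt_coe_iff.1 h3)
  have hcont : Filter.Tendsto (fun H : ℝ => 2 * ε + (2 : ℝ) ^ (((m : ℝ) - H + 3) / 2))
      (nhdsWithin Hth (Set.Iio Hth)) (nhds (2 * ε + (2 : ℝ) ^ (((m : ℝ) - Hth + 3) / 2))) := by
    apply Filter.Tendsto.mono_left _ nhdsWithin_le_nhds
    apply Continuous.tendsto
    fun_prop (disch := norm_num)
  exact ge_of_tendsto hcont (Filter.eventually_of_mem self_mem_nhdsWithin key)

end Smoothing

/-! ### The states of the actual scheme -/

section PartialTrace

variable {α β : Type*} [Fintype α] [DecidableEq α] [Fintype β] [DecidableEq β]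

lemma proj_apply (i x y : α) : proj i x y = if x = y ∧ i = x then 1 else 0 := by
  simp only [proj, Matrix.single_apply]
  congr 1
  simp only [eq_iff_iff]
  constructor
  · rintro ⟨rfl, rfl⟩; simp
  · rintro ⟨rfl, rfl⟩; simp

lemma posSemidef_trFst {ρ : Matrix (α × β) (α × β) ℂ} (hρ : ρ.PosSemidef) :
    (trFst ρ).PosSemidef := by
  have : trFst ρ = ∑ x, ρ.submatrix (fun i => (x, i)) (fun i => (x, i)) := by
    ext i j; simp [trFst, Matrix.sum_apply]
  rw [this]
  exact Matrix.posSemidef_sum _ fun x _ => hρ.submatrix _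

lemma trace_trFst (ρ : Matrix (α × β) (α × β) ℂ) : (trFst ρ).trace = ρ.trace := by
  simp only [Matrix.trace, trFst, Matrix.diag_apply, Fintype.sum_prod_type]
  exact Finset.sum_comm

lemma trFst_sum {ι : Type*} (s : Finset ι) (ρ : ι → Matrix (α × β) (α × β) ℂ) :
    trFst (∑ i ∈ s, ρ i) = ∑ i ∈ s, trFst (ρ i) := by
  ext i j
  simp only [trFst, Matrix.sum_apply]
  exact Finset.sum_comm

lemma trace_mul_mul_conjTranspose {γ : Type*} [Fintype γ] (K : Matrix γ α ℂ) (ρ : Matrix α α ℂ) :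
    (K * ρ * Kᴴ).trace = (Kᴴ * K * ρ).trace := by
  rw [Matrix.trace_mul_comm, ← Matrix.mul_assoc]

lemma announce_conjTranspose_mul {E T : Type*} [Fintype E] [DecidableEq E] [Fintype T]
    [DecidableEq T] (t : T) : (announce E t)ᴴ * announce E t = 1 := by
  ext e e'
  simp only [Matrix.mul_apply, Matrix.conjTranspose_apply, announce, Fintype.sum_prod_type,
    Matrix.one_apply]
  rw [Finset.sum_eq_single e, Finset.sum_eq_single t]
  · simp
  · intro x _ hx; simp [hx]
  · simp
  · intro x _ hx; simp [hx]
  · simp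

end PartialTrace

namespace Scheme

variable {n m l c : ℕ} {A' B' E T R I J 𝒰 𝒢 : Type*}
  [Fintype A'] [DecidableEq A'] [Fintype B'] [DecidableEq B'] [Fintype E] [DecidableEq E]
  [Fintype T] [DecidableEq T] [Fintype R] [DecidableEq R] [Fintype I] [Fintype J]
  [Fintype 𝒰] [DecidableEq 𝒰] [Fintype 𝒢] [DecidableEq 𝒢]
  (S : Scheme n m l c A' B' E T R I J 𝒰 𝒢)

lemma posSemidef_sampled : S.sampled.PosSemidef :=
  Matrix.posSemidef_sum _ fun _ _ => S.ini_sub.1.mul_mul_conjTranspose_same _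

lemma posSemidef_siftedBlock (a b : Bits n) : (S.siftedBlock a b).PosSemidef :=
  posSemidef_trFst <| Matrix.posSemidef_sum _ fun _ _ => Matrix.posSemidef_sum _ fun _ _ =>
    S.posSemidef_sampled.mul_mul_conjTranspose_same _

/-- The announcement is an isometry, and dropping the rejected outcomes can only lose trace. -/
lemma re_trace_sampled_le : S.sampled.trace.re ≤ 1 := by
  refine le_trans ?_ S.ini_sub.2
  have h0 : ∀ r, 0 ≤ (((S.smp r)ᴴ * S.smp r) ⊗ₖ (1 : Matrix E E ℂ) * S.ini).trace.re := fun r => by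
    have h : ((S.smp r ⊗ₖ (1 : Matrix E E ℂ)) * S.ini *
        (S.smp r ⊗ₖ (1 : Matrix E E ℂ))ᴴ).trace =
        (((S.smp r)ᴴ * S.smp r) ⊗ₖ (1 : Matrix E E ℂ) * S.ini).trace := by
      rw [trace_mul_mul_conjTranspose, Matrix.conjTranspose_kronecker, ← Matrix.mul_kronecker_mul]
      simp
    rw [← h]
    exact re_trace_nonneg (S.ini_sub.1.mul_mul_conjTranspose_same _)
  calc S.sampled.trace.re
      = ∑ r ∈ S.accept, (((S.smp r)ᴴ * S.smp r) ⊗ₖ (1 : Matrix E E ℂ) * S.ini).trace.re := by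
        simp only [sampled, Matrix.trace_sum, Complex.re_sum, trace_mul_mul_conjTranspose]
        simp only [Matrix.conjTranspose_kronecker, ← Matrix.mul_kronecker_mul,
          announce_conjTranspose_mul]
    _ ≤ ∑ r, (((S.smp r)ᴴ * S.smp r) ⊗ₖ (1 : Matrix E E ℂ) * S.ini).trace.re :=
        Finset.sum_le_univ_sum_of_nonneg h0
    _ = S.ini.trace.re := by
        rw [← Complex.re_sum, ← Matrix.trace_sum, ← Finset.sum_mul]
        have : ∑ r, ((S.smp r)ᴴ * S.smp r) ⊗ₖ (1 : Matrix E E ℂ) = 1 := by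
          rw [← Matrix.one_kronecker_one, ← S.smp_sum]
          ext ⟨x, y⟩ ⟨x', y'⟩
          simp only [Matrix.sum_apply, Matrix.kroneckerMap_apply, Finset.sum_mul]
        rw [this, Matrix.one_mul]

lemma sum_re_trace_siftedBlock_le : ∑ a, ∑ b, (S.siftedBlock a b).trace.re ≤ 1 := by
  refine le_trans (le_of_eq ?_) S.re_trace_sampled_le
  simp only [siftedBlock, trace_trFst, Matrix.trace_sum, trace_mul_mul_conjTranspose]
  simp only [Matrix.conjTranspose_kronecker, ← Matrix.mul_kronecker_mul]
  simp only [← Complex.re_sum, ← Matrix.trace_sum, ← Finset.sum_mul]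
  have : ∑ a, ∑ b, ∑ i, ∑ j, (((S.sifA a i)ᴴ * S.sifA a i) ⊗ₖ ((S.sifB b j)ᴴ * S.sifB b j)) ⊗ₖ
      ((1 : Matrix (E × T) (E × T) ℂ)ᴴ * 1) = 1 := by
    rw [show (1 : Matrix ((A' × B') × (E × T)) ((A' × B') × (E × T)) ℂ) =
      ((1 : Matrix A' A' ℂ) ⊗ₖ (1 : Matrix B' B' ℂ)) ⊗ₖ 1 by simp, ← S.sifA_sum, ← S.sifB_sum]
    ext ⟨⟨x, y⟩, z⟩ ⟨⟨x', y'⟩, z'⟩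
    simp only [Matrix.sum_apply, Matrix.kroneckerMap_apply, Finset.sum_mul, Finset.mul_sum,
      Matrix.conjTranspose_one, Matrix.one_mul]
    rw [Finset.sum_comm]
    refine Finset.sum_congr rfl fun b _ => ?_
    rw [Finset.sum_comm (γ := J)]
    refine Finset.sum_congr rfl fun a _ => ?_
    rw [Finset.sum_comm]
  rw [this, Matrix.one_mul]

/-- Eve's sub-normalized state when Alice's sifted key is `a`. -/
def siftedA (a : Bits n) : Matrix (E × T) (E × T) ℂ := ∑ b, S.siftedBlock a b

lemma posSemidef_siftedA (a : Bits n) : (S.siftedA a).PosSemidef :=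
  Matrix.posSemidef_sum _ fun _ _ => S.posSemidef_siftedBlock _ _

end Scheme

/-- The classical-quantum state with blocks `τ a`. -/
def cqState {X E : Type*} [Fintype X] [DecidableEq X] (τ : X → Matrix E E ℂ) :
    Matrix (X × E) (X × E) ℂ := ∑ a, proj a ⊗ₖ τ a

section cqState

variable {X E : Type*} [Fintype X] [DecidableEq X] [Fintype E] [DecidableEq E]

lemma cqState_apply (τ : X → Matrix E E ℂ) (a : X) (e : E) (a' : X) (e' : E) :
    cqState τ (a, e) (a', e') = if a = a' then τ a e e' else 0 := by
  simp only [cqState, Matrix.sum_apply, Matrix.kroneckerMap_apply, proj_apply]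
  by_cases h : a = a' <;> simp [h]

lemma diagBlock_cqState (τ : X → Matrix E E ℂ) (a : X) : diagBlock (cqState τ) a = τ a := by
  ext e e'
  simp [diagBlock, cqState_apply]

lemma posSemidef_cqState {τ : X → Matrix E E ℂ} (h : ∀ a, (τ a).PosSemidef) :
    (cqState τ).PosSemidef := by
  refine Matrix.posSemidef_sum _ fun a _ => ?_
  refine Matrix.PosSemidef.kronecker ?_ (h a)
  have : proj a = pureState (Pi.single a 1 : X → ℂ) := by
    ext x y
    simp [proj_apply, pureState, Matrix.vecMulVec_apply, Pi.single_apply]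
    aesop
  rw [this]
  exact Matrix.posSemidef_vecMulVec_self_star _

lemma cqState_sub (τ τ' : X → Matrix E E ℂ) :
    cqState (fun a => τ a - τ' a) = cqState τ - cqState τ' := by
  ext ⟨a, e⟩ ⟨a', e'⟩
  simp only [Matrix.sub_apply, cqState_apply]
  split_ifs <;> simp

lemma cqState_mono {τ τ' : X → Matrix E E ℂ} (h : ∀ a, τ a ≤ τ' a) :
    cqState τ ≤ cqState τ' := by
  rw [Matrix.le_iff, ← cqState_sub]
  exact posSemidef_cqState fun a => Matrix.le_iff.1 (h a)

lemma trace_cqState (τ : X → Matrix E E ℂ) : (cqState τ).trace = ∑ a, (τ a).trace := by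
  simp [Matrix.trace, Fintype.sum_prod_type, cqState_apply]

end cqState

namespace Scheme

variable {n m l c : ℕ} {A' B' E T R I J 𝒰 𝒢 : Type*}
  [Fintype A'] [DecidableEq A'] [Fintype B'] [DecidableEq B'] [Fintype E] [DecidableEq E]
  [Fintype T] [DecidableEq T] [Fintype R] [DecidableEq R] [Fintype I] [Fintype J]
  [Fintype 𝒰] [DecidableEq 𝒰] [Fintype 𝒢] [DecidableEq 𝒢]
  (S : Scheme n m l c A' B' E T R I J 𝒰 𝒢)

lemma siftedAE_eq : S.siftedAE = cqState S.siftedA := by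
  ext ⟨a, e⟩ ⟨a', e'⟩
  simp only [siftedAE, cqState, siftedA, Matrix.sum_apply, Matrix.kroneckerMap_apply,
    Finset.mul_sum]

lemma isSubnormalized_siftedAE : IsSubnormalized S.siftedAE := by
  rw [siftedAE_eq]
  refine ⟨posSemidef_cqState S.posSemidef_siftedA, ?_⟩
  rw [trace_cqState]
  simpa [siftedA, Matrix.trace_sum] using S.sum_re_trace_siftedBlock_le

/-- Eve's unnormalized state when the keys are `k`, `k'`, given the hash functions and the
verification outcome. -/
def keyBlock (ok : Bool) (g : 𝒢) (u : 𝒰) (k k' : Bits m) : Matrix (E × T) (E × T) ℂ :=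
  ∑ a, ∑ b, ∑ w, ∑ b', (S.ec a b (w, b') * (if decide (S.u u a = S.u u b') = ok then 1 else 0) *
    (if S.g g a = k ∧ S.g g b' = k' then 1 else 0)) • S.siftedBlock a b


/-- The summands of the final state. -/
lemma finalBranch_summand_apply (M : Matrix (E × T) (E × T) ℂ) (κ κ' : Bits m) (v : 𝒰) (z : Bits c)
    (t : Bits l) (γ : 𝒢) (k k' : Bits m) (e : E × T) (u : 𝒰) (x : Bits c) (y : Bits l)
    (g : 𝒢) (k₂ k₂' : Bits m) (e₂ : E × T) (u₂ : 𝒰) (x₂ : Bits c) (y₂ : Bits l) (g₂ : 𝒢) :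
    (proj κ ⊗ₖ (proj κ' ⊗ₖ ((M ⊗ₖ (proj v ⊗ₖ (proj z ⊗ₖ proj t))) ⊗ₖ proj γ)) : Matrix _ _ ℂ)
      (k, k', (e, (u, x, y)), g) (k₂, k₂', (e₂, (u₂, x₂, y₂)), g₂) =
      if k = k₂ ∧ k' = k₂' ∧ u = u₂ ∧ x = x₂ ∧ y = y₂ ∧ g = g₂ then
        (if γ = g then 1 else 0) * (if v = u then 1 else 0) * (if κ = k ∧ κ' = k' then 1 else 0) *
          (if z = x then 1 else 0) * (if t = y then 1 else 0) * M e e₂ else 0 := by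
  simp only [Matrix.kroneckerMap_apply, proj_apply]
  by_cases h1 : k = k₂
  swap
  · simp only [h1, false_and, if_false, zero_mul]
  by_cases h2 : k' = k₂'
  swap
  · simp only [h2, false_and, and_false, if_false, zero_mul, mul_zero]
  by_cases h3 : u = u₂
  swap
  · simp only [h3, false_and, and_false, if_false, zero_mul, mul_zero]
  by_cases h4 : x = x₂
  swap
  · simp only [h4, false_and, and_false, if_false, zero_mul, mul_zero]
  by_cases h5 : y = y₂
  swap
  · simp only [h5, false_and, and_false, if_false, zero_mul, mul_zero]
  by_cases h6 : g = g₂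
  swap
  · simp only [h6, false_and, and_false, if_false, mul_zero]
  simp only [h1, h2, h3, h4, h5, h6, true_and, if_true]
  by_cases h7 : κ = k₂
  swap
  · simp only [h7, false_and, if_false, zero_mul, mul_zero]
  simp only [h7, true_and, if_true]
  ring

/-- Security of the one-time pads: the right-hand side depends on the cipher texts x and y only
through the uniform weights. -/
lemma finalBranch_apply (ok : Bool) (k k' : Bits m) (e : E × T) (u : 𝒰) (x : Bits c) (y : Bits l)
    (g : 𝒢) (k₂ k₂' : Bits m) (e₂ : E × T) (u₂ : 𝒰) (x₂ : Bits c) (y₂ : Bits l) (g₂ : 𝒢) :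
    S.finalBranch ok (k, k', (e, (u, x, y)), g) (k₂, k₂', (e₂, (u₂, x₂, y₂)), g₂) =
      if k = k₂ ∧ k' = k₂' ∧ u = u₂ ∧ x = x₂ ∧ y = y₂ ∧ g = g₂ then
        ((S.pG g * S.pU u * (2 : ℝ) ^ (-(c : ℝ)) * (2 : ℝ) ^ (-(l : ℝ)) : ℝ) : ℂ) *
          S.keyBlock ok g u k k' e e₂ else 0 := by
  simp only [finalBranch, Matrix.sum_apply, Matrix.smul_apply, finalBranch_summand_apply]
  by_cases h : k = k₂ ∧ k' = k₂' ∧ u = u₂ ∧ x = x₂ ∧ y = y₂ ∧ g = g₂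
  · simp only [if_pos h]
    rw [Finset.sum_eq_single g (fun g' _ hg' => by
        simp only [if_neg hg', zero_mul, smul_zero, Finset.sum_const_zero])
        (fun h => absurd (Finset.mem_univ _) h),
      Finset.sum_eq_single u (fun u' _ hu' => by
        simp only [if_neg hu', mul_zero, zero_mul, smul_zero, Finset.sum_const_zero])
        (fun h => absurd (Finset.mem_univ _) h)]
    simp only [keyBlock, Matrix.sum_apply, Matrix.smul_apply, Finset.mul_sum]
    refine Finset.sum_congr rfl fun a _ => Finset.sum_congr rfl fun b _ =>
        Finset.sum_congr rfl fun w _ => Finset.sum_congr rfl fun b' _ => ?_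
    -- For given plain texts, exactly one pad x − w and one pad y − u(a) produce the observed cipher
    -- texts.
    rw [Finset.sum_eq_single (x - w) (fun x' _ hx' => Finset.sum_eq_zero fun y' _ => by
        rw [if_neg (c := w + x' = x) fun h => hx' (by rw [← h, add_sub_cancel_left])]
        simp only [mul_zero, zero_mul, smul_zero])
        (fun h => absurd (Finset.mem_univ _) h),
      Finset.sum_eq_single (y - S.u u a) (fun y' _ hy' => by
        rw [if_neg (c := S.u u a + y' = y) fun h => hy' (by rw [← h, add_sub_cancel_left])]
        simp only [mul_zero, zero_mul, smul_zero])
        (fun h => absurd (Finset.mem_univ _) h)]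
    simp only [add_sub_cancel, if_true, Complex.real_smul, one_mul, mul_one]
    by_cases hk : S.g g a = k ∧ S.g g b' = k'
    · simp only [if_pos hk]
      push_cast
      ring
    · simp only [if_neg hk, mul_zero, zero_mul, Complex.ofReal_zero]
  · simp only [if_neg h, smul_zero, Finset.sum_const_zero]

lemma sum_ec (a b : Bits n) : ∑ w, ∑ b', S.ec a b (w, b') = 1 := by
  rw [← Fintype.sum_prod_type (f := S.ec a b)]
  exact (S.ec_prob a b).2

/-- With both verification outcomes kept and k' forgotten, error correction acts only on Bob's side
and its probabilities sum to one. -/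
lemma sum_keyBlock (g : 𝒢) (u : 𝒰) (k : Bits m) :
    ∑ k', (S.keyBlock true g u k k' + S.keyBlock false g u k k') =
      ∑ a, (if S.g g a = k then (1 : ℝ) else 0) • S.siftedA a := by
  have h1 : ∀ k', S.keyBlock true g u k k' + S.keyBlock false g u k k' =
      ∑ a, ∑ b, ∑ w, ∑ b', (S.ec a b (w, b') * (if S.g g a = k ∧ S.g g b' = k' then 1 else 0)) •
        S.siftedBlock a b := fun k' => by
    simp only [keyBlock, ← Finset.sum_add_distrib, ← add_smul]
    refine Finset.sum_congr rfl fun a _ => Finset.sum_congr rfl fun b _ =>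
        Finset.sum_congr rfl fun w _ => Finset.sum_congr rfl fun b' _ => ?_
    congr 1
    by_cases h : S.u u a = S.u u b' <;> simp [h]
  simp only [h1]
  rw [Finset.sum_comm]
  refine Finset.sum_congr rfl fun a _ => ?_
  rw [siftedA, Finset.smul_sum, Finset.sum_comm]
  refine Finset.sum_congr rfl fun b _ => ?_
  simp only [← Finset.sum_smul]
  congr 1
  rw [Finset.sum_comm]
  calc _ = ∑ w, ∑ b', S.ec a b (w, b') * (if S.g g a = k then (1 : ℝ) else 0) := by
        refine Finset.sum_congr rfl fun w _ => ?_
        rw [Finset.sum_comm]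
        refine Finset.sum_congr rfl fun b' _ => ?_
        rw [← Finset.mul_sum]
        congr 1
        by_cases h : S.g g a = k <;> simp [h]
    _ = _ := by simp only [← Finset.sum_mul, sum_ec, one_mul]

lemma finalAlice_apply (k : Bits m) (e : E × T) (g : 𝒢) (k₂ : Bits m) (e₂ : E × T) (g₂ : 𝒢) :
    S.finalAlice (k, e, g) (k₂, e₂, g₂) = if k = k₂ ∧ g = g₂ then
      (S.pG g : ℂ) * (∑ a, (if S.g g a = k then (1 : ℝ) else 0) • S.siftedA a) e e₂ else 0 := by
  simp only [finalAlice, Matrix.add_apply, Fintype.sum_prod_type, finalBranch_apply, true_and]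
  by_cases h : k = k₂ ∧ g = g₂
  · have hu : ∀ u, ∑ k', (S.keyBlock true g u k k' e e₂ + S.keyBlock false g u k k' e e₂) =
        (∑ a, (if S.g g a = k then (1 : ℝ) else 0) • S.siftedA a) e e₂ := fun u => by
      rw [← S.sum_keyBlock g u, Matrix.sum_apply]
      rfl
    have hw : ∑ u, ∑ _x : Bits c, ∑ _y : Bits l,
        S.pG g * S.pU u * (2 : ℝ) ^ (-(c : ℝ)) * (2 : ℝ) ^ (-(l : ℝ)) = S.pG g := by
      simp only [← Finset.mul_sum, sum_bits_two_rpow_neg, mul_one, S.pU_prob.2]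
    simp only [h.1, h.2, true_and, if_true, ← mul_add] at hu hw ⊢
    rw [Finset.sum_comm]
    conv_rhs => rw [← hw]
    push_cast
    simp only [Finset.sum_mul]
    refine Finset.sum_congr rfl fun u _ => ?_
    rw [Finset.sum_comm]
    refine Finset.sum_congr rfl fun x _ => ?_
    rw [Finset.sum_comm]
    refine Finset.sum_congr rfl fun y _ => ?_
    rw [← Finset.mul_sum, hu]
  · rw [if_neg h]
    refine Finset.sum_eq_zero fun _ _ => Finset.sum_eq_zero fun _ _ => Finset.sum_eq_zero fun _ _ =>
      Finset.sum_eq_zero fun _ _ => ?_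
    simp only [if_neg h, add_zero]

end Scheme

/-! ### Security of the actual scheme -/

section Distance

variable {m : ℕ} {E 𝒢 : Type*} [Fintype E] [DecidableEq E] [Fintype 𝒢] [DecidableEq 𝒢]

lemma hashState_apply (p : 𝒢 → ℝ) (g g₂ : 𝒢) :
    hashState p g g₂ = if g = g₂ then (p g : ℂ) else 0 := by
  simp only [hashState, Matrix.sum_apply, Matrix.smul_apply, proj_apply, Complex.real_smul]
  by_cases h : g = g₂ <;> simp [h]

/-- Moving the classical registers `K` and `G` to the front. -/
def keyHashEquiv (K E 𝒢 : Type*) : K × E × 𝒢 ≃ (𝒢 × K) × E where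
  toFun x := ((x.2.2, x.1), x.2.1)
  invFun y := (y.1.2, y.2, y.1.1)
  left_inv _ := rfl
  right_inv _ := rfl

/-- Serves the actual and the virtual scheme alike. The assumption that Eve's state ∑_k X g k is the
same for all g makes the ideal state block diagonal with blocks p g 2^{-m} ρE. -/
lemma d₁_le {p : 𝒢 → ℝ} (hp : p ∈ stdSimplex ℝ 𝒢)
    {ρ : Matrix (Bits m × E × 𝒢) (Bits m × E × 𝒢) ℂ} {X : 𝒢 → Bits m → Matrix E E ℂ}
    {ρE : Matrix E E ℂ} {C : ℝ}
    (hρ : ∀ k e g k₂ e₂ g₂, ρ (k, e, g) (k₂, e₂, g₂) =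
      if k = k₂ ∧ g = g₂ then (p g : ℂ) * X g k e e₂ else 0)
    (hE : ∀ g, ∑ k, X g k = ρE)
    (h : ∀ V : 𝒢 → Bits m → Matrix E E ℂ, (∀ g k, IsContraction (V g k)) →
      ∑ g, p g * ∑ k, (V g k * (X g k - (2 : ℝ) ^ (-(m : ℝ)) • ρE)).trace.re ≤ C) :
    d₁ p ρ ≤ C := by
  have hred : trSnd (trFst ρ) = ρE := by
    ext e e₂
    have hp2 : ∑ g, (p g : ℂ) = 1 := by exact_mod_cast hp.2
    simp only [trSnd, trFst, hρ, and_self, if_true, ← Finset.mul_sum, ← Matrix.sum_apply, hE,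
      ← Finset.sum_mul, hp2, one_mul]
  refine traceNorm_le_of_blocks (keyHashEquiv (Bits m) E 𝒢)
    (D := fun i => p i.1 • (X i.1 i.2 - (2 : ℝ) ^ (-(m : ℝ)) • ρE)) ?_ ?_
  · rintro ⟨g, k⟩ e ⟨g₂, k₂⟩ e₂
    simp only [keyHashEquiv, Equiv.coe_fn_symm_mk, hred, Matrix.sub_apply, hρ, Matrix.sum_apply,
      Matrix.smul_apply, Matrix.kroneckerMap_apply, proj_apply, hashState_apply, Prod.mk.injEq]
    by_cases hg : g = g₂
    · by_cases hk : k = k₂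
      · simp [hg, hk]
        ring
      · simp [hk]
    · simp [hg]
  · intro V hV
    refine le_trans (le_of_eq ?_) (h (fun g k => V (g, k)) fun g k => hV _)
    rw [Fintype.sum_prod_type]
    simp only [Matrix.mul_smul, Matrix.trace_smul, Complex.smul_re, smul_eq_mul, Finset.mul_sum]

end Distance

namespace Scheme

variable {n m l c : ℕ} {A' B' E T R I J 𝒰 𝒢 : Type*}
  [Fintype A'] [DecidableEq A'] [Fintype B'] [DecidableEq B'] [Fintype E] [DecidableEq E]
  [Fintype T] [DecidableEq T] [Fintype R] [DecidableEq R] [Fintype I] [Fintype J]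
  [Fintype 𝒰] [DecidableEq 𝒰] [Fintype 𝒢] [DecidableEq 𝒢]
  (S : Scheme n m l c A' B' E T R I J 𝒰 𝒢)

lemma sum_hash_sub (g : Bits n →ₗ[ZMod 2] Bits m) (k : Bits m) {F : Type*}
    (τ : Bits n → Matrix F F ℂ) :
    ∑ a, (if g a = k then (1 : ℝ) else 0) • τ a - (2 : ℝ) ^ (-(m : ℝ)) • ∑ a, τ a =
      ∑ a, hashDev g k a • τ a := by
  simp only [hashDev, sub_smul, Finset.sum_sub_distrib, Finset.smul_sum]

lemma sum_hash (g : Bits n →ₗ[ZMod 2] Bits m) {F : Type*} (τ : Bits n → Matrix F F ℂ) :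
    ∑ k, ∑ a, (if g a = k then (1 : ℝ) else 0) • τ a = ∑ a, τ a := by
  rw [Finset.sum_comm]
  refine Finset.sum_congr rfl fun a _ => ?_
  rw [← Finset.sum_smul]
  simp only [Finset.sum_ite_eq, Finset.mem_univ, if_true, one_smul]

/-- Leftover hashing for a part `τ` of the sifted key state. -/
lemma hash_siftedA_le {ε Hth : ℝ} (hSM : (Hth : EReal) ≤ smoothMinEntropy ε S.siftedAE)
    {τ : Bits n → Matrix (E × T) (E × T) ℂ} (hτ : ∀ a, (τ a).PosSemidef)
    (hτS : ∀ a, τ a ≤ S.siftedA a) {V : 𝒢 → Bits m → Matrix (E × T) (E × T) ℂ}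
    (hV : ∀ g k, IsContraction (V g k)) :
    ∑ g, S.pG g * ∑ k, (V g k * ∑ a, hashDev (S.g g) k a • τ a).trace.re ≤
      2 * ε + (2 : ℝ) ^ (((m : ℝ) - Hth + 3) / 2) := by
  have h := smooth_leftover_hashing S.pG_prob S.g_surj S.g_univ hV S.isSubnormalized_siftedAE
    (posSemidef_cqState hτ) (S.siftedAE_eq ▸ cqState_mono hτS) hSM
  simpa only [diagBlock_cqState] using h

lemma d₁_finalAlice_le {ε Hth : ℝ} (hSM : (Hth : EReal) ≤ smoothMinEntropy ε S.siftedAE) :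
    d₁ S.pG S.finalAlice ≤ 2 * ε + (2 : ℝ) ^ (((m : ℝ) - Hth + 3) / 2) := by
  refine d₁_le S.pG_prob (ρE := ∑ a, S.siftedA a) S.finalAlice_apply
    (fun g => sum_hash (S.g g) S.siftedA) fun V hV => ?_
  simp only [sum_hash_sub]
  exact S.hash_siftedA_le hSM S.posSemidef_siftedA (fun a => le_refl _) hV

/-! ### Correct keys and wrongly accepted keys. -/

/-- Mixture of Eve's states, weighted by the sifted keys, the error correction messages and the
corrected key. -/
def mix (ω : Bits n → Bits n → Bits c → Bits n → ℝ) : Matrix (E × T) (E × T) ℂ :=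
  ∑ a, ∑ b, ∑ w, ∑ b', ω a b w b' • S.siftedBlock a b

lemma mix_add (ω ω' : Bits n → Bits n → Bits c → Bits n → ℝ) :
    S.mix (fun a b w b' => ω a b w b' + ω' a b w b') = S.mix ω + S.mix ω' := by
  simp only [mix, add_smul, Finset.sum_add_distrib]

lemma mix_sum {ι : Type*} [Fintype ι] (ω : ι → Bits n → Bits n → Bits c → Bits n → ℝ) :
    ∑ i, S.mix (ω i) = S.mix (fun a b w b' => ∑ i, ω i a b w b') := by
  simp only [mix, Finset.sum_smul]
  rw [Finset.sum_comm]
  refine Finset.sum_congr rfl fun a _ => ?_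
  rw [Finset.sum_comm]
  refine Finset.sum_congr rfl fun b _ => ?_
  rw [Finset.sum_comm]
  refine Finset.sum_congr rfl fun w _ => ?_
  rw [Finset.sum_comm]

lemma posSemidef_mix {ω : Bits n → Bits n → Bits c → Bits n → ℝ} (h : ∀ a b w b', 0 ≤ ω a b w b') :
    (S.mix ω).PosSemidef :=
  Matrix.posSemidef_sum _ fun _ _ => Matrix.posSemidef_sum _ fun _ _ =>
    Matrix.posSemidef_sum _ fun _ _ => Matrix.posSemidef_sum _ fun _ _ =>
      (S.posSemidef_siftedBlock _ _).smul (h _ _ _ _)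

lemma re_trace_mix (ω : Bits n → Bits n → Bits c → Bits n → ℝ) :
    (S.mix ω).trace.re = ∑ a, ∑ b, ∑ w, ∑ b', ω a b w b' * (S.siftedBlock a b).trace.re := by
  simp only [mix, Matrix.trace_sum, Complex.re_sum, Matrix.trace_smul, Complex.smul_re,
    smul_eq_mul]

lemma ec_nonneg (a b : Bits n) (x : Bits c × Bits n) : 0 ≤ S.ec a b x := (S.ec_prob a b).1 x

/-- Eve's state when Alice's sifted key is `a` and is corrected properly. -/
def correctA (a : Bits n) : Matrix (E × T) (E × T) ℂ :=
  ∑ b, ∑ w, ∑ b', (S.ec a b (w, b') * if a = b' then 1 else 0) • S.siftedBlock a b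

/-- Eve's state when verification accepts a wrong key, which leads to the keys `k`, `k'`. -/
def wrongBlock (g : 𝒢) (u : 𝒰) (k k' : Bits m) : Matrix (E × T) (E × T) ℂ :=
  S.mix fun a b w b' => S.ec a b (w, b') * (if a ≠ b' ∧ S.u u a = S.u u b' then 1 else 0) *
    (if S.g g a = k ∧ S.g g b' = k' then 1 else 0)

/-- Eve's state when verification accepts a wrong key. -/
def wrongState (u : 𝒰) : Matrix (E × T) (E × T) ℂ :=
  S.mix fun a b w b' => S.ec a b (w, b') * (if a ≠ b' ∧ S.u u a = S.u u b' then 1 else 0)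

lemma posSemidef_correctA (a : Bits n) : (S.correctA a).PosSemidef :=
  Matrix.posSemidef_sum _ fun _ _ => Matrix.posSemidef_sum _ fun _ _ =>
    Matrix.posSemidef_sum _ fun _ _ => (S.posSemidef_siftedBlock _ _).smul
      (mul_nonneg (S.ec_nonneg _ _ _) (by split_ifs <;> norm_num))

lemma correctA_le (a : Bits n) : S.correctA a ≤ S.siftedA a := by
  have h : S.siftedA a - S.correctA a =
      ∑ b, ∑ w, ∑ b', (S.ec a b (w, b') * if a = b' then 0 else 1) • S.siftedBlock a b := by
    rw [sub_eq_iff_eq_add, correctA, siftedA]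
    simp only [← Finset.sum_add_distrib, ← add_smul, ← mul_add]
    refine Finset.sum_congr rfl fun b _ => ?_
    have : ∀ b', ((if a = b' then (0 : ℝ) else 1) + if a = b' then 1 else 0) = 1 := fun b' => by
      split_ifs <;> norm_num
    simp only [this, mul_one, ← Finset.sum_smul, sum_ec, one_smul]
  rw [Matrix.le_iff, h]
  exact Matrix.posSemidef_sum _ fun _ _ => Matrix.posSemidef_sum _ fun _ _ =>
    Matrix.posSemidef_sum _ fun _ _ => (S.posSemidef_siftedBlock _ _).smul
      (mul_nonneg (S.ec_nonneg _ _ _) (by split_ifs <;> norm_num))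

lemma posSemidef_wrongBlock (g : 𝒢) (u : 𝒰) (k k' : Bits m) :
    (S.wrongBlock g u k k').PosSemidef :=
  S.posSemidef_mix fun a b w b' => mul_nonneg (mul_nonneg (S.ec_nonneg _ _ _)
    (by split_ifs <;> norm_num)) (by split_ifs <;> norm_num)

lemma posSemidef_wrongState (u : 𝒰) : (S.wrongState u).PosSemidef :=
  S.posSemidef_mix fun a b w b' => mul_nonneg (S.ec_nonneg _ _ _) (by split_ifs <;> norm_num)

lemma sum_wrongBlock (g : 𝒢) (u : 𝒰) : ∑ k, ∑ k', S.wrongBlock g u k k' = S.wrongState u := by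
  simp only [wrongBlock, wrongState, mix_sum, ← Finset.mul_sum]
  congr 1
  funext a b w b'
  have : ∑ k, ∑ k', (if S.g g a = k ∧ S.g g b' = k' then (1 : ℝ) else 0) = 1 := by
    simp [ite_and]
  rw [this, mul_one]

/-- If a = b', verification always accepts and k = k'. The remaining accepted events are collisions
of u. -/
lemma keyBlock_true_eq (g : 𝒢) (u : 𝒰) (k k' : Bits m) :
    S.keyBlock true g u k k' =
      (if k = k' then ∑ a, (if S.g g a = k then (1 : ℝ) else 0) • S.correctA a else 0) +
        S.wrongBlock g u k k' := by
  have h1 : (if k = k' then ∑ a, (if S.g g a = k then (1 : ℝ) else 0) • S.correctA a else 0) =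
      S.mix fun a b w b' => S.ec a b (w, b') * (if a = b' then 1 else 0) *
        (if S.g g a = k ∧ S.g g b' = k' then 1 else 0) := by
    simp only [mix, correctA, Finset.smul_sum, smul_smul]
    split_ifs with hk
    · subst hk
      refine Finset.sum_congr rfl fun a _ => Finset.sum_congr rfl fun b _ =>
        Finset.sum_congr rfl fun w _ => Finset.sum_congr rfl fun b' _ => ?_
      congr 1
      by_cases h : a = b'
      · subst h; simp [mul_comm]
      · simp [h]
    · symm
      refine Finset.sum_eq_zero fun a _ => Finset.sum_eq_zero fun b _ =>
        Finset.sum_eq_zero fun w _ => Finset.sum_eq_zero fun b' _ => ?_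
      by_cases h : a = b'
      · subst h
        rw [if_neg (c := _ ∧ _) (fun h => hk (h.1.symm.trans h.2)), mul_zero, zero_smul]
      · simp [h]
  rw [h1, wrongBlock, ← mix_add, keyBlock, mix]
  refine Finset.sum_congr rfl fun a _ => Finset.sum_congr rfl fun b _ =>
        Finset.sum_congr rfl fun w _ => Finset.sum_congr rfl fun b' _ => ?_
  congr 1
  rw [← add_mul, ← mul_add]
  congr 2
  by_cases h : a = b'
  · subst h; simp
  · simp [h]

lemma sum_keyBlock_true (g : 𝒢) (u : 𝒰) :
    ∑ k, ∑ k', S.keyBlock true g u k k' = ∑ a, S.correctA a + S.wrongState u := by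
  simp only [keyBlock_true_eq, Finset.sum_add_distrib, sum_wrongBlock, Finset.sum_ite_eq,
    Finset.mem_univ, if_true, sum_hash]

/-- The function u is independent of a and b', so for each pair a ≠ b' the average over u is a
collision probability. -/
lemma sum_re_trace_wrongState_le : ∑ u, S.pU u * (S.wrongState u).trace.re ≤ (2 : ℝ) ^ (-(l : ℝ)) := by
  have hcol : ∀ a b', ∑ u, S.pU u * (if a ≠ b' ∧ S.u u a = S.u u b' then 1 else 0) ≤
      (2 : ℝ) ^ (-(l : ℝ)) := fun a b' => by
    by_cases h : a = b'
    · simp only [h, ne_eq, not_true, false_and, if_false, mul_zero, Finset.sum_const_zero]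
      positivity
    · simpa only [ne_eq, h, not_false_eq_true, true_and] using S.u_univ a b' h
  calc ∑ u, S.pU u * (S.wrongState u).trace.re
      = ∑ a, ∑ b, ∑ w, ∑ b', S.ec a b (w, b') * (S.siftedBlock a b).trace.re *
          ∑ u, S.pU u * (if a ≠ b' ∧ S.u u a = S.u u b' then 1 else 0) := by
        simp only [wrongState, re_trace_mix, Finset.mul_sum]
        rw [Finset.sum_comm]
        refine Finset.sum_congr rfl fun a _ => ?_
        rw [Finset.sum_comm]
        refine Finset.sum_congr rfl fun b _ => ?_
        rw [Finset.sum_comm]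
        refine Finset.sum_congr rfl fun w _ => ?_
        rw [Finset.sum_comm]
        refine Finset.sum_congr rfl fun b' _ => Finset.sum_congr rfl fun u _ => ?_
        ring
    _ ≤ ∑ a, ∑ b, ∑ w, ∑ b', S.ec a b (w, b') * (S.siftedBlock a b).trace.re *
          (2 : ℝ) ^ (-(l : ℝ)) := by
        gcongr with a _ b _ w _ b' _
        · exact mul_nonneg (S.ec_nonneg _ _ _) (re_trace_nonneg (S.posSemidef_siftedBlock a b))
        · exact hcol a b'
    _ = (∑ a, ∑ b, (S.siftedBlock a b).trace.re) * (2 : ℝ) ^ (-(l : ℝ)) := by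
        simp only [← Finset.sum_mul, sum_ec, one_mul]
    _ ≤ 1 * (2 : ℝ) ^ (-(l : ℝ)) := by
        gcongr
        exact S.sum_re_trace_siftedBlock_le
    _ = _ := one_mul _

/-- The contribution of a fixed verification function and fixed cipher texts. -/
lemma sum_keyBlock_dev_le {ε Hth : ℝ} (hSM : (Hth : EReal) ≤ smoothMinEntropy ε S.siftedAE)
    (u : 𝒰) {V : 𝒢 → Bits m → Bits m → Matrix (E × T) (E × T) ℂ}
    (hV : ∀ g k k', IsContraction (V g k k')) :
    ∑ g, S.pG g * ∑ k, ∑ k', (V g k k' * (S.keyBlock true g u k k' -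
      (if k = k' then (2 : ℝ) ^ (-(m : ℝ)) else 0) •
        (∑ a, S.correctA a + S.wrongState u))).trace.re ≤
      (2 * ε + (2 : ℝ) ^ (((m : ℝ) - Hth + 3) / 2)) + 2 * (S.wrongState u).trace.re := by
  -- The correct part reduces to a hashing deviation tested on the diagonal k = k'. The wrong part
  -- occurs twice, in the real state and in Eve's marginal inside the ideal state.
  have hsplit : ∀ g k, ∑ k', (V g k k' * (S.keyBlock true g u k k' -
      (if k = k' then (2 : ℝ) ^ (-(m : ℝ)) else 0) •
        (∑ a, S.correctA a + S.wrongState u))).trace.re =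
      (V g k k * ∑ a, hashDev (S.g g) k a • S.correctA a).trace.re +
      (∑ k', (V g k k' * S.wrongBlock g u k k').trace.re +
        (2 : ℝ) ^ (-(m : ℝ)) * -(V g k k * S.wrongState u).trace.re) := by
    intro g k
    have h1 : ∀ k', (V g k k' * (S.keyBlock true g u k k' -
      (if k = k' then (2 : ℝ) ^ (-(m : ℝ)) else 0) •
        (∑ a, S.correctA a + S.wrongState u))).trace.re =
        (if k = k' then (V g k k' * ∑ a, hashDev (S.g g) k a • S.correctA a).trace.re +
          (2 : ℝ) ^ (-(m : ℝ)) * -(V g k k' * S.wrongState u).trace.re else 0) +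
          (V g k k' * S.wrongBlock g u k k').trace.re := by
      intro k'
      rw [keyBlock_true_eq]
      split_ifs with hk
      · rw [← sum_hash_sub]
        simp only [Matrix.mul_add, Matrix.mul_sub, Matrix.trace_add, Matrix.trace_sub,
          Matrix.mul_smul, Matrix.trace_smul, smul_add, Complex.add_re, Complex.sub_re,
          Complex.smul_re, smul_eq_mul]
        ring
      · simp
    simp only [h1, Finset.sum_add_distrib, Finset.sum_ite_eq, Finset.mem_univ, if_true]
    ring
  have hcorr := S.hash_siftedA_le hSM S.posSemidef_correctA S.correctA_le
    (V := fun g k => V g k k) fun g k => hV g k k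
  have hwrong : ∀ g, ∑ k, (∑ k', (V g k k' * S.wrongBlock g u k k').trace.re +
        (2 : ℝ) ^ (-(m : ℝ)) * -(V g k k * S.wrongState u).trace.re) ≤
      2 * (S.wrongState u).trace.re := by
    intro g
    have e1 : ∑ k, ∑ k', (V g k k' * S.wrongBlock g u k k').trace.re ≤
        (S.wrongState u).trace.re := by
      rw [← S.sum_wrongBlock g u]
      simp only [Matrix.trace_sum, Complex.re_sum]
      refine Finset.sum_le_sum fun k _ => Finset.sum_le_sum fun k' _ => ?_
      exact re_trace_contraction_posSemidef_le (hV g k k') (S.posSemidef_wrongBlock g u k k')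
    have e2 : ∑ k, (2 : ℝ) ^ (-(m : ℝ)) * -(V g k k * S.wrongState u).trace.re ≤
        (S.wrongState u).trace.re := by
      calc _ ≤ ∑ _k : Bits m, (2 : ℝ) ^ (-(m : ℝ)) * (S.wrongState u).trace.re := by
            gcongr with k _
            exact neg_re_trace_contraction_posSemidef_le (hV g k k) (S.posSemidef_wrongState u)
        _ = _ := by rw [← Finset.sum_mul, sum_bits_two_rpow_neg, one_mul]
    rw [Finset.sum_add_distrib]
    linarith
  simp only [hsplit, Finset.sum_add_distrib (f := fun k => (V _ k k * _).trace.re), mul_add]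
  rw [Finset.sum_add_distrib]
  refine add_le_add hcorr ?_
  simp only [← mul_add, ← Finset.sum_add_distrib]
  calc _ ≤ ∑ g, S.pG g * (2 * (S.wrongState u).trace.re) :=
        Finset.sum_le_sum fun g _ => mul_le_mul_of_nonneg_left (hwrong g) (S.pG_prob.1 g)
    _ = _ := by rw [← Finset.sum_mul, S.pG_prob.2, one_mul]

/-- Moving all classical registers of the final state to the front. -/
def finalEquiv (K F Z 𝒢 : Type*) : K × K × (F × Z) × 𝒢 ≃ (Z × 𝒢 × K × K) × F where
  toFun x := ((x.2.2.1.2, x.2.2.2, x.1, x.2.1), x.2.2.1.1)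
  invFun y := (y.1.2.2.1, y.1.2.2.2, (y.2, y.1.1), y.1.2.1)
  left_inv _ := rfl
  right_inv _ := rfl

/-- Eve's marginal in the ideal state. The accepted weight for given u does not depend on g, so
averaging over g has no effect. -/
lemma reduced_final_apply (e : E × T) (u : 𝒰) (x : Bits c) (y : Bits l) (e₂ : E × T) (u₂ : 𝒰)
    (x₂ : Bits c) (y₂ : Bits l) :
    trSnd (trFst (trFst S.final)) (e, (u, x, y)) (e₂, (u₂, x₂, y₂)) =
      if u = u₂ ∧ x = x₂ ∧ y = y₂ then
        ((S.pU u * (2 : ℝ) ^ (-(c : ℝ)) * (2 : ℝ) ^ (-(l : ℝ)) : ℝ) : ℂ) *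
          (∑ a, S.correctA a + S.wrongState u) e e₂ else 0 := by
  simp only [trSnd, trFst, final, finalBranch_apply, true_and, and_true]
  split_ifs with h
  · have hg : ∀ g, ∑ k', ∑ k, S.keyBlock true g u k k' e e₂ =
        (∑ a, S.correctA a + S.wrongState u) e e₂ := fun g => by
      rw [← S.sum_keyBlock_true g u, Finset.sum_comm]
      simp only [Matrix.sum_apply]
    have hp2 : ∑ g, (S.pG g : ℂ) = 1 := by exact_mod_cast S.pG_prob.2
    simp only [← Finset.mul_sum, hg, ← Finset.sum_mul]
    push_cast
    simp only [← Finset.sum_mul, hp2, one_mul]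
  · simp only [Finset.sum_const_zero]

-- The pads contribute only uniform weights, so the distance is bounded by the average over u of the
-- estimate `sum_keyBlock_dev_le`.
set_option synthInstance.maxHeartbeats 400000 in
set_option synthInstance.maxSize 1000 in
theorem D₁_final_le {ε Hth : ℝ} (hSM : (Hth : EReal) ≤ smoothMinEntropy ε S.siftedAE) :
    D₁ S.pG S.final ≤
      (2 : ℝ) ^ (-(l : ℝ) + 1) + 2 * ε + (2 : ℝ) ^ (((m : ℝ) - Hth + 3) / 2) := by
  refine traceNorm_le_of_blocks (finalEquiv (Bits m) (E × T) (𝒰 × Bits c × Bits l) 𝒢)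
    (D := fun i => (S.pG i.2.1 * S.pU i.1.1 * (2 : ℝ) ^ (-(c : ℝ)) * (2 : ℝ) ^ (-(l : ℝ))) •
      (S.keyBlock true i.2.1 i.1.1 i.2.2.1 i.2.2.2 -
        (if i.2.2.1 = i.2.2.2 then (2 : ℝ) ^ (-(m : ℝ)) else 0) •
          (∑ a, S.correctA a + S.wrongState i.1.1))) ?_ ?_
  · rintro ⟨⟨u, x, y⟩, g, k, k'⟩ e ⟨⟨u₂, x₂, y₂⟩, g₂, k₂, k₂'⟩ e₂
    simp only [finalEquiv, Equiv.coe_fn_symm_mk, Matrix.sub_apply, Matrix.sum_apply,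
      Matrix.smul_apply, Matrix.kroneckerMap_apply, proj_apply, hashState_apply, Prod.mk.injEq,
      reduced_final_apply]
    rw [final, finalBranch_apply]
    by_cases hz : u = u₂ ∧ x = x₂ ∧ y = y₂
    swap
    · rw [if_neg (c := k = k₂ ∧ _) (fun h => hz ⟨h.2.2.1, h.2.2.2.1, h.2.2.2.2.1⟩),
        if_neg (c := _ ∧ g = g₂ ∧ _) (fun h => hz h.1)]
      simp only [if_neg hz, zero_mul, mul_zero, smul_zero, Finset.sum_const_zero, sub_zero]
    obtain ⟨rfl, rfl, rfl⟩ := hz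
    by_cases hg : g = g₂
    swap
    · simp only [hg, false_and, and_false, if_false, mul_zero, smul_zero, Finset.sum_const_zero,
        sub_zero]
    subst hg
    by_cases hk : k = k₂
    swap
    · simp only [hk, false_and, and_false, if_false, zero_mul, smul_zero, Finset.sum_const_zero,
        sub_zero]
    subst hk
    by_cases hk' : k' = k₂'
    swap
    · simp only [hk', false_and, and_false, if_false, mul_zero, zero_mul, smul_zero,
        Finset.sum_const_zero, sub_zero]
    subst hk'
    simp only [true_and, and_self, if_true]
    rw [Finset.sum_eq_single k (fun j _ hj => by rw [if_neg hj]; simp) (by simp)]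
    by_cases hkk : k = k'
    · simp only [hkk, if_true, Complex.real_smul]
      push_cast
      ring
    · simp only [hkk, if_false, Complex.real_smul]
      push_cast
      ring
  · intro V hV
    have hterm : ∀ z : 𝒰 × Bits c × Bits l, ∑ i : 𝒢 × Bits m × Bits m,
        (V (z, i) * ((S.pG i.1 * S.pU z.1 * (2 : ℝ) ^ (-(c : ℝ)) * (2 : ℝ) ^ (-(l : ℝ))) •
          (S.keyBlock true i.1 z.1 i.2.1 i.2.2 -
            (if i.2.1 = i.2.2 then (2 : ℝ) ^ (-(m : ℝ)) else 0) •
              (∑ a, S.correctA a + S.wrongState z.1)))).trace.re ≤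
        S.pU z.1 * (2 : ℝ) ^ (-(c : ℝ)) * (2 : ℝ) ^ (-(l : ℝ)) *
          ((2 * ε + (2 : ℝ) ^ (((m : ℝ) - Hth + 3) / 2)) + 2 * (S.wrongState z.1).trace.re) := by
      intro z
      have hz : 0 ≤ S.pU z.1 * (2 : ℝ) ^ (-(c : ℝ)) * (2 : ℝ) ^ (-(l : ℝ)) :=
        mul_nonneg (mul_nonneg (S.pU_prob.1 _) (by positivity)) (by positivity)
      refine le_trans (le_of_eq ?_) (mul_le_mul_of_nonneg_left (S.sum_keyBlock_dev_le hSM z.1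
        (V := fun g k k' => V (z, g, k, k')) fun g k k' => hV _) hz)
      simp only [Fintype.sum_prod_type, Matrix.mul_smul, Matrix.trace_smul, Complex.smul_re,
        smul_eq_mul, Finset.mul_sum]
      refine Finset.sum_congr rfl fun g _ => Finset.sum_congr rfl fun k _ =>
        Finset.sum_congr rfl fun k' _ => ?_
      ring
    rw [Fintype.sum_prod_type]
    refine (Finset.sum_le_sum fun z _ => hterm z).trans ?_
    have hsum : ∀ f : 𝒰 → ℝ, ∑ z : 𝒰 × Bits c × Bits l,
        S.pU z.1 * (2 : ℝ) ^ (-(c : ℝ)) * (2 : ℝ) ^ (-(l : ℝ)) * f z.1 = ∑ u, S.pU u * f u := by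
      intro f
      simp only [Fintype.sum_prod_type]
      refine Finset.sum_congr rfl fun u _ => ?_
      calc _ = ∑ _x : Bits c, ∑ _y : Bits l,
            S.pU u * f u * (2 : ℝ) ^ (-(c : ℝ)) * (2 : ℝ) ^ (-(l : ℝ)) :=
            Finset.sum_congr rfl fun _ _ => Finset.sum_congr rfl fun _ _ => by ring
        _ = _ := by simp only [← Finset.mul_sum, sum_bits_two_rpow_neg, mul_one]
    rw [hsum fun u => (2 * ε + (2 : ℝ) ^ (((m : ℝ) - Hth + 3) / 2)) + 2 * (S.wrongState u).trace.re]
    simp only [mul_add, Finset.sum_add_distrib]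
    simp only [← Finset.sum_mul, S.pU_prob.2, one_mul]
    have h1 := S.sum_re_trace_wrongState_le
    have h2 : ∑ u, S.pU u * (2 * (S.wrongState u).trace.re) =
        2 * ∑ u, S.pU u * (S.wrongState u).trace.re := by
      rw [Finset.mul_sum]
      exact Finset.sum_congr rfl fun u _ => by ring
    -- 2^{-l+1} is twice the bound 2^{-l} on the average weight of wrongly accepted keys.
    rw [Real.rpow_add (by norm_num), Real.rpow_one, h2]
    linarith

end Scheme

/-! ### Pauli operators and syndrome measurement -/

section Pauli

variable {n m : ℕ}

lemma sign_add (x y z : Bits n) : sign (x + y) z = sign x z * sign y z := by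
  simp only [sign, add_dotProduct, ← pow_add]
  rw [ZMod.val_add, ← neg_one_pow_eq_pow_mod_two]

lemma sign_comm (x z : Bits n) : sign x z = sign z x := by
  rw [sign, sign, dotProduct_comm]

lemma sign_mul_self (x z : Bits n) : sign x z * sign x z = 1 := by
  rw [sign, ← mul_pow]; simp

lemma star_sign (x z : Bits n) : star (sign x z) = sign x z := by
  simp [sign]

lemma sign_zero_left (z : Bits n) : sign 0 z = 1 := by
  simp [sign]

lemma sign_eq_neg_one {x z : Bits n} (h : x ⬝ᵥ z ≠ 0) : sign x z = -1 := by
  have h1 : ∀ a : ZMod 2, a ≠ 0 → a = 1 := by decide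
  simp [sign, h1 _ h, ZMod.val_one]

lemma sum_sign {x : Bits n} (hx : x ≠ 0) : ∑ z, sign x z = 0 := by
  obtain ⟨i, hi⟩ := Function.ne_iff.1 hx
  -- Flipping a bit where x is nonzero permutes the summands and changes their signs.
  have h1 : sign x (Pi.single i 1) = -1 := sign_eq_neg_one (by simpa using hi)
  have h2 : ∑ z, sign x z = -∑ z, sign x z := by
    conv_lhs => rw [← Equiv.sum_comp (Equiv.addRight (Pi.single i 1 : Bits n))]
    rw [← Finset.sum_neg_distrib]
    refine Finset.sum_congr rfl fun z _ => ?_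
    rw [Equiv.coe_addRight, sign_comm, sign_add, sign_comm z, sign_comm _ x, h1, mul_neg_one]
  exact self_eq_neg.1 h2

/-- The unitary with columns `|x̃⟩`. -/
def phaseBasis (n : ℕ) : Matrix (Bits n) (Bits n) ℂ := Matrix.of fun z x => phaseKet x z

lemma phaseKet_mul_star (x y z z' : Bits n) :
    phaseKet x z * star (phaseKet y z') = ((2 : ℝ) ^ (-(n : ℝ)) : ℝ) * (sign x z * sign y z') := by
  have h : ((2 : ℝ) ^ (-(n : ℝ) / 2)) * ((2 : ℝ) ^ (-(n : ℝ) / 2)) = (2 : ℝ) ^ (-(n : ℝ)) := by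
    rw [← Real.rpow_add (by norm_num)]; congr 1; ring
  have h' : (((2 : ℝ) ^ (-(n : ℝ) / 2) : ℝ) : ℂ) * (((2 : ℝ) ^ (-(n : ℝ) / 2) : ℝ) : ℂ) =
      ((2 : ℝ) ^ (-(n : ℝ)) : ℝ) := by exact_mod_cast h
  rw [← h', phaseKet, phaseKet, star_mul', star_sign, RCLike.star_def, Complex.conj_ofReal]
  ring

lemma phaseBasis_conjTranspose_mul : (phaseBasis n)ᴴ * phaseBasis n = 1 := by
  ext x y
  have h1 : ((phaseBasis n)ᴴ * phaseBasis n) x y = ∑ z, phaseKet y z * star (phaseKet x z) := by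
    simp only [Matrix.mul_apply, Matrix.conjTranspose_apply, phaseBasis, Matrix.of_apply, mul_comm]
  rw [h1]
  simp only [phaseKet_mul_star, ← Finset.mul_sum, ← sign_add, Matrix.one_apply]
  split_ifs with h
  · subst h
    have : x + x = 0 := by ext i; exact CharTwo.add_self_eq_zero _
    simp only [this, sign_zero_left, Finset.sum_const, Finset.card_univ, card_bits]
    have := two_rpow_neg_mul_two_pow n
    rw [nsmul_eq_mul, mul_one]
    exact_mod_cast this
  · rw [sum_sign, mul_zero]
    intro h0
    apply h
    have : x + x = 0 := by ext i; exact CharTwo.add_self_eq_zero _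
    exact add_right_cancel (this.trans h0.symm)

lemma phaseBasis_mul_conjTranspose : phaseBasis n * (phaseBasis n)ᴴ = 1 :=
  mul_eq_one_comm.1 phaseBasis_conjTranspose_mul

lemma syndromeProj_eq (h : Matrix (Fin (n - m)) (Fin n) (ZMod 2)) (s : Bits (n - m)) :
    syndromeProj h s = phaseBasis n * Matrix.diagonal (fun x => if h *ᵥ x = s then 1 else 0) *
      (phaseBasis n)ᴴ := by
  ext z z'
  rw [syndromeProj, Matrix.sum_apply, Matrix.mul_apply]
  refine Finset.sum_congr rfl fun x _ => ?_
  rw [Matrix.mul_diagonal]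
  split_ifs <;> simp [pureState, Matrix.vecMulVec_apply, phaseBasis]

lemma syndromeProj_mul_self (h : Matrix (Fin (n - m)) (Fin n) (ZMod 2)) (s : Bits (n - m)) :
    syndromeProj h s * syndromeProj h s = syndromeProj h s := by
  rw [syndromeProj_eq]
  calc _ = phaseBasis n * (Matrix.diagonal (fun x => if h *ᵥ x = s then 1 else 0) *
        (((phaseBasis n)ᴴ * phaseBasis n) *
          Matrix.diagonal (fun x => if h *ᵥ x = s then 1 else 0))) * (phaseBasis n)ᴴ := by
        simp only [Matrix.mul_assoc]
    _ = _ := by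
        rw [phaseBasis_conjTranspose_mul, Matrix.one_mul, Matrix.diagonal_mul_diagonal]
        congr 3
        ext x
        split_ifs <;> simp

lemma syndromeProj_isHermitian (h : Matrix (Fin (n - m)) (Fin n) (ZMod 2)) (s : Bits (n - m)) :
    (syndromeProj h s)ᴴ = syndromeProj h s := by
  rw [syndromeProj_eq, Matrix.conjTranspose_mul, Matrix.conjTranspose_mul,
    Matrix.conjTranspose_conjTranspose, Matrix.diagonal_conjTranspose, Matrix.mul_assoc]
  congr 3
  ext x
  simp [apply_ite]

lemma sum_syndromeProj (h : Matrix (Fin (n - m)) (Fin n) (ZMod 2)) :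
    ∑ s, syndromeProj h s = 1 := by
  simp only [syndromeProj_eq, ← Finset.sum_mul, ← Finset.mul_sum]
  have : ∑ s : Bits (n - m), Matrix.diagonal (fun x => if h *ᵥ x = s then (1 : ℂ) else 0) = 1 := by
    ext x y
    rw [Matrix.sum_apply]
    by_cases hxy : x = y
    · subst hxy; simp
    · simp [hxy]
  rw [this, Matrix.mul_one, phaseBasis_mul_conjTranspose]

/-- The syndrome measurement commutes with the measurement of the hash value. -/
lemma bitProj_mul_syndromeProj {g : Bits n →ₗ[ZMod 2] Bits m}
    {h : Matrix (Fin (n - m)) (Fin n) (ZMod 2)} (hg : IsCheckMatrix g h) (k : Bits m)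
    (s : Bits (n - m)) : bitProj g k * syndromeProj h s = syndromeProj h s * bitProj g k := by
  ext z z'
  rw [bitProj, Matrix.diagonal_mul, Matrix.mul_diagonal]
  by_cases hz : g z = g z'
  · rw [hz, mul_comm]
  suffices h0 : syndromeProj h s z z' = 0 by rw [h0, mul_zero, zero_mul]
  obtain ⟨i, hi⟩ := Function.ne_iff.1 hz
  -- A row of g on which z and z' have different values. Since h r = 0, the shift x ↦ x + r
  -- preserves the syndrome, but it reverses the sign of each summand in the matrix element, which
  -- therefore vanishes.
  set r : Bits n := LinearMap.toMatrix' g i with hr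
  have hrz : ∀ v, r ⬝ᵥ v = g v i := fun v => by
    conv_rhs => rw [← LinearMap.toMatrix'_mulVec g v]
    rfl
  have hhr : h *ᵥ r = 0 := by
    ext j
    have := congrFun (congrFun hg.2 j) i
    simpa [Matrix.mul_apply, Matrix.mulVec, dotProduct, hr] using this
  have hsign : sign r z * sign r z' = -1 := by
    have h2 : ∀ a b : ZMod 2, a ≠ b → a + b ≠ 0 := by decide
    rw [sign_comm r z, sign_comm r z', ← sign_add, sign_comm]
    apply sign_eq_neg_one
    rw [dotProduct_add, hrz, hrz]
    exact h2 _ _ hi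
  have hent : syndromeProj h s z z' = ∑ x, (if h *ᵥ x = s then (1 : ℂ) else 0) *
      (((2 : ℝ) ^ (-(n : ℝ)) : ℝ) * (sign x z * sign x z')) := by
    rw [syndromeProj, Matrix.sum_apply]
    refine Finset.sum_congr rfl fun x _ => ?_
    rw [← phaseKet_mul_star]
    split_ifs <;> simp [pureState, Matrix.vecMulVec_apply]
  have hneg : syndromeProj h s z z' = -syndromeProj h s z z' := by
    conv_lhs => rw [hent, ← Equiv.sum_comp (Equiv.addRight r)]
    rw [hent, ← Finset.sum_neg_distrib]
    refine Finset.sum_congr rfl fun x _ => ?_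
    rw [Equiv.coe_addRight, Matrix.mulVec_add, hhr, add_zero, sign_add, sign_add,
      mul_mul_mul_comm (sign x z), hsign]
    ring
  exact self_eq_neg.1 hneg

lemma pauliZ_conj_bitProj (g : Bits n →ₗ[ZMod 2] Bits m) (k : Bits m) (e : Bits n) :
    (pauliZ e)ᴴ * bitProj g k * pauliZ e = bitProj g k := by
  rw [pauliZ, bitProj, Matrix.diagonal_conjTranspose, Matrix.diagonal_mul_diagonal,
    Matrix.diagonal_mul_diagonal]
  congr 1
  ext z
  simp only [Pi.star_apply, star_sign]
  rw [mul_right_comm, sign_mul_self, one_mul]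

lemma bitProj_mul_self (g : Bits n →ₗ[ZMod 2] Bits m) (k : Bits m) :
    bitProj g k * bitProj g k = bitProj g k := by
  simp [bitProj, Matrix.diagonal_mul_diagonal]

lemma bitProj_isHermitian (g : Bits n →ₗ[ZMod 2] Bits m) (k : Bits m) :
    (bitProj g k)ᴴ = bitProj g k := by
  rw [bitProj, Matrix.diagonal_conjTranspose]
  congr 1
  ext x
  simp [apply_ite]

lemma sum_bitProj (g : Bits n →ₗ[ZMod 2] Bits m) : ∑ k, bitProj g k = 1 := by
  ext x y
  rw [Matrix.sum_apply]
  by_cases hxy : x = y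
  · subst hxy; simp [bitProj]
  · simp [bitProj, hxy]

lemma bitProj_mul_of_ne (g : Bits n →ₗ[ZMod 2] Bits m) {k k' : Bits m} (h : k ≠ k') :
    bitProj g k * bitProj g k' = 0 := by
  ext x y
  rw [bitProj, bitProj, Matrix.diagonal_mul_diagonal]
  by_cases hxy : x = y
  · subst hxy
    simp only [Matrix.diagonal_apply_eq, Matrix.zero_apply]
    by_cases h1 : g x = k
    · rw [if_neg (c := g x = k') (h1 ▸ h), mul_zero]
    · rw [if_neg h1, zero_mul]
  · simp [hxy]

/-- |0̃⟩ is the uniform superposition, so this is the proportion of strings in the fiber over k. -/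
lemma sum_star_phaseKet_zero (g : Bits n →ₗ[ZMod 2] Bits m) (hg : Function.Surjective g)
    (k : Bits m) : star (phaseKet (0 : Bits n)) ⬝ᵥ (bitProj g k *ᵥ phaseKet 0) =
      ((2 : ℝ) ^ (-(m : ℝ)) : ℝ) := by
  have h1 : star (phaseKet (0 : Bits n)) ⬝ᵥ (bitProj g k *ᵥ phaseKet 0) =
      ((2 : ℝ) ^ (-(n : ℝ)) : ℝ) * ∑ a, (((if g a = k then (1 : ℝ) else 0) : ℝ) : ℂ) := by
    rw [dotProduct, Finset.mul_sum]
    refine Finset.sum_congr rfl fun a _ => ?_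
    have h2 := phaseKet_mul_star (0 : Bits n) 0 a a
    rw [sign_zero_left, mul_one, mul_one] at h2
    rw [bitProj, Matrix.mulVec_diagonal, Pi.star_apply, ← h2]
    split_ifs
    · push_cast; ring
    · push_cast; ring
  rw [h1, ← Complex.ofReal_sum, sum_fiber_eq g hg, ← Complex.ofReal_mul]
  congr 1
  have := two_rpow_neg_mul_two_pow n
  rw [← mul_assoc, this, one_mul]

end Pauli

/-! ### Phase errors bound the distance from a uniform key -/

section PhaseError

variable {n m : ℕ} {F : Type*} [Fintype F] [DecidableEq F]

lemma posSemidef_bitProj (g : Bits n →ₗ[ZMod 2] Bits m) (k : Bits m) :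
    (bitProj g k).PosSemidef := by
  have h := Matrix.posSemidef_conjTranspose_mul_self (bitProj g k)
  rwa [bitProj_isHermitian, bitProj_mul_self] at h

/-- Contractions controlled by the hash value form a contraction. -/
lemma isContraction_sum_bitProj (g : Bits n →ₗ[ZMod 2] Bits m) {V : Bits m → Matrix F F ℂ}
    (hV : ∀ k, IsContraction (V k)) : IsContraction (∑ k, bitProj g k ⊗ₖ V k) := by
  have h1 : (∑ k, bitProj g k ⊗ₖ V k) * (∑ k, bitProj g k ⊗ₖ V k)ᴴ =
      ∑ k, bitProj g k ⊗ₖ (V k * (V k)ᴴ) := by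
    rw [Matrix.conjTranspose_sum, Finset.sum_mul_sum]
    refine Finset.sum_congr rfl fun k _ => ?_
    rw [Finset.sum_eq_single k]
    · rw [Matrix.conjTranspose_kronecker, bitProj_isHermitian, ← Matrix.mul_kronecker_mul,
        bitProj_mul_self]
    · intro k' _ hk'
      rw [Matrix.conjTranspose_kronecker, bitProj_isHermitian, ← Matrix.mul_kronecker_mul,
        bitProj_mul_of_ne g hk'.symm, Matrix.zero_kronecker]
    · simp
  have h2 : 1 - (∑ k, bitProj g k ⊗ₖ V k) * (∑ k, bitProj g k ⊗ₖ V k)ᴴ =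
      ∑ k, bitProj g k ⊗ₖ (1 - V k * (V k)ᴴ) := by
    have h3 : (1 : Matrix (Bits n × F) (Bits n × F) ℂ) = ∑ k, bitProj g k ⊗ₖ (1 : Matrix F F ℂ) := by
      rw [← Matrix.one_kronecker_one, ← sum_bitProj g]
      ext ⟨x, y⟩ ⟨x', y'⟩
      simp only [Matrix.sum_apply, Matrix.kroneckerMap_apply, Finset.sum_mul]
    rw [h1, h3, ← Finset.sum_sub_distrib]
    refine Finset.sum_congr rfl fun k _ => ?_
    ext ⟨x, y⟩ ⟨x', y'⟩
    simp only [Matrix.sub_apply, Matrix.kroneckerMap_apply, mul_sub]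
  rw [IsContraction, h2]
  exact Matrix.posSemidef_sum _ fun k _ => (posSemidef_bitProj g k).kronecker (hV k)

lemma isContraction_one_kronecker {α : Type*} [Fintype α] [DecidableEq α] {V : Matrix F F ℂ}
    (hV : IsContraction V) : IsContraction ((1 : Matrix α α ℂ) ⊗ₖ V) := by
  have : 1 - ((1 : Matrix α α ℂ) ⊗ₖ V) * ((1 : Matrix α α ℂ) ⊗ₖ V)ᴴ =
      (1 : Matrix α α ℂ) ⊗ₖ (1 - V * Vᴴ) := by
    rw [Matrix.conjTranspose_kronecker, ← Matrix.mul_kronecker_mul, Matrix.conjTranspose_one,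
      Matrix.one_mul, ← Matrix.one_kronecker_one]
    ext ⟨x, y⟩ ⟨x', y'⟩
    simp only [Matrix.sub_apply, Matrix.kroneckerMap_apply, mul_sub]
  rw [IsContraction, this]
  exact Matrix.PosSemidef.one.kronecker hV

lemma isContraction_kronecker_one {α : Type*} [Fintype α] [DecidableEq α] {V : Matrix F F ℂ}
    (hV : IsContraction V) : IsContraction (V ⊗ₖ (1 : Matrix α α ℂ)) := by
  have : 1 - (V ⊗ₖ (1 : Matrix α α ℂ)) * (V ⊗ₖ (1 : Matrix α α ℂ))ᴴ =
      (1 - V * Vᴴ) ⊗ₖ (1 : Matrix α α ℂ) := by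
    rw [Matrix.conjTranspose_kronecker, ← Matrix.mul_kronecker_mul, Matrix.conjTranspose_one,
      Matrix.one_mul, ← Matrix.one_kronecker_one]
    ext ⟨x, y⟩ ⟨x', y'⟩
    simp only [Matrix.sub_apply, Matrix.kroneckerMap_apply, sub_mul]
  rw [IsContraction, this]
  exact Matrix.PosSemidef.kronecker hV Matrix.PosSemidef.one

lemma pureState_mul_mul_pureState {α : Type*} [Fintype α] (v : α → ℂ) (M : Matrix α α ℂ) :
    pureState v * M * pureState v = (star v ⬝ᵥ (M *ᵥ v)) • pureState v := by
  rw [pureState, Matrix.vecMulVec_mul, Matrix.vecMulVec_mul_vecMulVec, Matrix.vecMulVec_smul,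
    Matrix.dotProduct_mulVec]

lemma trace_pureState_mul {α : Type*} [Fintype α] (v : α → ℂ) (M : Matrix α α ℂ) :
    (pureState v * M).trace = star v ⬝ᵥ (M *ᵥ v) := by
  rw [pureState, Matrix.vecMulVec_mul, Matrix.trace_vecMulVec, dotProduct_comm,
    Matrix.dotProduct_mulVec]

lemma pureState_phaseKet_mul_self (x : Bits n) :
    pureState (phaseKet x) * pureState (phaseKet x) = pureState (phaseKet x) := by
  have h : star (phaseKet x) ⬝ᵥ phaseKet x = 1 := by
    have := congrFun (congrFun (phaseBasis_conjTranspose_mul (n := n)) x) x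
    simpa [Matrix.mul_apply, phaseBasis, dotProduct] using this
  have h1 := pureState_mul_mul_pureState (phaseKet x) 1
  rwa [Matrix.mul_one, Matrix.one_mulVec, h, one_smul] at h1

lemma isContraction_pureState_phaseKet (x : Bits n) : IsContraction (pureState (phaseKet x)) := by
  have hH : (pureState (phaseKet x))ᴴ = pureState (phaseKet x) :=
    (Matrix.posSemidef_vecMulVec_self_star _).isHermitian
  have hP := pureState_phaseKet_mul_self x
  set q := pureState (phaseKet x)
  have h : 1 - q * qᴴ = (1 - q)ᴴ * (1 - q) := by
    rw [Matrix.conjTranspose_sub, hH, Matrix.conjTranspose_one, Matrix.mul_sub,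
      Matrix.sub_mul 1 q q, hP]
    simp
  rw [IsContraction, h]
  exact Matrix.posSemidef_conjTranspose_mul_self _

lemma trace_kronecker_one_mul {α : Type*} [Fintype α] [DecidableEq α] (X : Matrix α α ℂ)
    (ω : Matrix (α × F) (α × F) ℂ) :
    ((X ⊗ₖ (1 : Matrix F F ℂ)) * ω).trace = (X * trSnd ω).trace := by
  simp only [Matrix.trace, Matrix.diag_apply, Matrix.mul_apply, Matrix.kroneckerMap_apply, trSnd,
    Fintype.sum_prod_type, Finset.mul_sum, Matrix.one_apply, mul_ite, mul_one, mul_zero, ite_mul,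
    zero_mul, Finset.sum_ite_eq, Finset.mem_univ, if_true]
  refine Finset.sum_congr rfl fun a _ => Finset.sum_comm

/-- Needed to square the root of the phase error probability in `Scheme.d₁_virtualFinal_le`. -/
lemma one_sub_phase_nonneg {ω : Matrix (Bits n × F) (Bits n × F) ℂ} (hω : IsSubnormalized ω) :
    0 ≤ 1 - (star (phaseKet 0) ⬝ᵥ (trSnd ω *ᵥ phaseKet 0)).re := by
  have h := re_trace_contraction_posSemidef_le
    (isContraction_kronecker_one (α := F) (isContraction_pureState_phaseKet (0 : Bits n))) hω.1
  rw [trace_kronecker_one_mul, trace_pureState_mul] at h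
  linarith [hω.2]

/-- Gentle measurement of the phase: the distance of the hash value from uniform is bounded by the
phase error probability. -/
lemma sum_trace_bitProj_dev_le {g : Bits n →ₗ[ZMod 2] Bits m} (hg : Function.Surjective g)
    {V : Bits m → Matrix F F ℂ} (hV : ∀ k, IsContraction (V k))
    {ω : Matrix (Bits n × F) (Bits n × F) ℂ} (hω : IsSubnormalized ω) :
    ∑ k, ((((bitProj g k ⊗ₖ V k) * ω).trace.re) -
      (2 : ℝ) ^ (-(m : ℝ)) * (((1 : Matrix (Bits n) (Bits n) ℂ) ⊗ₖ V k) * ω).trace.re) ≤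
      2 * √2 * √(1 - (star (phaseKet 0) ⬝ᵥ (trSnd ω *ᵥ phaseKet 0)).re) := by
  set q : Matrix (Bits n) (Bits n) ℂ := pureState (phaseKet 0) with hq
  set Q : Matrix (Bits n × F) (Bits n × F) ℂ := q ⊗ₖ 1 with hQ
  set R := CFC.sqrt ω with hR
  have hRR : R * Rᴴ = ω := by rw [hR, (isHermitian_sqrt ω).eq, sqrt_mul_sqrt hω.1]
  have hqH : qᴴ = q := (Matrix.posSemidef_vecMulVec_self_star _).isHermitian
  -- Inside the projection onto |0̃⟩ the hash value is exactly uniform, so the term BB† has no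
  -- deviation at all.
  have hqb : ∀ k, q * bitProj g k * q = (2 : ℝ) ^ (-(m : ℝ)) • q := fun k => by
    rw [hq, pureState_mul_mul_pureState, sum_star_phaseKet_zero g hg k]
    ext x y
    simp
  have hqq : q * q = q := pureState_phaseKet_mul_self 0
  have hQH : Qᴴ = Q := by rw [hQ, Matrix.conjTranspose_kronecker, hqH, Matrix.conjTranspose_one]
  have hQQ : Q * Q = Q := by rw [hQ, ← Matrix.mul_kronecker_mul, hqq, Matrix.one_mul]
  set B := Q * R with hB
  set N := R - Q * R with hN
  have hRBN : R = B + N := by rw [hB, hN]; abel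
  have hQN : Q * N = 0 := by
    rw [hN, Matrix.mul_sub, ← Matrix.mul_assoc, hQQ, sub_self]
  have hBH : Bᴴ = Rᴴ * Q := by rw [hB, Matrix.conjTranspose_mul, hQH]
  have hNQ : Nᴴ * Q = 0 := by
    rw [← hQH, ← Matrix.conjTranspose_mul, hQN, Matrix.conjTranspose_zero]
  set V₁ : Matrix (Bits n × F) (Bits n × F) ℂ := ∑ k, bitProj g k ⊗ₖ V k with hV₁
  have hV₁c : IsContraction V₁ := isContraction_sum_bitProj g hV
  have hcomm : ∀ k, Q * ((1 : Matrix (Bits n) (Bits n) ℂ) ⊗ₖ V k) =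
      ((1 : Matrix (Bits n) (Bits n) ℂ) ⊗ₖ V k) * Q := fun k => by
    rw [hQ, ← Matrix.mul_kronecker_mul, ← Matrix.mul_kronecker_mul]
    simp
  have hexp : ∀ W : Matrix (Bits n × F) (Bits n × F) ℂ, (W * ω).trace =
      (W * (B * Bᴴ)).trace + (W * (B * Nᴴ)).trace + (W * (N * Bᴴ)).trace + (W * (N * Nᴴ)).trace := by
    intro W
    rw [← hRR]
    conv_lhs => rw [hRBN]
    simp only [Matrix.conjTranspose_add, Matrix.mul_add, Matrix.add_mul, Matrix.trace_add]
    ring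
  -- In the ideal state the test operators act trivially on A and commute with Q, so they cannot
  -- couple B = QR with N = (1 − Q)R.
  have hcross1 : ∀ k, (((1 : Matrix (Bits n) (Bits n) ℂ) ⊗ₖ V k) * (B * Nᴴ)).trace = 0 := fun k => by
    have : ((1 : Matrix (Bits n) (Bits n) ℂ) ⊗ₖ V k) * (B * Nᴴ) =
        Q * (((1 : Matrix (Bits n) (Bits n) ℂ) ⊗ₖ V k) * R * Nᴴ) := by
      rw [hB]
      simp only [← Matrix.mul_assoc]
      rw [hcomm k]
    rw [this, Matrix.trace_mul_comm, Matrix.mul_assoc, hNQ, Matrix.mul_zero, Matrix.trace_zero]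
  have hcross2 : ∀ k, (((1 : Matrix (Bits n) (Bits n) ℂ) ⊗ₖ V k) * (N * Bᴴ)).trace = 0 := fun k => by
    rw [hBH, ← Matrix.mul_assoc, ← Matrix.mul_assoc, Matrix.trace_mul_comm]
    simp only [← Matrix.mul_assoc]
    rw [hcomm k]
    simp only [Matrix.mul_assoc]
    rw [← Matrix.mul_assoc Q N, hQN]
    simp
  have hdiag : ∀ k, ((bitProj g k ⊗ₖ V k) * (B * Bᴴ)).trace.re =
      (2 : ℝ) ^ (-(m : ℝ)) * (((1 : Matrix (Bits n) (Bits n) ℂ) ⊗ₖ V k) * (B * Bᴴ)).trace.re := by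
    intro k
    have h1 : ∀ X : Matrix (Bits n) (Bits n) ℂ, ((X ⊗ₖ V k) * (B * Bᴴ)).trace =
        (((q * X * q) ⊗ₖ V k) * ω).trace := fun X => by
      have : (q * X * q) ⊗ₖ V k = Q * (X ⊗ₖ V k) * Q := by
        rw [hQ, ← Matrix.mul_kronecker_mul, ← Matrix.mul_kronecker_mul]
        simp
      rw [this, ← hRR, hBH, hB]
      simp only [Matrix.mul_assoc]
      rw [Matrix.trace_mul_comm Q]
      simp only [Matrix.mul_assoc]
    rw [h1, h1, hqb, Matrix.mul_one, hqq, Matrix.smul_kronecker, Matrix.smul_mul,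
      Matrix.trace_smul, Complex.smul_re, smul_eq_mul]
  have hsum : ∑ k, ((((bitProj g k ⊗ₖ V k) * ω).trace.re) -
      (2 : ℝ) ^ (-(m : ℝ)) * (((1 : Matrix (Bits n) (Bits n) ℂ) ⊗ₖ V k) * ω).trace.re) =
      (V₁ * (B * Nᴴ)).trace.re + (V₁ * (N * Bᴴ)).trace.re + (V₁ * (N * Nᴴ)).trace.re +
      ∑ k, (2 : ℝ) ^ (-(m : ℝ)) *
        -(((1 : Matrix (Bits n) (Bits n) ℂ) ⊗ₖ V k) * (N * Nᴴ)).trace.re := by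
    simp only [hV₁, Finset.sum_mul, Matrix.trace_sum, Complex.re_sum, ← Finset.sum_add_distrib]
    refine Finset.sum_congr rfl fun k _ => ?_
    rw [hexp, hexp, hcross1, hcross2]
    simp only [Complex.add_re, Complex.zero_re, hdiag]
    ring
  set s := √(hsNormSq N) with hs
  set t := √(hsNormSq B) with ht
  have hs2 : s ^ 2 = hsNormSq N := Real.sq_sqrt (hsNormSq_nonneg _)
  have ht2 : t ^ 2 = hsNormSq B := Real.sq_sqrt (hsNormSq_nonneg _)
  have hs0 : 0 ≤ s := Real.sqrt_nonneg _
  have ht0 : 0 ≤ t := Real.sqrt_nonneg _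
  have b1 : (V₁ * (B * Nᴴ)).trace.re ≤ t * s := by
    have := re_trace_contraction_mul_le hV₁c B Nᴴ
    rwa [hsNormSq_conjTranspose] at this
  have b2 : (V₁ * (N * Bᴴ)).trace.re ≤ s * t := by
    have := re_trace_contraction_mul_le hV₁c N Bᴴ
    rwa [hsNormSq_conjTranspose] at this
  have hNN := Matrix.posSemidef_self_mul_conjTranspose N
  have b3 : (V₁ * (N * Nᴴ)).trace.re ≤ s ^ 2 := by
    rw [hs2, ← re_trace_mul_conjTranspose]
    exact re_trace_contraction_posSemidef_le hV₁c hNN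
  have b4 : ∑ k, (2 : ℝ) ^ (-(m : ℝ)) *
        -(((1 : Matrix (Bits n) (Bits n) ℂ) ⊗ₖ V k) * (N * Nᴴ)).trace.re ≤ s ^ 2 := by
    calc _ ≤ ∑ _k : Bits m, (2 : ℝ) ^ (-(m : ℝ)) * s ^ 2 := by
          refine Finset.sum_le_sum fun k _ => mul_le_mul_of_nonneg_left ?_ (by positivity)
          rw [hs2, ← re_trace_mul_conjTranspose]
          exact neg_re_trace_contraction_posSemidef_le (isContraction_one_kronecker (hV k)) hNN
      _ = _ := by rw [← Finset.sum_mul, sum_bits_two_rpow_neg, one_mul]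
  have hBt : t ^ 2 = (star (phaseKet 0) ⬝ᵥ (trSnd ω *ᵥ phaseKet 0)).re := by
    rw [ht2, ← re_trace_mul_conjTranspose, ← trace_pureState_mul, ← trace_kronecker_one_mul, hBH,
      hB, Matrix.mul_assoc, ← Matrix.mul_assoc R, hRR, Matrix.trace_mul_comm, Matrix.mul_assoc, hQQ,
      Matrix.trace_mul_comm]
  have htot : s ^ 2 + t ^ 2 ≤ 1 := by
    have h := hexp 1
    simp only [Matrix.one_mul] at h
    have h1 : (B * Nᴴ).trace = 0 := by
      rw [hB, Matrix.trace_mul_comm, ← Matrix.mul_assoc, hNQ, Matrix.zero_mul, Matrix.trace_zero]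
    have h2 : (N * Bᴴ).trace = 0 := by
      rw [hBH, ← Matrix.mul_assoc, Matrix.trace_mul_comm, ← Matrix.mul_assoc, hQN, Matrix.zero_mul,
        Matrix.trace_zero]
    rw [h1, h2, trace_mul_conjTranspose, trace_mul_conjTranspose] at h
    have h3 := hω.2
    rw [h] at h3
    simp only [Complex.add_re, Complex.zero_re, Complex.ofReal_re] at h3
    linarith
  have hsP : s ≤ √(1 - (star (phaseKet 0) ⬝ᵥ (trSnd ω *ᵥ phaseKet 0)).re) := by
    rw [← hBt]
    apply Real.le_sqrt_of_sq_le
    linarith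
  -- The deviation is at most 2st + 2s² = 2s(s + t). With s² + t² ≤ 1 this gives 2√2 s, and s² is at
  -- most the phase error probability.
  have hst : s + t ≤ √2 := by
    apply Real.le_sqrt_of_sq_le
    nlinarith [sq_nonneg (s - t)]
  rw [hsum]
  calc _ ≤ 2 * (s * (s + t)) := by nlinarith
    _ ≤ 2 * (√(1 - (star (phaseKet 0) ⬝ᵥ (trSnd ω *ᵥ phaseKet 0)).re) * √2) := by gcongr
    _ = _ := by ring

end PhaseError

/-! ### The virtual scheme -/

section Virtual

variable {n m : ℕ} {E C : Type*} [Fintype E] [DecidableEq E] [Fintype C] [DecidableEq C]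

/-- Passing to observables of Eve makes it possible to move the phase error correction onto the
observable. -/
lemma trace_mul_trSnd_trFst {α : Type*} [Fintype α] [DecidableEq α] (Y : Matrix E E ℂ)
    (Z : Matrix (α × E × C) (α × E × C) ℂ) :
    (Y * trSnd (trFst Z)).trace =
      (((1 : Matrix α α ℂ) ⊗ₖ (Y ⊗ₖ (1 : Matrix C C ℂ))) * Z).trace := by
  simp only [Matrix.trace, Matrix.diag_apply, Matrix.mul_apply, Matrix.kroneckerMap_apply, trSnd,
    trFst, Fintype.sum_prod_type, Finset.mul_sum, Matrix.one_apply, mul_ite, mul_one, mul_zero,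
    ite_mul, one_mul, zero_mul, Finset.sum_ite_eq, Finset.sum_ite_irrel, Finset.sum_const_zero,
    Finset.mem_univ, if_true]
  calc _ = ∑ e, ∑ z, ∑ e', ∑ a, Y e e' * Z (a, e', z) (a, e, z) :=
        Finset.sum_congr rfl fun e _ => Finset.sum_comm
    _ = ∑ e, ∑ z, ∑ a, ∑ e', Y e e' * Z (a, e', z) (a, e, z) :=
        Finset.sum_congr rfl fun e _ => Finset.sum_congr rfl fun z _ => Finset.sum_comm
    _ = ∑ e, ∑ a, ∑ z, ∑ e', Y e e' * Z (a, e', z) (a, e, z) :=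
        Finset.sum_congr rfl fun e _ => Finset.sum_comm
    _ = _ := Finset.sum_comm

/-- The state of Eve when the hash value is `k`, tested against an observable. -/
lemma trace_mul_bitProj_block (g : Bits n →ₗ[ZMod 2] Bits m) (k : Bits m) (Y : Matrix E E ℂ)
    (ρ : Matrix (Bits n × E × C) (Bits n × E × C) ℂ) :
    (Y * trSnd (trFst ((bitProj g k ⊗ₖ (1 : Matrix (E × C) (E × C) ℂ)) * ρ *
      (bitProj g k ⊗ₖ (1 : Matrix (E × C) (E × C) ℂ))))).trace =
      ((bitProj g k ⊗ₖ (Y ⊗ₖ (1 : Matrix C C ℂ))) * ρ).trace := by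
  rw [trace_mul_trSnd_trFst, ← Matrix.mul_assoc, Matrix.trace_mul_comm, ← Matrix.mul_assoc,
    ← Matrix.mul_assoc, ← Matrix.mul_kronecker_mul, ← Matrix.mul_kronecker_mul]
  simp only [Matrix.one_mul, Matrix.mul_one, bitProj_mul_self]

lemma posSemidef_pureState {α : Type*} [Fintype α] (v : α → ℂ) : (pureState v).PosSemidef :=
  Matrix.posSemidef_vecMulVec_self_star v

lemma posSemidef_pec (h : Matrix (Fin (n - m)) (Fin n) (ZMod 2))
    (M : Bits (n - m) → Bits n → Matrix C C ℂ) {ρ : Matrix (Bits n × E × C) (Bits n × E × C) ℂ}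
    (hρ : ρ.PosSemidef) : (pec h M ρ).PosSemidef :=
  Matrix.posSemidef_sum _ fun _ _ => Matrix.posSemidef_sum _ fun _ _ =>
    hρ.mul_mul_conjTranspose_same _

/-- Phase error correction does not change the joint state of the hash value and Eve. -/
lemma trace_bitProj_mul_pec {g : Bits n →ₗ[ZMod 2] Bits m}
    {h : Matrix (Fin (n - m)) (Fin n) (ZMod 2)} (hg : IsCheckMatrix g h)
    {M : Bits (n - m) → Bits n → Matrix C C ℂ} (hM : ∀ s, ∑ e, (M s e)ᴴ * M s e = 1)
    (k : Bits m) (Y : Matrix E E ℂ) (ρ : Matrix (Bits n × E × C) (Bits n × E × C) ℂ) :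
    ((bitProj g k ⊗ₖ (Y ⊗ₖ (1 : Matrix C C ℂ))) * pec h M ρ).trace =
      ((bitProj g k ⊗ₖ (Y ⊗ₖ (1 : Matrix C C ℂ))) * ρ).trace := by
  -- In the Heisenberg picture the phase flip drops out because it is diagonal, and the syndrome
  -- projection drops out after summing over s because it commutes with the hash measurement.
  have hK : ∀ s e, (pauliZ e * syndromeProj h s)ᴴ * bitProj g k * (pauliZ e * syndromeProj h s) =
      bitProj g k * syndromeProj h s := fun s e => by
    calc _ = syndromeProj h s * ((pauliZ e)ᴴ * bitProj g k * pauliZ e) * syndromeProj h s := by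
          rw [Matrix.conjTranspose_mul, syndromeProj_isHermitian]
          simp only [Matrix.mul_assoc]
      _ = _ := by
          rw [pauliZ_conj_bitProj, ← bitProj_mul_syndromeProj hg, Matrix.mul_assoc,
            syndromeProj_mul_self]
  have hterm : ∀ s e, ((bitProj g k ⊗ₖ (Y ⊗ₖ (1 : Matrix C C ℂ))) *
      (((pauliZ e * syndromeProj h s) ⊗ₖ ((1 : Matrix E E ℂ) ⊗ₖ M s e)) * ρ *
        ((pauliZ e * syndromeProj h s) ⊗ₖ ((1 : Matrix E E ℂ) ⊗ₖ M s e))ᴴ)).trace =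
      (((bitProj g k * syndromeProj h s) ⊗ₖ (Y ⊗ₖ ((M s e)ᴴ * M s e))) * ρ).trace := fun s e => by
    rw [← Matrix.mul_assoc, Matrix.trace_mul_comm, ← Matrix.mul_assoc, ← Matrix.mul_assoc,
      Matrix.conjTranspose_kronecker, Matrix.conjTranspose_kronecker, ← Matrix.mul_kronecker_mul,
      ← Matrix.mul_kronecker_mul, ← Matrix.mul_kronecker_mul, ← Matrix.mul_kronecker_mul, hK]
    simp only [Matrix.conjTranspose_one, Matrix.one_mul, Matrix.mul_one]
  simp only [pec, Finset.mul_sum, Matrix.trace_sum, hterm]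
  simp only [← Matrix.trace_sum, ← Finset.sum_mul]
  congr 2
  have h1 : ∀ s, ∑ e, (bitProj g k * syndromeProj h s) ⊗ₖ (Y ⊗ₖ ((M s e)ᴴ * M s e)) =
      (bitProj g k * syndromeProj h s) ⊗ₖ (Y ⊗ₖ (1 : Matrix C C ℂ)) := fun s => by
    rw [← hM s]
    ext ⟨x, y, z⟩ ⟨x', y', z'⟩
    simp only [Matrix.sum_apply, Matrix.kroneckerMap_apply, Finset.mul_sum]
  simp only [h1]
  have h2 : bitProj g k = ∑ s, bitProj g k * syndromeProj h s := by
    rw [← Finset.mul_sum, sum_syndromeProj, Matrix.mul_one]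
  conv_rhs => rw [h2]
  ext ⟨x, y, z⟩ ⟨x', y', z'⟩
  simp only [Matrix.sum_apply, Matrix.kroneckerMap_apply, Finset.sum_mul]

lemma zMeasure_apply (ρ : Matrix (Bits n × E) (Bits n × E) ℂ) (a : Bits n) (e : E) (a' : Bits n)
    (e' : E) : zMeasure ρ (a, e) (a', e') = if a = a' then ρ (a, e) (a', e') else 0 := by
  have hd : ∀ z : Bits n, proj z ⊗ₖ (1 : Matrix E E ℂ) =
      Matrix.diagonal fun x => if z = x.1 then 1 else 0 := fun z => by
    ext ⟨x, y⟩ ⟨x', y'⟩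
    simp only [Matrix.kroneckerMap_apply, proj_apply, Matrix.one_apply, Matrix.diagonal_apply,
      Prod.mk.injEq]
    by_cases h1 : x = x' <;> by_cases h2 : y = y' <;> simp [h1, h2]
  simp only [zMeasure, hd, Matrix.sum_apply, Matrix.mul_diagonal, Matrix.diagonal_mul]
  by_cases h : a = a'
  · subst h; simp
  · rw [if_neg h]
    refine Finset.sum_eq_zero fun z _ => ?_
    by_cases h1 : z = a
    · subst h1; simp [h]
    · simp [h1]

lemma twirl_apply (φ : Bits n × E × C → ℂ) (a : Bits n) (e : E) (z : C) (t : Bits n) :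
    twirl φ (a, e, (z, t)) = if t = a then φ (a, e, z) else 0 := by
  simp [twirl, pauliX]

/-- The ancilla T holds a copy of the Z value of A, so tracing it out decoheres A in the Z basis. -/
lemma reducedAE_twirl (φ : Bits n × E × C → ℂ) : reducedAE (twirl φ) = zMeasure (reducedAE φ) := by
  ext ⟨a, e⟩ ⟨a', e'⟩
  rw [zMeasure_apply]
  simp only [reducedAE, pureState, Matrix.vecMulVec_apply, Pi.star_apply, Fintype.sum_prod_type,
    twirl_apply]
  split_ifs with h
  · subst h
    refine Finset.sum_congr rfl fun z _ => ?_
    rw [Finset.sum_eq_single a (fun t _ ht => by simp [ht]) (by simp)]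
    simp
  · refine Finset.sum_eq_zero fun z _ => Finset.sum_eq_zero fun t _ => ?_
    by_cases ht : t = a
    · subst ht; simp [h]
    · simp [ht]

/-- The hash projection is diagonal, so after tracing out A only the blocks diagonal in a
contribute. -/
lemma trSnd_trFst_bitProj_pureState (g : Bits n →ₗ[ZMod 2] Bits m) (k : Bits m)
    (ψ : Bits n × E × C → ℂ) :
    trSnd (trFst ((bitProj g k ⊗ₖ (1 : Matrix (E × C) (E × C) ℂ)) * pureState ψ *
      (bitProj g k ⊗ₖ (1 : Matrix (E × C) (E × C) ℂ)))) =
      ∑ a, (if g a = k then (1 : ℝ) else 0) • diagBlock (reducedAE ψ) a := by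
  have hd : bitProj g k ⊗ₖ (1 : Matrix (E × C) (E × C) ℂ) =
      Matrix.diagonal fun x => if g x.1 = k then 1 else 0 := by
    ext ⟨x, y⟩ ⟨x', y'⟩
    simp only [Matrix.kroneckerMap_apply, bitProj, Matrix.one_apply, Matrix.diagonal_apply,
      Prod.mk.injEq]
    by_cases h1 : x = x' <;> by_cases h2 : y = y' <;> simp [h1, h2]
  ext e e'
  simp only [hd, trSnd, trFst, Matrix.mul_diagonal, Matrix.diagonal_mul, Matrix.sum_apply,
    Matrix.smul_apply, diagBlock, Matrix.submatrix_apply, reducedAE]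
  rw [Finset.sum_comm]
  refine Finset.sum_congr rfl fun a _ => ?_
  by_cases h : g a = k <;> simp [h]

end Virtual

/-! ### Comparison of the virtual with the actual scheme. -/

namespace Scheme

variable {n m l c : ℕ} {A' B' E T R I J 𝒰 𝒢 : Type*}
  [Fintype A'] [DecidableEq A'] [Fintype B'] [DecidableEq B'] [Fintype E] [DecidableEq E]
  [Fintype T] [DecidableEq T] [Fintype R] [DecidableEq R] [Fintype I] [Fintype J]
  [Fintype 𝒰] [DecidableEq 𝒰] [Fintype 𝒢] [DecidableEq 𝒢]
  (S : Scheme n m l c A' B' E T R I J 𝒰 𝒢)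
  {C : Type*} [Fintype C] [DecidableEq C] {φ : Bits n × (E × T) × C → ℂ}
  {h : 𝒢 → Matrix (Fin (n - m)) (Fin n) (ZMod 2)}
  {M : 𝒢 → Bits (n - m) → Bits n → Matrix (C × Bits n) (C × Bits n) ℂ}

lemma isPurification_twirl (hφ : IsSemiPurification φ S.siftedAE) :
    IsPurification (twirl φ) S.siftedAE :=
  (reducedAE_twirl φ).trans hφ

/-- Eve's state in the virtual scheme, given the hash value. -/
lemma trSnd_trFst_bitProj_pec (hφ : IsSemiPurification φ S.siftedAE)
    (hh : ∀ g, IsCheckMatrix (S.g g) (h g)) (hM : ∀ g s, ∑ e, (M g s e)ᴴ * M g s e = 1) (g : 𝒢)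
    (k : Bits m) :
    trSnd (trFst ((bitProj (S.g g) k ⊗ₖ
        (1 : Matrix ((E × T) × (C × Bits n)) ((E × T) × (C × Bits n)) ℂ)) *
      pec (h g) (M g) (pureState (twirl φ)) * (bitProj (S.g g) k ⊗ₖ
        (1 : Matrix ((E × T) × (C × Bits n)) ((E × T) × (C × Bits n)) ℂ)))) =
      ∑ a, (if S.g g a = k then (1 : ℝ) else 0) • S.siftedA a := by
  have hpur : reducedAE (twirl φ) = cqState S.siftedA :=
    (S.isPurification_twirl hφ).trans S.siftedAE_eq
  have h1 := trSnd_trFst_bitProj_pureState (S.g g) k (twirl φ)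
  simp only [hpur, diagBlock_cqState] at h1
  -- Equality is tested against all observables Y of Eve, which do not see the correction.
  rw [← h1, Matrix.ext_iff_trace_mul_left]
  intro Y
  rw [trace_mul_bitProj_block, trace_mul_bitProj_block, trace_bitProj_mul_pec (hh g) (hM g)]

lemma virtualFinal_apply (hφ : IsSemiPurification φ S.siftedAE)
    (hh : ∀ g, IsCheckMatrix (S.g g) (h g)) (hM : ∀ g s, ∑ e, (M g s e)ᴴ * M g s e = 1)
    (k : Bits m) (e : E × T) (g : 𝒢) (k₂ : Bits m) (e₂ : E × T) (g₂ : 𝒢) :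
    S.virtualFinal h M φ (k, e, g) (k₂, e₂, g₂) = if k = k₂ ∧ g = g₂ then
      (S.pG g : ℂ) * (∑ a, (if S.g g a = k then (1 : ℝ) else 0) • S.siftedA a) e e₂ else 0 := by
  have hb : ∀ γ, bitMeasure (S.g γ) (pec (h γ) (M γ) (pureState (twirl φ))) (k, e) (k₂, e₂) =
      if k = k₂ then (∑ a, (if S.g γ a = k then (1 : ℝ) else 0) • S.siftedA a) e e₂ else 0 :=
    fun γ => by
      simp only [bitMeasure, S.trSnd_trFst_bitProj_pec hφ hh hM]
      exact cqState_apply _ k e k₂ e₂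
  simp only [virtualFinal, Matrix.submatrix_apply, Equiv.prodAssoc_symm_apply, Matrix.sum_apply,
    Matrix.smul_apply, Matrix.kroneckerMap_apply, hb, proj_apply]
  by_cases hg : g = g₂
  · subst hg
    rw [Finset.sum_eq_single g (fun γ _ hγ => by simp [hγ]) (by simp)]
    by_cases hk : k = k₂ <;> simp [hk]
  · simp [hg]

theorem virtualFinal_eq (hφ : IsSemiPurification φ S.siftedAE)
    (hh : ∀ g, IsCheckMatrix (S.g g) (h g)) (hM : ∀ g s, ∑ e, (M g s e)ᴴ * M g s e = 1) :
    S.virtualFinal h M φ = S.finalAlice := by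
  ext ⟨k, e, g⟩ ⟨k₂, e₂, g₂⟩
  rw [S.virtualFinal_apply hφ hh hM, finalAlice_apply]

/-- Summing over the hash outcomes shows that Eve's marginal survives the correction. The case Y = 1
gives the trace of the corrected state. -/
lemma trace_one_kronecker_mul_pec (hφ : IsSemiPurification φ S.siftedAE)
    (hh : ∀ g, IsCheckMatrix (S.g g) (h g)) (hM : ∀ g s, ∑ e, (M g s e)ᴴ * M g s e = 1) (g : 𝒢)
    (Y : Matrix (E × T) (E × T) ℂ) :
    (((1 : Matrix (Bits n) (Bits n) ℂ) ⊗ₖ (Y ⊗ₖ (1 : Matrix (C × Bits n) (C × Bits n) ℂ))) *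
      pec (h g) (M g) (pureState (twirl φ))).trace = (Y * ∑ a, S.siftedA a).trace := by
  rw [← sum_hash (S.g g) S.siftedA, Finset.mul_sum, Matrix.trace_sum]
  simp only [← S.trSnd_trFst_bitProj_pec hφ hh hM, trace_mul_bitProj_block]
  rw [← Matrix.trace_sum, ← Finset.sum_mul]
  congr 2
  rw [← sum_bitProj (S.g g)]
  ext ⟨x, y⟩ ⟨x', y'⟩
  simp only [Matrix.sum_apply, Matrix.kroneckerMap_apply, Finset.sum_mul]

lemma isSubnormalized_pec (hφ : IsSemiPurification φ S.siftedAE)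
    (hh : ∀ g, IsCheckMatrix (S.g g) (h g)) (hM : ∀ g s, ∑ e, (M g s e)ᴴ * M g s e = 1) (g : 𝒢) :
    IsSubnormalized (pec (h g) (M g) (pureState (twirl φ))) := by
  refine ⟨posSemidef_pec _ _ (posSemidef_pureState _), ?_⟩
  have h1 := S.trace_one_kronecker_mul_pec hφ hh hM g 1
  rw [Matrix.one_kronecker_one, Matrix.one_kronecker_one, Matrix.one_mul, Matrix.one_mul] at h1
  rw [h1]
  simpa [siftedA, Matrix.trace_sum] using S.sum_re_trace_siftedBlock_le

theorem d₁_virtualFinal_le (hφ : IsSemiPurification φ S.siftedAE)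
    (hh : ∀ g, IsCheckMatrix (S.g g) (h g)) (hM : ∀ g s, ∑ e, (M g s e)ᴴ * M g s e = 1) :
    d₁ S.pG (S.virtualFinal h M φ) ≤ 2 * √2 * √(∑ g, S.pG g *
      phaseError (pec (h g) (M g) (pureState (twirl φ)))) := by
  set P : 𝒢 → ℝ := fun g => phaseError (pec (h g) (M g) (pureState (twirl φ))) with hP
  refine d₁_le S.pG_prob (ρE := ∑ a, S.siftedA a) (S.virtualFinal_apply hφ hh hM)
    (fun g => sum_hash (S.g g) S.siftedA) fun V hV => ?_
  have hterm : ∀ g, ∑ k, (V g k * (∑ a, (if S.g g a = k then (1 : ℝ) else 0) • S.siftedA a -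
      (2 : ℝ) ^ (-(m : ℝ)) • ∑ a, S.siftedA a)).trace.re ≤ 2 * √2 * √(P g) := by
    intro g
    refine le_trans (le_of_eq ?_) (sum_trace_bitProj_dev_le (S.g_surj g)
      (fun k => isContraction_kronecker_one (α := C × Bits n) (hV g k))
      (S.isSubnormalized_pec hφ hh hM g))
    refine Finset.sum_congr rfl fun k _ => ?_
    rw [S.trace_one_kronecker_mul_pec hφ hh hM, ← trace_mul_bitProj_block,
      S.trSnd_trFst_bitProj_pec hφ hh hM, Matrix.mul_sub, Matrix.mul_smul, Matrix.trace_sub,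
      Matrix.trace_smul, Complex.sub_re, Complex.smul_re, smul_eq_mul]
  have hP0 : ∀ g, 0 ≤ P g := fun g => one_sub_phase_nonneg (S.isSubnormalized_pec hφ hh hM g)
  calc _ ≤ ∑ g, S.pG g * (2 * √2 * √(P g)) :=
        Finset.sum_le_sum fun g _ => mul_le_mul_of_nonneg_left (hterm g) (S.pG_prob.1 g)
    -- Concavity of the square root, in the form of Cauchy–Schwarz with weights p, moves the average
    -- over g under the root.
    _ = 2 * √2 * ∑ g, √(S.pG g) * (√(S.pG g) * √(P g)) := by
        rw [Finset.mul_sum]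
        refine Finset.sum_congr rfl fun g _ => ?_
        rw [← mul_assoc (√(S.pG g)), Real.mul_self_sqrt (S.pG_prob.1 g)]
        ring
    _ ≤ 2 * √2 * (√(∑ g, √(S.pG g) ^ 2) * √(∑ g, (√(S.pG g) * √(P g)) ^ 2)) := by
        gcongr
        exact Real.sum_mul_le_sqrt_mul_sqrt _ _ _
    _ = _ := by
        simp only [mul_pow, Real.sq_sqrt (S.pG_prob.1 _), Real.sq_sqrt (hP0 _), S.pG_prob.2,
          Real.sqrt_one, one_mul]
        rfl

end Scheme

/-! ### Purification of the initial state and preparation of a semi-purification -/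

section Purification

variable {α β γ : Type*} [Fintype α] [DecidableEq α] [Fintype β] [DecidableEq β] [Fintype γ]

lemma exists_purification {ρ : Matrix α α ℂ} (hρ : ρ.PosSemidef) :
    ∃ ψ : α × α → ℂ, trSnd (pureState ψ) = ρ := by
  -- The canonical purification: the entries of √ρ read as a vector, so that tracing out the second
  -- factor gives √ρ √ρ†.
  refine ⟨fun x => CFC.sqrt ρ x.1 x.2, ?_⟩
  conv_rhs => rw [← sqrt_mul_sqrt hρ]
  conv_rhs => enter [2]; rw [← (isHermitian_sqrt ρ).eq]
  rfl

/-- The discarded part of the first system only enters through `X† X`. -/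
lemma trFst_conj (X : Matrix γ α ℂ) (ρ : Matrix (α × β) (α × β) ℂ) :
    trFst ((X ⊗ₖ (1 : Matrix β β ℂ)) * ρ * (X ⊗ₖ (1 : Matrix β β ℂ))ᴴ) =
      trFst (((Xᴴ * X) ⊗ₖ (1 : Matrix β β ℂ)) * ρ) := by
  ext e e'
  simp only [trFst, Matrix.mul_apply, Matrix.kroneckerMap_apply, Matrix.conjTranspose_apply,
    Matrix.one_apply, Fintype.sum_prod_type, mul_ite, mul_one, mul_zero, ite_mul, zero_mul,
    Finset.sum_ite_eq, Finset.mem_univ, if_true, apply_ite star, star_zero, Finset.sum_mul]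
  calc _ = ∑ x, ∑ z, ∑ w, X x w * ρ (w, e) (z, e') * star (X x z) := rfl
    _ = ∑ z, ∑ x, ∑ w, X x w * ρ (w, e) (z, e') * star (X x z) := Finset.sum_comm
    _ = ∑ z, ∑ w, ∑ x, X x w * ρ (w, e) (z, e') * star (X x z) :=
      Finset.sum_congr rfl fun z _ => Finset.sum_comm
    _ = _ := by
      refine Finset.sum_congr rfl fun z _ => Finset.sum_congr rfl fun w _ =>
        Finset.sum_congr rfl fun x _ => ?_
      ring

end Purification

namespace Scheme

variable {n m l c : ℕ} {A' B' E T R I J 𝒰 𝒢 : Type*}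
  [Fintype A'] [DecidableEq A'] [Fintype B'] [DecidableEq B'] [Fintype E] [DecidableEq E]
  [Fintype T] [DecidableEq T] [Fintype R] [DecidableEq R] [Fintype I] [Fintype J]
  [Fintype 𝒰] [DecidableEq 𝒰] [Fintype 𝒢] [DecidableEq 𝒢]
  (S : Scheme n m l c A' B' E T R I J 𝒰 𝒢)

/-- Alice's sifted key state does not depend on Bob's measurement. -/
lemma siftedA_eq (a : Bits n) : S.siftedA a = ∑ i, ∑ r ∈ S.accept,
    trFst (((((S.sifA a i ⊗ₖ (1 : Matrix B' B' ℂ)) * S.smp r) ⊗ₖ announce E (S.ann r)) * S.ini) *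
      (((S.sifA a i ⊗ₖ (1 : Matrix B' B' ℂ)) * S.smp r) ⊗ₖ announce E (S.ann r))ᴴ) := by
  -- Bob's system is traced out, so his measurement operators enter only through their sum, which is
  -- the identity.
  have h1 : ∀ i, ∑ b, ∑ j, trFst (((S.sifA a i ⊗ₖ S.sifB b j) ⊗ₖ
      (1 : Matrix (E × T) (E × T) ℂ)) * S.sampled *
        ((S.sifA a i ⊗ₖ S.sifB b j) ⊗ₖ (1 : Matrix (E × T) (E × T) ℂ))ᴴ) =
      trFst (((S.sifA a i ⊗ₖ (1 : Matrix B' B' ℂ)) ⊗ₖ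
      (1 : Matrix (E × T) (E × T) ℂ)) * S.sampled *
        ((S.sifA a i ⊗ₖ (1 : Matrix B' B' ℂ)) ⊗ₖ (1 : Matrix (E × T) (E × T) ℂ))ᴴ) := by
    intro i
    simp only [trFst_conj]
    simp only [Matrix.conjTranspose_kronecker, ← Matrix.mul_kronecker_mul, ← trFst_sum,
      ← Finset.sum_mul]
    congr 2
    rw [Matrix.conjTranspose_one, Matrix.one_mul, ← S.sifB_sum]
    ext ⟨⟨x, y⟩, z⟩ ⟨⟨x', y'⟩, z'⟩
    simp only [Matrix.sum_apply, Matrix.kroneckerMap_apply, Finset.sum_mul, Finset.mul_sum]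
  have h2 : S.siftedA a = ∑ i, ∑ b, ∑ j, trFst (((S.sifA a i ⊗ₖ S.sifB b j) ⊗ₖ
      (1 : Matrix (E × T) (E × T) ℂ)) * S.sampled *
        ((S.sifA a i ⊗ₖ S.sifB b j) ⊗ₖ (1 : Matrix (E × T) (E × T) ℂ))ᴴ) := by
    simp only [siftedA, siftedBlock, trFst_sum]
    exact Finset.sum_comm
  rw [h2]
  refine Finset.sum_congr rfl fun i _ => ?_
  rw [h1, sampled, Finset.mul_sum, Finset.sum_mul, trFst_sum]
  refine Finset.sum_congr rfl fun r _ => ?_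
  have h3 : ((S.sifA a i ⊗ₖ (1 : Matrix B' B' ℂ)) * S.smp r) ⊗ₖ announce E (S.ann r) =
      ((S.sifA a i ⊗ₖ (1 : Matrix B' B' ℂ)) ⊗ₖ (1 : Matrix (E × T) (E × T) ℂ)) *
        (S.smp r ⊗ₖ announce E (S.ann r)) := by
    rw [← Matrix.mul_kronecker_mul, Matrix.one_mul]
  rw [h3, Matrix.conjTranspose_mul]
  simp only [Matrix.mul_assoc]

theorem isSemiPurification_prepared {P : Type*} [Fintype P] {ψ : ((A' × B') × E) × P → ℂ}
    (hψ : trSnd (pureState ψ) = S.ini) : IsSemiPurification (S.prepared ψ) S.siftedAE := by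
  -- Read as a matrix, the purification factors the initial state as ΨΨ†. Each branch of outcomes
  -- then acts on Ψ from the left, and the prepared vector lists the entries of these products.
  set Ψ : Matrix ((A' × B') × E) P ℂ := Matrix.of fun x p => ψ (x, p) with hΨ
  have hini : S.ini = Ψ * Ψᴴ := by rw [← hψ]; rfl
  have hL : ∀ a i r z e t p, ((((S.sifA a i ⊗ₖ (1 : Matrix B' B' ℂ)) * S.smp r) ⊗ₖ
      announce E (S.ann r)) * Ψ) (z, (e, t)) p = if t = S.ann r then
        ∑ z', ((S.sifA a i ⊗ₖ (1 : Matrix B' B' ℂ)) * S.smp r) z z' * ψ ((z', e), p) else 0 := by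
    intro a i r z e t p
    rw [Matrix.mul_apply, Fintype.sum_prod_type]
    split_ifs with ht
    · refine Finset.sum_congr rfl fun z' _ => ?_
      rw [Finset.sum_eq_single e (fun x _ hx => by
        simp [Matrix.kroneckerMap_apply, announce, hx.symm]) (by simp)]
      simp [Matrix.kroneckerMap_apply, announce, ht, hΨ]
    · refine Finset.sum_eq_zero fun z' _ => Finset.sum_eq_zero fun x _ => ?_
      simp [Matrix.kroneckerMap_apply, announce, ht]
  rw [IsSemiPurification, siftedAE_eq]
  ext ⟨a, e, t⟩ ⟨a', e', t'⟩
  rw [zMeasure_apply, cqState_apply]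
  split_ifs with ha
  swap
  · rfl
  subst ha
  rw [siftedA_eq]
  have hR : ∀ i r, trFst (((((S.sifA a i ⊗ₖ (1 : Matrix B' B' ℂ)) * S.smp r) ⊗ₖ
      announce E (S.ann r)) * S.ini) * (((S.sifA a i ⊗ₖ (1 : Matrix B' B' ℂ)) * S.smp r) ⊗ₖ
        announce E (S.ann r))ᴴ) (e, t) (e', t') = ∑ z, ∑ p,
      (if t = S.ann r then ∑ z', ((S.sifA a i ⊗ₖ (1 : Matrix B' B' ℂ)) * S.smp r) z z' *
        ψ ((z', e), p) else 0) *
      star (if t' = S.ann r then ∑ z', ((S.sifA a i ⊗ₖ (1 : Matrix B' B' ℂ)) * S.smp r) z z' *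
        ψ ((z', e'), p) else 0) := by
    intro i r
    rw [hini, ← Matrix.mul_assoc, Matrix.mul_assoc, ← Matrix.conjTranspose_mul, trFst]
    refine Finset.sum_congr rfl fun z _ => ?_
    rw [Matrix.mul_apply]
    refine Finset.sum_congr rfl fun p _ => ?_
    rw [Matrix.conjTranspose_apply, hL, hL]
  simp only [Matrix.sum_apply, hR]
  have hlhs : reducedAE (S.prepared ψ) (a, (e, t)) (a, (e', t')) = ∑ z, ∑ p, ∑ r, ∑ i,
      if r ∈ S.accept then
        (if t = S.ann r then ∑ z', ((S.sifA a i ⊗ₖ (1 : Matrix B' B' ℂ)) * S.smp r) z z' *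
          ψ ((z', e), p) else 0) *
        star (if t' = S.ann r then ∑ z', ((S.sifA a i ⊗ₖ (1 : Matrix B' B' ℂ)) * S.smp r) z z' *
          ψ ((z', e'), p) else 0) else 0 := by
    simp only [reducedAE, pureState, Matrix.vecMulVec_apply, Pi.star_apply]
    rw [Fintype.sum_prod_type]
    refine Finset.sum_congr rfl fun z _ => ?_
    rw [Fintype.sum_prod_type]
    refine Finset.sum_congr rfl fun p _ => ?_
    rw [Fintype.sum_prod_type]
    refine Finset.sum_congr rfl fun r _ => Finset.sum_congr rfl fun i _ => ?_
    simp only [prepared]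
    by_cases hr : r ∈ S.accept <;> simp only [hr, true_and, false_and, if_true, if_false, zero_mul]
  rw [hlhs, sum_sum_comm, Finset.sum_comm]
  refine Finset.sum_congr rfl fun i _ => ?_
  -- Tracing out the recorded outcomes makes the branches incoherent, and rejected outcomes
  -- contribute zero.
  rw [← Finset.sum_subset (Finset.subset_univ S.accept) (fun r _ hr => by
    simp only [if_neg hr, Finset.sum_const_zero])]
  refine Finset.sum_congr rfl fun r hr => ?_
  simp only [if_pos hr]

end Scheme

end QKD

end

theorem mainTheorem4 {n m l c : ℕ} {A' B' E T R I J 𝒰 𝒢 : Type*}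
    [Fintype A'] [DecidableEq A'] [Fintype B'] [DecidableEq B'] [Fintype E] [DecidableEq E]
    [Fintype T] [DecidableEq T] [Fintype R] [DecidableEq R] [Fintype I] [Fintype J]
    [Fintype 𝒰] [DecidableEq 𝒰] [Fintype 𝒢] [DecidableEq 𝒢]
    (S : QKD.Scheme n m l c A' B' E T R I J 𝒰 𝒢) (ε Hth : ℝ)
    (hSM : (Hth : EReal) ≤ QKD.smoothMinEntropy ε S.siftedAE) :
    -- security of the actual scheme
    QKD.D₁ S.pG S.final ≤
      (2 : ℝ) ^ (-(l : ℝ) + 1) + 2 * ε + (2 : ℝ) ^ (((m : ℝ) - Hth + 3) / 2) ∧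
    -- purification of the initial state and preparation of a semi-purification of the sifted key
    (∃ ψ : ((A' × B') × E) × ((A' × B') × E) → ℂ, QKD.trSnd (QKD.pureState ψ) = S.ini) ∧
    (∀ (P : Type*) [Fintype P] (ψ : ((A' × B') × E) × P → ℂ),
      QKD.trSnd (QKD.pureState ψ) = S.ini →
        QKD.IsSemiPurification (S.prepared ψ) S.siftedAE) ∧
    -- the virtual scheme with twirling and embedded phase error correction
    (∀ (C : Type*) [Fintype C] [DecidableEq C] (φ : QKD.Bits n × (E × T) × C → ℂ)
      (h : 𝒢 → Matrix (Fin (n - m)) (Fin n) (ZMod 2))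
      (M : 𝒢 → QKD.Bits (n - m) → QKD.Bits n → Matrix (C × QKD.Bits n) (C × QKD.Bits n) ℂ),
      QKD.IsSemiPurification φ S.siftedAE →
      (∀ g, QKD.IsCheckMatrix (S.g g) (h g)) →
      (∀ g s, ∑ e, (M g s e)ᴴ * M g s e = 1) →
        QKD.IsPurification (QKD.twirl φ) S.siftedAE ∧
        S.virtualFinal h M φ = S.finalAlice ∧
        QKD.d₁ S.pG (S.virtualFinal h M φ) ≤
          2 * √2 * √(∑ g, S.pG g *
            QKD.phaseError (QKD.pec (h g) (M g) (QKD.pureState (QKD.twirl φ)))) ∧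
        QKD.d₁ S.pG (S.virtualFinal h M φ) ≤
          2 * ε + (2 : ℝ) ^ (((m : ℝ) - Hth + 3) / 2)) := by
  refine ⟨S.D₁_final_le hSM, QKD.exists_purification S.ini_sub.1,
    fun P _ ψ hψ => S.isSemiPurification_prepared hψ, fun C _ _ φ h M hφ hh hM => ?_⟩
  refine ⟨S.isPurification_twirl hφ, S.virtualFinal_eq hφ hh hM, S.d₁_virtualFinal_le hφ hh hM, ?_⟩
  rw [S.virtualFinal_eq hφ hh hM]
  exact S.d₁_finalAlice_le hSM
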